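/- **Setting.** For $p>1$ let $Q_p(x)=\big(\tfrac{p+1}{2}\operatorname{sech}^2(\tfrac{p-1}{2}x)\big)^{1/(p-1)}$ be the soliton profile of the one-dimensional equation $i\partial_t\psi=-\partial_x^2\psi-|\psi|^{p-1}\psi$, and let $$\mathcal L_p=\sigma_3\big(-\partial_x^2+1+V^{(p)}\big),\qquad V^{(p)}=-\tfrac12\begin{pmatrix}p+1&p-1\\p-1&p+1\end{pmatrix}Q_p^{p-1},\qquad \sigma_3=\begin{pmatrix}1&0\\0&-1\end{pmatrix},$$ be the linearized operator about the soliton, on $L^2=L^2(\mathbb R,\mathbb C^2)$ with domain $H^2$ and essential spectrum $(-\infty,-1]\cup[1,\infty)$. Write $Q=Q_3=\sqrt2\,\operatorname{sech}x$, $B=\begin{pmatrix}2&1\\1&2\end{pmatrix}$, $E=\begin{pmatrix}1&1\\1&1\end{pmatrix}$, $$q_1=\operatorname{sech}^2x\,(\tfrac12-2x\tanh x),\qquad q_2=\tfrac12\big(2x^2\tanh^2x\operatorname{sech}^2x-x^2\operatorname{sech}^4x-x\tanh x\operatorname{sech}^2x\big),$$ $$V_0=V^{(3)}=-BQ^2,\quad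 V_1=-\tfrac12EQ^2-Bq_1,\quad V_2=-\tfrac12Eq_1-Bq_2,\quad |V_0|^{1/2}=\tfrac12\begin{pmatrix}\sqrt3+1&\sqrt3-1\\\sqrt3-1&\sqrt3+1\end{pmatrix}Q .$$ For $0<\alpha<\sqrt2$ let $R^{(\alpha)}=\operatorname{diag}\big((-\partial_x^2+\alpha^2)^{-1},(-\partial_x^2+2-\alpha^2)^{-1}\big)$, and let $R_{-1},R_0,R_1$ be the operators with integral kernels $$\operatorname{diag}(\tfrac12,0),\qquad \operatorname{diag}\big(-\tfrac{|x-y|}2,\tfrac{e^{-\sqrt2|x-y|}}{2\sqrt2}\big),\qquad \operatorname{diag}\big(\tfrac{|x-y|^2}4,0\big),$$ which are the coefficients of $\alpha^{-1},\alpha^0,\alpha^1$ in the expansion of the kernel of $R^{(\alpha)}$. Put $$K_{\alpha,\varepsilon}=|V_0|^{1/2}R^{(\alpha)}V^{(3+\varepsilon)}|V_0|^{-1/2},\qquad K_{jk}=|V_0|^{1/2}R_jV_k|V_0|^{-1/2}.$$ Let $v=|V_0|^{1/2}(1,0)^T$, let $P$ be the orthogonal projection of $L^2$ onto the span of $v$,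 $\overline P=1-P$, and let $w_0=|V_0|^{1/2}u_0$, where $u_0=(2-Q^2,-Q^2)^T$ is the threshold resonance of the cubic problem ($\mathcal L_3u_0=u_0$). Let $T=\overline P(K_{00}+1)\overline P$ and let $T^{-1}$ denote its inverse on $\{v,w_0\}^\perp$. Define successively $$w_1=\tfrac14K_{-11}w_0-T^{-1}g_1,\qquad g_1=\tfrac14\overline PK_{00}K_{-11}w_0+\overline PK_{01}w_0,$$ $$\alpha_2=\frac{-\frac14\langle w_0,K_{00}K_{-11}w_1\rangle-\frac14\langle w_0,K_{00}K_{-12}w_0\rangle-\langle w_0,K_{01}w_1\rangle-\langle w_0,K_{02}w_0\rangle}{\langle w_0,K_{10}w_0\rangle+\frac14\langle w_0,K_{00}(K_{00}+1)w_0\rangle},$$ $$w_2=\tfrac14\big(K_{-11}w_1+K_{-12}w_0+\alpha_2(K_{00}+1)w_0\big)-T^{-1}g_2,$$ $$g_2=\tfrac14\overline PK_{00}K_{-11}w_1+\tfrac14\overline PK_{00}K_{-12}w_0+\tfrac{\alpha_2}4\overline PK_{00}(K_{00}+1)w_0+\overline PK_{01}w_1+\overline PK_{02}w_0+\alpha_2\overline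 PK_{10}w_0 .$$ **Theorem.** These quantities are well defined: for every $g\in\{v,w_0\}^\perp\subset L^2$ the equation $Tf=g$ has exactly one solution $f\in\{v,w_0\}^\perp$, and $g_1,g_2\in\{v,w_0\}^\perp$. The number $\alpha_2$ is real and $\alpha_2>0$. There are $\varepsilon_0>0$ and $C>0$ such that for every real $\varepsilon$ with $0<|\varepsilon|\le\varepsilon_0$ the Birman–Schwinger problem $(K_{\alpha,\varepsilon}+1)w=0$ has a solution $\alpha>0$, $w\in L^2$ with $$|\alpha-\varepsilon^2\alpha_2|<C|\varepsilon|^3,\qquad \|w-(w_0+\varepsilon w_1+\varepsilon^2w_2)\|_{L^2}<C|\varepsilon|^3 .$$ Moreover, with $p=3+\varepsilon$, the function $u=|V_0|^{-1/2}w$ is a nonzero element of $H^2(\mathbb R,\mathbb C^2)$ with $\mathcal L_pu=(1-\alpha^2)u$, where $1-\alpha^2\in(-1,1)$ and $|(1-\alpha^2)-(1-\alpha_2^2(p-3)^4)|<C|\varepsilon|^5$. Thus $\mathcal L_p$ has a true eigenvalue just inside the gap, for $p$ on both sides of $3$. -/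

import Mathlib

open MeasureTheory
open scoped Matrix ENNReal ContDiff

namespace NearCubicNLS

noncomputable section

/-! ### Vectors, matrices, the Hilbert space `L²(ℝ, ℂ²)` -/

/-- `ℂ²` with its Hermitian norm. -/
abbrev Vec : Type := EuclideanSpace ℂ (Fin 2)

/-- Real `2 × 2` matrices. -/
abbrev Mat : Type := Matrix (Fin 2) (Fin 2) ℝ

/-- A real matrix applied to a vector of `ℂ²`. -/
def act (M : Mat) (z : Vec) : Vec :=
  WithLp.toLp 2 (M.map (fun r : ℝ => (r : ℂ)) *ᵥ WithLp.ofLp z)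

/-- Membership in `L²(ℝ, ℂ²)`. -/
def IsL2 (f : ℝ → Vec) : Prop := MemLp f 2 volume

/-- The inner product of `L²(ℝ, ℂ²)`, conjugate linear in the first argument. -/
def ip (f g : ℝ → Vec) : ℂ := ∫ x : ℝ, inner ℂ (f x) (g x)

/-! ### The soliton and the linearized operator -/

/-- The hyperbolic secant. -/
def sech (x : ℝ) : ℝ := 1 / Real.cosh x

/-- The soliton profile `Q_p`, for `p > 1`. -/
def soliton (p x : ℝ) : ℝ := ((p + 1) / 2 * sech ((p - 1) / 2 * x) ^ 2) ^ (1 / (p - 1))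

/-- The matrix potential `V^{(p)} = -(1/2) (p+1, p-1; p-1, p+1) Q_p^{p-1}`. -/
def potential (p x : ℝ) : Mat :=
  (-(1 / 2) * soliton p x ^ (p - 1)) • !![p + 1, p - 1; p - 1, p + 1]

/-- The Pauli matrix `σ₃`. -/
def sigma3 : Mat := !![1, 0; 0, -1]

/-- `g` is the weak derivative of `f` on `ℝ`. -/
def HasWeakDeriv (f g : ℝ → Vec) : Prop :=
  ∀ φ : ℝ → ℝ, ContDiff ℝ ∞ φ → HasCompactSupport φ →
    ∫ x : ℝ, deriv φ x • f x = -∫ x : ℝ, φ x • g x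

/-- The graph of the unbounded operator `𝓛_p = σ₃ (-∂ₓ² + 1 + V^{(p)})` on `L²(ℝ, ℂ²)` with domain
`H²(ℝ, ℂ²)`: `u` has weak derivatives `u'`, `u''`, all three are in `L²`, and `𝓛_p u = f`
almost everywhere. -/
def LinearizedGraph (p : ℝ) (u f : ℝ → Vec) : Prop :=
  IsL2 u ∧ ∃ u' u'' : ℝ → Vec, IsL2 u' ∧ IsL2 u'' ∧ HasWeakDeriv u u' ∧ HasWeakDeriv u' u'' ∧
    ∀ᵐ x : ℝ, f x = act sigma3 (-u'' x + u x + act (potential p x) (u x))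

/-- `u` is an `L²` eigenfunction of `𝓛_p` with eigenvalue `z`. -/
def IsEigenfunction (p : ℝ) (z : ℂ) (u : ℝ → Vec) : Prop :=
  LinearizedGraph p u (fun x => z • u x) ∧ ¬ ∀ᵐ x : ℝ, u x = 0

/-! ### Potential expansion around the cubic case -/

/-- The cubic soliton. -/
def Q (x : ℝ) : ℝ := soliton 3 x

/-- First Taylor coefficient of `Q_p^{p-1}` in `p - 3`. -/
def q1 (x : ℝ) : ℝ := sech x ^ 2 * (1 / 2 - 2 * x * Real.tanh x)

/-- Second Taylor coefficient of `Q_p^{p-1}` in `p - 3`. -/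
def q2 (x : ℝ) : ℝ :=
  1 / 2 * (2 * x ^ 2 * Real.tanh x ^ 2 * sech x ^ 2 - x ^ 2 * sech x ^ 4
    - x * Real.tanh x * sech x ^ 2)

def V0 (x : ℝ) : Mat := -(Q x ^ 2 • !![2, 1; 1, 2])

def V1 (x : ℝ) : Mat := -((1 / 2 * Q x ^ 2) • !![1, 1; 1, 1]) - q1 x • !![2, 1; 1, 2]

def V2 (x : ℝ) : Mat := -((1 / 2 * q1 x) • !![1, 1; 1, 1]) - q2 x • !![2, 1; 1, 2]

/-- The positive matrix square root `|V₀|^{1/2}`, where `|V₀| = -V₀`. -/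
def sqrtAbsV0 (x : ℝ) : Mat :=
  (1 / 2 * Q x) • !![√3 + 1, √3 - 1; √3 - 1, √3 + 1]

/-- `V₀` is the potential of the cubic problem. -/
theorem potential_three (x : ℝ) : potential 3 x = V0 x := by
  ext i j
  fin_cases i <;> fin_cases j <;> norm_num [potential, V0, Q] <;> ring

theorem sqrtAbsV0_mul_self (x : ℝ) : sqrtAbsV0 x * sqrtAbsV0 x = -V0 x := by
  have h : (√3 : ℝ) * √3 = 3 := Real.mul_self_sqrt (by norm_num)
  ext i j
  fin_cases i <;> fin_cases j <;>
    simp [sqrtAbsV0, V0, Matrix.mul_apply, Fin.sum_univ_two] <;> grind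

theorem Q_pos (x : ℝ) : 0 < Q x := by
  have := Real.cosh_pos ((3 - 1) / 2 * x)
  unfold Q soliton sech
  positivity

/-- `|V₀|^{1/2}` is pointwise invertible, so that its matrix inverse is `|V₀|^{-1/2}`. -/
theorem isUnit_det_sqrtAbsV0 (x : ℝ) : IsUnit (sqrtAbsV0 x).det := by
  have h : (√3 : ℝ) * √3 = 3 := Real.mul_self_sqrt (by norm_num)
  have h3 : (0 : ℝ) < √3 := by positivity
  have hd : (sqrtAbsV0 x).det = Q x ^ 2 * √3 := by
    simp [sqrtAbsV0, Matrix.det_fin_two]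
    ring
  rw [hd, isUnit_iff_ne_zero]
  have := Q_pos x
  positivity

/-! ### Resolvent kernels and the Birman–Schwinger operators -/

/-- Integral kernel of `R^{(α)}`, which is diagonal with entries
`(-∂ₓ² + α²)⁻¹` and `(-∂ₓ² + 2 - α²)⁻¹`, for `0 < α < √2`. -/
def resolventKernel (α x y : ℝ) : Mat :=
  !![1 / (2 * α) * Real.exp (-α * |x - y|), 0;
    0, 1 / (2 * √(2 - α ^ 2)) * Real.exp (-√(2 - α ^ 2) * |x - y|)]

/-- Coefficient of `α⁻¹` in the expansion of the resolvent kernel. -/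
def Rm1 (_x _y : ℝ) : Mat := !![1 / 2, 0; 0, 0]

/-- Coefficient of `α⁰`. -/
def R0 (x y : ℝ) : Mat :=
  !![-|x - y| / 2, 0; 0, Real.exp (-√2 * |x - y|) / (2 * √2)]

/-- Coefficient of `α¹`. -/
def R1 (x y : ℝ) : Mat := !![|x - y| ^ 2 / 4, 0; 0, 0]

/-- The operator `|V₀|^{1/2} R V |V₀|^{-1/2}`, where `R` is given by its integral kernel and `V` is
a matrix potential. -/
def sandwich (R : ℝ → ℝ → Mat) (V : ℝ → Mat) (f : ℝ → Vec) : ℝ → Vec :=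
  fun x => ∫ y : ℝ, act (sqrtAbsV0 x * R x y * V y * (sqrtAbsV0 y)⁻¹) (f y)

/-- The Birman–Schwinger operator `K_{α,ε}`, with `p = 3 + ε`. -/
def K (α ε : ℝ) : (ℝ → Vec) → (ℝ → Vec) := sandwich (resolventKernel α) (potential (3 + ε))

/-! The operators `K_{jk}`, the coefficient of `α^j ε^k` in the expansion of `K_{α,ε}`. -/

def Km11 : (ℝ → Vec) → (ℝ → Vec) := sandwich Rm1 V1
def Km12 : (ℝ → Vec) → (ℝ → Vec) := sandwich Rm1 V2
def K00 : (ℝ → Vec) → (ℝ → Vec) := sandwich R0 V0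
def K01 : (ℝ → Vec) → (ℝ → Vec) := sandwich R0 V1
def K02 : (ℝ → Vec) → (ℝ → Vec) := sandwich R0 V2
def K10 : (ℝ → Vec) → (ℝ → Vec) := sandwich R1 V0

/-! ### Projections, the reduced operator and its inverse -/

/-- `v = |V₀|^{1/2} (1, 0)ᵀ`. -/
def v (x : ℝ) : Vec := act (sqrtAbsV0 x) !₂[1, 0]

/-- The threshold resonance `u₀ = (2 - Q², -Q²)ᵀ` of the cubic problem. -/
def u0 (x : ℝ) : Vec := !₂[((2 - Q x ^ 2 : ℝ) : ℂ), ((-Q x ^ 2 : ℝ) : ℂ)]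

/-- `w₀ = |V₀|^{1/2} u₀`. -/
def w0 (x : ℝ) : Vec := act (sqrtAbsV0 x) (u0 x)

/-- The orthogonal projection of `L²` onto the span of `v`. -/
def P (f : ℝ → Vec) : ℝ → Vec := fun x => (ip v f / ip v v) • v x

/-- The complementary projection `1 - P`. -/
def Pbar (f : ℝ → Vec) : ℝ → Vec := f - P f

/-- The operator `P̄ (K₀₀ + 1) P̄`. -/
def reduced (f : ℝ → Vec) : ℝ → Vec := Pbar (K00 (Pbar f) + Pbar f)

/-- `f` belongs to the orthogonal complement of `{v, w₀}` in `L²`. -/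
def IsPerp (f : ℝ → Vec) : Prop := IsL2 f ∧ ip v f = 0 ∧ ip w0 f = 0

/-- `f` is a preimage of `g` under `P̄ (K₀₀ + 1) P̄` in `{v, w₀}^⊥`. -/
def IsReducedPreimage (g f : ℝ → Vec) : Prop := IsPerp f ∧ ∀ᵐ x : ℝ, reduced f x = g x

open Classical in
/-- The inverse of `P̄ (K₀₀ + 1) P̄` on `{v, w₀}^⊥`: a representative of the preimage, which is unique
up to null sets (and `0` where there is no preimage). -/
def reducedInv (g : ℝ → Vec) : ℝ → Vec :=
  if h : ∃ f, IsReducedPreimage g f then h.choose else 0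

/-! ### The coefficients of the expansion -/

/-- The function at which `(P̄ (K₀₀ + 1) P̄)⁻¹` is taken in the definition of `w₁`. -/
def source1 : ℝ → Vec :=
  (1 / 4 : ℝ) • Pbar (K00 (Km11 w0)) + Pbar (K01 w0)

/-- `w₁ = P w₁ + P̄ w₁`. -/
def w1 : ℝ → Vec := (1 / 4 : ℝ) • Km11 w0 - reducedInv source1

/-- The quotient that defines `α₂`. -/
def alpha2Quotient : ℂ :=
  (-(1 / 4) * ip w0 (K00 (Km11 w1)) - 1 / 4 * ip w0 (K00 (Km12 w0))
      - ip w0 (K01 w1) - ip w0 (K02 w0)) /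
    (ip w0 (K10 w0) + 1 / 4 * ip w0 (K00 (K00 w0 + w0)))

/-- The coefficient `α₂`, as a real number. -/
def alpha2 : ℝ := alpha2Quotient.re

/-- The function at which `(P̄ (K₀₀ + 1) P̄)⁻¹` is taken in the definition of `w₂`. -/
def source2 : ℝ → Vec :=
  (1 / 4 : ℝ) • Pbar (K00 (Km11 w1)) + (1 / 4 : ℝ) • Pbar (K00 (Km12 w0))
    + (alpha2 / 4) • Pbar (K00 (K00 w0 + w0))
    + Pbar (K01 w1) + Pbar (K02 w0) + alpha2 • Pbar (K10 w0)

/-- `w₂ = P w₂ + P̄ w₂`. -/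
def w2 : ℝ → Vec :=
  (1 / 4 : ℝ) • (Km11 w1 + Km12 w0 + alpha2 • (K00 w0 + w0)) - reducedInv source2

end

end NearCubicNLS

open NearCubicNLS

namespace NearCubicNLS

/-! ### Linear algebra in `ℂ²` and bounded operators given by exponentially weighted kernels. -/

/-! ### Real matrices acting on `ℂ²` -/

/-! Put `u = |V₀|^{-1/2} w`. The equation `𝓛_p u = (1 - α²) u` for a decaying `u` is `u = -R^{(α)}
V^{(p)} u`, that is, the Birman–Schwinger equation `(K_{α,ε} + 1) w = 0` with `p = 3 + ε`. As `α →
0` the only singular part of the resolvent kernel is `α⁻¹ diag(1/2, 0)`, and its sandwich has rank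
one with range spanned by `v`. So the equation reads `A(α,ε) w + α⁻¹ ℓ_ε(w) v = 0`, where `ℓ_ε` is a
linear functional and `A(α,ε)` (`regularOp`) is `K₀₀ + 1 + ε K₀₁ + ε² K₀₂ + α K₁₀` up to `O(|ε|³ +
α|ε| + α²)` (`regularOp_expansion`).

The cubic threshold enters as follows. The resonance satisfies `(K₀₀ + 1) w₀ = 2v` (`K00_w0`), so
`w₀` is annihilated by the reduced operator, while `K₀₀ + 1` itself is invertible on `L²`
(`isUnit_one_add_op00`). Invertibility comes from the Fredholm alternative: `K₀₀` is compact
(`compactKernel_k00`), and an element of the kernel of `K₀₀ + 1` gives a bounded solution of `L₊ a =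
b`, `L₋ b = a`. These are exactly the multiples of the resonance (`threshold_uniqueness`, by
intertwining with a constant coefficient operator), and the resonance is excluded because `2v ≠ 0`.

For small `ε` and `α` of size `ε²` the operator `A(α,ε)` is therefore invertible, and the problem
has a nonzero solution as soon as the scalar equation `α + ℓ_ε(A(α,ε)⁻¹ v) = 0` holds. The
coefficients `w₁`, `w₂` are made so that `W = w₀ + ε w₁ + ε² w₂` satisfies `A W = (2 + η) v +
O(|ε|³)` with a small scalar `η`, and `ℓ_ε(W) = -2 α₂ ε² + O(|ε|³)`. Multiplied by `2 + η`, the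
scalar equation becomes `2 (α - ε² α₂) = O(|ε|³)`. Its left side before the expansion is real,
because all kernels are real, and is continuous in `α`. The intermediate value theorem then gives a
root within `O(|ε|³)` of `ε² α₂` (`exists_edge_bifurcation`). Only `α₂ > 0` matters, not the sign of
`ε`.

Well-posedness and the sign of `α₂` are explicit computations. Tested against `w₀`, the terms of
order `ε` reduce to `⟨V₁ u₀, u₀⟩`, which vanishes (`ip_sourceVec_V1_w0`). The denominator of `α₂`
equals `8` (`denominator_eq`). Modulo a harmless multiple of `w₀`, the corrector `w₁` is explicit in
terms of `κ = (2 - ∂ₓ²)⁻¹ sech²`, and integration by parts gives `8 α₂ = 2 + ∫ sech² κ`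
(`eight_mul_alpha2Quotient`). This is positive since the Green function, hence `κ`, is nonnegative.

Finally, a Birman–Schwinger solution has a continuous representative; Green function estimates make
it an exponentially decaying classical eigenfunction (`isEigenfunction_of_birmanSchwinger`). -/

theorem act_apply (M : Mat) (z : Vec) (i : Fin 2) :
    act M z i = (M i 0 : ℂ) * z 0 + (M i 1 : ℂ) * z 1 := by
  fin_cases i <;> simp [act]

theorem vec_ext {z z' : Vec} (h0 : z 0 = z' 0) (h1 : z 1 = z' 1) : z = z' := by
  ext i; fin_cases i <;> assumption

theorem act_add (M : Mat) (z z' : Vec) : act M (z + z') = act M z + act M z' := by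
  ext i; simp [act_apply]; ring

theorem act_smul (M : Mat) (c : ℂ) (z : Vec) : act M (c • z) = c • act M z := by
  ext i; simp [act_apply]; ring

theorem act_neg (M : Mat) (z : Vec) : act M (-z) = -act M z := by
  ext i; simp [act_apply]; ring

theorem act_mul (M N : Mat) (z : Vec) : act (M * N) z = act M (act N z) := by
  ext i
  simp only [act_apply, Matrix.mul_apply, Fin.sum_univ_two]
  push_cast
  ring

theorem act_one (z : Vec) : act 1 z = z := by
  apply vec_ext <;> simp [act_apply]

theorem add_act (M N : Mat) (z : Vec) : act (M + N) z = act M z + act N z := by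
  ext i; simp [act_apply]; ring

theorem sub_act (M N : Mat) (z : Vec) : act (M - N) z = act M z - act N z := by
  ext i; simp [act_apply]; ring

theorem neg_act (M : Mat) (z : Vec) : act (-M) z = -act M z := by
  ext i; simp [act_apply]; ring

theorem smul_act (c : ℝ) (M : Mat) (z : Vec) : act (c • M) z = c • act M z := by
  ext i; simp [act_apply]; ring

theorem act_zero (M : Mat) : act M 0 = 0 := by
  ext i; simp [act_apply]

/-- `act M` as a continuous linear map. -/
noncomputable def actL (M : Mat) : Vec →L[ℂ] Vec :=
  LinearMap.toContinuousLinearMap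
    { toFun := act M, map_add' := act_add M, map_smul' := act_smul M }

@[simp] theorem actL_apply (M : Mat) (z : Vec) : actL M z = act M z := rfl

theorem norm_comp_le (z : Vec) (i : Fin 2) : ‖z i‖ ≤ ‖z‖ := PiLp.norm_apply_le z i

theorem norm_le_comp (z : Vec) : ‖z‖ ≤ ‖z 0‖ + ‖z 1‖ := by
  rw [EuclideanSpace.norm_eq, Fin.sum_univ_two]
  apply Real.sqrt_le_iff.2 ⟨by positivity, ?_⟩
  nlinarith [mul_nonneg (norm_nonneg (z 0)) (norm_nonneg (z 1))]

theorem norm_act_le {M : Mat} {c : ℝ} (h : ∀ i j, |M i j| ≤ c) (z : Vec) :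
    ‖act M z‖ ≤ 4 * c * ‖z‖ := by
  have key : ∀ i, ‖act M z i‖ ≤ 2 * c * ‖z‖ := by
    intro i
    rw [act_apply]
    refine (norm_add_le _ _).trans ?_
    rw [norm_mul, norm_mul, Complex.norm_real, Complex.norm_real, Real.norm_eq_abs,
      Real.norm_eq_abs]
    have hc : 0 ≤ c := (abs_nonneg _).trans (h 0 0)
    have := mul_le_mul (h i 0) (norm_comp_le z 0) (norm_nonneg _) hc
    have := mul_le_mul (h i 1) (norm_comp_le z 1) (norm_nonneg _) hc
    linarith
  have := norm_le_comp (act M z)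
  linarith [key 0, key 1]

theorem inner_vec (z z' : Vec) :
    inner ℂ z z' = z' 0 * starRingEnd ℂ (z 0) + z' 1 * starRingEnd ℂ (z 1) := by
  simp [PiLp.inner_apply, Fin.sum_univ_two]

theorem inner_act (M : Mat) (z z' : Vec) : inner ℂ z (act M z') = inner ℂ (act Mᵀ z) z' := by
  simp only [inner_vec, act_apply, Matrix.transpose_apply, map_add, map_mul, Complex.conj_ofReal]
  ring

/-- The matrix unit `E i j` acting on `ℂ²`. -/
noncomputable def unitL (i j : Fin 2) : Vec →L[ℂ] Vec :=
  LinearMap.toContinuousLinearMap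
    { toFun := fun z => EuclideanSpace.single i (z j)
      map_add' := fun z z' => by ext l; by_cases h : l = i <;> simp [h]
      map_smul' := fun c z => by ext l; by_cases h : l = i <;> simp [h] }

theorem unitL_apply (i j : Fin 2) (z : Vec) : unitL i j z = EuclideanSpace.single i (z j) := rfl

/-- Scalar coefficients times fixed continuous maps: measurability and continuity of `act (k x) (f
x)` thereby reduce to those of the entries and of `f`. -/
theorem act_eq_sum (M : Mat) (z : Vec) : act M z = ∑ i, ∑ j, M i j • unitL i j z := by
  apply vec_ext <;> simp [act_apply, unitL_apply, Fin.sum_univ_two]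

theorem aestronglyMeasurable_act {X : Type*} [MeasurableSpace X] {μ : Measure X} {k : X → Mat}
    {f : X → Vec} (hk : ∀ i j, Measurable fun x => k x i j) (hf : AEStronglyMeasurable f μ) :
    AEStronglyMeasurable (fun x => act (k x) (f x)) μ := by
  simp only [act_eq_sum, Fin.sum_univ_two]
  have h : ∀ i j, AEStronglyMeasurable (fun x => k x i j • unitL i j (f x)) μ := fun i j =>
    (hk i j).aestronglyMeasurable.smul ((unitL i j).continuous.comp_aestronglyMeasurable hf)
  exact ((h 0 0).add (h 0 1)).add ((h 1 0).add (h 1 1))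

/-! ### Integral operators with exponentially localized matrix kernels -/

/-- The Hilbert space `L²(ℝ, ℂ²)`. -/
abbrev L2Space : Type := Lp Vec 2 (volume : Measure ℝ)

/-- The exponential weight dominating all kernels. -/
noncomputable def wt (x : ℝ) : ℝ := Real.exp (-|x| / 4)

theorem wt_pos (x : ℝ) : 0 < wt x := Real.exp_pos _

theorem continuous_wt : Continuous wt := by unfold wt; fun_prop

theorem integral_exp_neg_abs {c : ℝ} (hc : 0 < c) :
    Integrable (fun x : ℝ => Real.exp (-c * |x|)) ∧ ∫ x : ℝ, Real.exp (-c * |x|) = 2 / c := by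
  have h1 : IntegrableOn (fun x : ℝ => Real.exp (-c * |x|)) (Set.Ioi 0) :=
    (integrableOn_exp_mul_Ioi (neg_lt_zero.2 hc) 0).congr_fun
      (fun x hx => by simp [abs_of_pos (Set.mem_Ioi.1 hx)]) measurableSet_Ioi
  refine ⟨?_, ?_⟩
  · have h2 : IntegrableOn (fun x : ℝ => Real.exp (-c * |x|)) (Set.Iic 0) :=
      (integrableOn_exp_mul_Iic hc 0).congr_fun
        (fun x hx => by simp [abs_of_nonpos (Set.mem_Iic.1 hx)]) measurableSet_Iic
    rw [← integrableOn_univ, ← Set.Iic_union_Ioi (a := (0 : ℝ))]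
    exact h2.union h1
  · rw [integral_comp_abs (f := fun x => Real.exp (-c * x)),
      integral_exp_mul_Ioi (neg_lt_zero.2 hc)]
    simp; field_simp

theorem memLp_wt : MemLp wt 2 volume := by
  rw [memLp_two_iff_integrable_sq continuous_wt.aestronglyMeasurable]
  refine (integral_exp_neg_abs (c := 1/2) (by norm_num)).1.congr (ae_of_all _ fun x => ?_)
  simp only [wt, ← Real.exp_nat_mul]
  congr 1; push_cast; ring

/-- The weight has `L²` norm `2`; this is the source of the numerical factors in the operator bounds
below. -/
theorem integral_wt_sq : ∫ x, wt x ^ 2 = 4 := by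
  have h := (integral_exp_neg_abs (c := 1/2) (by norm_num)).2
  have : ∀ x, wt x ^ 2 = Real.exp (-(1/2) * |x|) := fun x => by
    simp only [wt, ← Real.exp_nat_mul]
    congr 1; push_cast; ring
  simp only [this, h]; norm_num

theorem integrable_wt_mul_norm {f : ℝ → Vec} (hf : IsL2 f) :
    Integrable fun y => wt y * ‖f y‖ := by
  have := (memLp_wt).integrable_mul (MemLp.norm hf)
  exact this

/-- The class in `L²(ℝ, ℂ²)` of a square integrable function. -/
noncomputable def toL2 (f : ℝ → Vec) (hf : IsL2 f) : L2Space := MemLp.toLp f hf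

theorem isL2_coe (f : L2Space) : IsL2 f := Lp.memLp f

theorem coeFn_toL2 {f : ℝ → Vec} (hf : IsL2 f) : toL2 f hf =ᵐ[volume] f := MemLp.coeFn_toLp hf

theorem toL2_coe (f : L2Space) (hf : IsL2 f) : toL2 f hf = f := Lp.toLp_coeFn f hf

theorem toL2_eq_iff {f g : ℝ → Vec} {hf : IsL2 f} {hg : IsL2 g} :
    toL2 f hf = toL2 g hg ↔ f =ᵐ[volume] g := MemLp.toLp_eq_toLp_iff hf hg

theorem IsL2.add {f g : ℝ → Vec} (hf : IsL2 f) (hg : IsL2 g) : IsL2 (f + g) := MemLp.add hf hg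

theorem IsL2.sub {f g : ℝ → Vec} (hf : IsL2 f) (hg : IsL2 g) : IsL2 (f - g) := MemLp.sub hf hg

theorem IsL2.smul {f : ℝ → Vec} (hf : IsL2 f) (c : ℂ) : IsL2 (c • f) := MemLp.const_smul hf c

theorem IsL2.rsmul {f : ℝ → Vec} (hf : IsL2 f) (c : ℝ) : IsL2 (c • f) := MemLp.const_smul hf c

theorem toL2_add {f g : ℝ → Vec} (hf : IsL2 f) (hg : IsL2 g) :
    toL2 (f + g) (hf.add hg) = toL2 f hf + toL2 g hg := rfl

theorem toL2_sub {f g : ℝ → Vec} (hf : IsL2 f) (hg : IsL2 g) :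
    toL2 (f - g) (hf.sub hg) = toL2 f hf - toL2 g hg := rfl

theorem toL2_smul {f : ℝ → Vec} (hf : IsL2 f) (c : ℂ) :
    toL2 (c • f) (hf.smul c) = c • toL2 f hf := rfl

theorem inner_toL2 {f g : ℝ → Vec} (hf : IsL2 f) (hg : IsL2 g) :
    inner ℂ (toL2 f hf) (toL2 g hg) = ip f g := by
  rw [L2.inner_def]
  apply integral_congr_ae
  filter_upwards [coeFn_toL2 hf, coeFn_toL2 hg] with y h1 h2
  rw [h1, h2]

theorem integral_norm_sq_eq {f : ℝ → Vec} (hf : IsL2 f) : ∫ y, ‖f y‖ ^ 2 = ‖toL2 f hf‖ ^ 2 := by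
  rw [@norm_sq_eq_re_inner ℂ, inner_toL2]
  have : ip f f = ((∫ y, ‖f y‖ ^ 2 : ℝ) : ℂ) := by
    rw [← integral_complex_ofReal]
    apply integral_congr_ae
    refine ae_of_all _ fun y => ?_
    simp only [inner_self_eq_norm_sq_to_K]; simp
  rw [this]; simp

theorem integral_wt_mul_norm_le {f : ℝ → Vec} (hf : IsL2 f) :
    ∫ y, wt y * ‖f y‖ ≤ 2 * ‖toL2 f hf‖ := by
  have h := integral_mul_le_Lp_mul_Lq_of_nonneg (μ := volume) (f := wt) (g := fun y => ‖f y‖)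
    Real.HolderConjugate.two_two (ae_of_all _ fun x => (wt_pos x).le)
    (ae_of_all _ fun x => norm_nonneg _) (by simpa using memLp_wt) (by simpa using MemLp.norm hf)
  refine h.trans (le_of_eq ?_)
  simp only [Real.rpow_two, integral_wt_sq, integral_norm_sq_eq hf, ← Real.sqrt_eq_rpow]
  rw [Real.sqrt_sq (norm_nonneg _), show (4 : ℝ) = 2 ^ 2 by norm_num, Real.sqrt_sq (by norm_num)]

theorem norm_toL2_le {f : ℝ → Vec} (hf : IsL2 f) {c : ℝ} (hc : 0 ≤ c)
    (h : ∀ x, ‖f x‖ ≤ c * wt x) : ‖toL2 f hf‖ ≤ 2 * c := by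
  refine le_of_sq_le_sq ?_ (by positivity)
  rw [← integral_norm_sq_eq hf]
  have h2 : Integrable fun x => c ^ 2 * wt x ^ 2 :=
    (((memLp_two_iff_integrable_sq continuous_wt.aestronglyMeasurable).1 memLp_wt)).const_mul _
  have := integral_mono_of_nonneg (ae_of_all _ fun x => sq_nonneg ‖f x‖) h2
    (ae_of_all _ fun x => by
      have := pow_le_pow_left₀ (norm_nonneg _) (h x) 2
      simpa only [mul_pow] using this)
  rw [integral_const_mul, integral_wt_sq] at this
  linarith

theorem isL2_of_bound {f : ℝ → Vec} (hm : AEStronglyMeasurable f volume) {c : ℝ}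
    (h : ∀ x, ‖f x‖ ≤ c * wt x) : IsL2 f :=
  MemLp.of_le_mul (c := c) memLp_wt hm (ae_of_all _ fun x => by
    rw [Real.norm_of_nonneg (wt_pos x).le]; exact h x)

/-- The integral operator with matrix kernel `k`. -/
noncomputable def kint (k : ℝ → ℝ → Mat) (f : ℝ → Vec) : ℝ → Vec := fun x => ∫ y, act (k x y) (f y)

/-- A measurable kernel bounded by `C` times the product weight. -/
structure IsAdm (k : ℝ → ℝ → Mat) (C : ℝ) : Prop where
  meas : ∀ i j, Measurable fun p : ℝ × ℝ => k p.1 p.2 i j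
  bound : ∀ x y i j, |k x y i j| ≤ C * wt x * wt y

namespace IsAdm

variable {k l : ℝ → ℝ → Mat} {C D : ℝ}

theorem nonneg (hk : IsAdm k C) : 0 ≤ C := by
  have := (abs_nonneg _).trans (hk.bound 0 0 0 0)
  have h : 0 < wt 0 := wt_pos 0
  by_contra hC
  push Not at hC
  have := mul_neg_of_neg_of_pos (mul_neg_of_neg_of_pos hC h) h
  linarith

theorem add (hk : IsAdm k C) (hl : IsAdm l D) : IsAdm (fun x y => k x y + l x y) (C + D) where
  meas i j := (hk.meas i j).add (hl.meas i j)
  bound x y i j := by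
    have := abs_add_le (k x y i j) (l x y i j)
    have := hk.bound x y i j
    have := hl.bound x y i j
    simp only [Matrix.add_apply]
    linarith

theorem adjoint (hk : IsAdm k C) : IsAdm (fun x y => (k y x)ᵀ) C where
  meas i j := (hk.meas j i).comp measurable_swap
  bound x y i j := by
    have := hk.bound y x j i
    simp only [Matrix.transpose_apply]
    linarith

theorem norm_act_le (hk : IsAdm k C) (x y : ℝ) (z : Vec) :
    ‖act (k x y) z‖ ≤ 4 * C * wt x * (wt y * ‖z‖) := by
  refine (NearCubicNLS.norm_act_le (hk.bound x y) z).trans (le_of_eq (by ring))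

theorem integrable (hk : IsAdm k C) {f : ℝ → Vec} (hf : IsL2 f) (x : ℝ) :
    Integrable fun y => act (k x y) (f y) := by
  refine ((integrable_wt_mul_norm hf).const_mul (4 * C * wt x)).mono' ?_
    (ae_of_all _ fun y => hk.norm_act_le x y _)
  exact aestronglyMeasurable_act (fun i j => (hk.meas i j).comp measurable_prodMk_left)
    hf.aestronglyMeasurable

theorem norm_kint_le (hk : IsAdm k C) {f : ℝ → Vec} (hf : IsL2 f) (x : ℝ) :
    ‖kint k f x‖ ≤ 8 * C * ‖toL2 f hf‖ * wt x := by
  refine (norm_integral_le_of_norm_le ((integrable_wt_mul_norm hf).const_mul (4 * C * wt x))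
    (ae_of_all _ fun y => hk.norm_act_le x y _)).trans ?_
  rw [integral_const_mul]
  have h1 := integral_wt_mul_norm_le hf
  have h2 : 0 ≤ 4 * C * wt x := by have := hk.nonneg; have := wt_pos x; positivity
  nlinarith [mul_le_mul_of_nonneg_left h1 h2]

theorem isL2_kint (hk : IsAdm k C) {f : ℝ → Vec} (hf : IsL2 f) : IsL2 (kint k f) := by
  refine isL2_of_bound ?_ (hk.norm_kint_le hf)
  have : AEStronglyMeasurable (fun p : ℝ × ℝ => act (k p.1 p.2) (f p.2))
      ((volume : Measure ℝ).prod volume) :=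
    aestronglyMeasurable_act hk.meas hf.aestronglyMeasurable.comp_snd
  exact this.integral_prod_right'

/-- Cauchy–Schwarz against the product weight: `16` is the factor `4` from the matrix entries times
`∫ wt² = 4`. -/
theorem norm_toL2_kint_le (hk : IsAdm k C) {f : ℝ → Vec} (hf : IsL2 f) :
    ‖toL2 (kint k f) (hk.isL2_kint hf)‖ ≤ 16 * C * ‖toL2 f hf‖ := by
  have := norm_toL2_le (hk.isL2_kint hf) (by have := hk.nonneg; positivity) (hk.norm_kint_le hf)
  linarith

end IsAdm

theorem kint_congr {k : ℝ → ℝ → Mat} {f g : ℝ → Vec} (h : f =ᵐ[volume] g) : kint k f = kint k g := by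
  ext1 x
  apply integral_congr_ae
  filter_upwards [h] with y hy
  rw [hy]

/-- A kernel that is bounded by a multiple of the product weight. -/
def Adm (k : ℝ → ℝ → Mat) : Prop := ∃ C, IsAdm k C

theorem IsAdm.adm {k : ℝ → ℝ → Mat} {C : ℝ} (h : IsAdm k C) : Adm k := ⟨C, h⟩

theorem Adm.isL2_kint {k : ℝ → ℝ → Mat} (hk : Adm k) {f : ℝ → Vec} (hf : IsL2 f) :
    IsL2 (kint k f) := hk.choose_spec.isL2_kint hf

theorem Adm.integrable {k : ℝ → ℝ → Mat} (hk : Adm k) {f : ℝ → Vec} (hf : IsL2 f) (x : ℝ) :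
    Integrable fun y => act (k x y) (f y) := hk.choose_spec.integrable hf x

theorem kint_add {k : ℝ → ℝ → Mat} (hk : Adm k) {f g : ℝ → Vec} (hf : IsL2 f) (hg : IsL2 g) :
    kint k (f + g) = kint k f + kint k g := by
  ext1 x
  simp only [kint, Pi.add_apply, act_add]
  exact integral_add (hk.integrable hf x) (hk.integrable hg x)

theorem kint_smul (k : ℝ → ℝ → Mat) (c : ℂ) (f : ℝ → Vec) : kint k (c • f) = c • kint k f := by
  ext1 x
  simp only [kint, Pi.smul_apply, act_smul, integral_smul]

/-- The bounded operator on `L²(ℝ, ℂ²)` with a given localized kernel. -/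
noncomputable def op (k : ℝ → ℝ → Mat) (hk : Adm k) : L2Space →L[ℂ] L2Space :=
  LinearMap.mkContinuous
    { toFun := fun f => toL2 (kint k f) (hk.isL2_kint (isL2_coe f))
      map_add' := fun f g => by
        rw [← toL2_add, toL2_eq_iff, kint_congr (Lp.coeFn_add f g),
          kint_add hk (isL2_coe f) (isL2_coe g)]
      map_smul' := fun c f => by
        rw [RingHom.id_apply, ← toL2_smul, toL2_eq_iff, kint_congr (Lp.coeFn_smul c f),
          kint_smul] }
    (16 * hk.choose) fun f => by
      have := hk.choose_spec.norm_toL2_kint_le (isL2_coe f)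
      rwa [toL2_coe] at this

theorem op_coe {k : ℝ → ℝ → Mat} (hk : Adm k) (f : L2Space) :
    op k hk f = toL2 (kint k f) (hk.isL2_kint (isL2_coe f)) := rfl

theorem op_toL2 {k : ℝ → ℝ → Mat} (hk : Adm k) {f : ℝ → Vec} (hf : IsL2 f) :
    op k hk (toL2 f hf) = toL2 (kint k f) (hk.isL2_kint hf) := by
  rw [op_coe, toL2_eq_iff, kint_congr (coeFn_toL2 hf)]

theorem norm_op_le {k : ℝ → ℝ → Mat} {C : ℝ} (hk : IsAdm k C) : ‖op k hk.adm‖ ≤ 16 * C := by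
  refine ContinuousLinearMap.opNorm_le_bound _ (by have := hk.nonneg; positivity) fun f => ?_
  have := hk.norm_toL2_kint_le (isL2_coe f)
  rwa [toL2_coe] at this

theorem op_add {k l : ℝ → ℝ → Mat} (hk : Adm k) (hl : Adm l)
    (h : Adm fun x y => k x y + l x y) : op _ h = op k hk + op l hl := by
  ext1 f
  rw [add_apply, op_coe, op_coe, op_coe, ← toL2_add, toL2_eq_iff]
  refine ae_of_all _ fun x => ?_
  simp only [kint, add_act, Pi.add_apply]
  exact integral_add (hk.integrable (isL2_coe f) x) (hl.integrable (isL2_coe f) x)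

theorem op_sub {k l : ℝ → ℝ → Mat} (hk : Adm k) (hl : Adm l)
    (h : Adm fun x y => k x y - l x y) : op _ h = op k hk - op l hl := by
  ext1 f
  rw [sub_apply, op_coe, op_coe, op_coe, ← toL2_sub, toL2_eq_iff]
  refine ae_of_all _ fun x => ?_
  simp only [kint, sub_act, Pi.sub_apply]
  exact integral_sub (hk.integrable (isL2_coe f) x) (hl.integrable (isL2_coe f) x)

theorem op_smul {k : ℝ → ℝ → Mat} (hk : Adm k) (c : ℝ)
    (h : Adm fun x y => c • k x y) : op _ h = (c : ℂ) • op k hk := by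
  ext1 f
  rw [smul_apply, op_coe, op_coe, ← toL2_smul, toL2_eq_iff]
  refine ae_of_all _ fun x => ?_
  simp only [kint, smul_act, Pi.smul_apply, integral_smul]
  simp

theorem op_congr {k l : ℝ → ℝ → Mat} (hk : Adm k) (hl : Adm l) (h : ∀ x y, k x y = l x y) :
    op k hk = op l hl := by
  obtain rfl : k = l := by ext1 x; ext1 y; exact h x y
  rfl

/-- The adjoint of the operator with kernel `k x y` has kernel `(k y x)ᵀ`. -/
theorem ip_kint {k : ℝ → ℝ → Mat} (hk : Adm k) {f g : ℝ → Vec} (hf : IsL2 f) (hg : IsL2 g) :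
    ip g (kint k f) = ip (kint (fun x y => (k y x)ᵀ) g) f := by
  obtain ⟨C, hC⟩ := hk
  have hC' := hC.adjoint
  -- Fubini applies because the product weight bounds the integrand by a product of two integrable
  -- functions of one variable.
  have hint : Integrable (Function.uncurry fun x y => inner ℂ (g x) (act (k x y) (f y)))
      ((volume : Measure ℝ).prod volume) := by
    refine (((integrable_wt_mul_norm hg).const_mul (4 * C)).mul_prod
      (integrable_wt_mul_norm hf)).mono' ?_ (ae_of_all _ fun p => ?_)
    · exact hg.aestronglyMeasurable.comp_fst.inner
        (aestronglyMeasurable_act hC.meas hf.aestronglyMeasurable.comp_snd)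
    · refine (norm_inner_le_norm _ _).trans ?_
      refine (mul_le_mul_of_nonneg_left (hC.norm_act_le p.1 p.2 _) (norm_nonneg _)).trans
        (le_of_eq (by ring))
  have e1 : ip g (kint k f) = ∫ x, ∫ y, inner ℂ (g x) (act (k x y) (f y)) := by
    refine integral_congr_ae (ae_of_all _ fun x => ?_)
    exact (integral_inner (hC.integrable hf x) (g x)).symm
  have e2 : ip (kint (fun x y => (k y x)ᵀ) g) f =
      ∫ y, ∫ x, inner ℂ (g x) (act (k x y) (f y)) := by
    refine integral_congr_ae (ae_of_all _ fun y => ?_)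
    simp only [inner_act]
    rw [← inner_conj_symm]
    simp only [kint]
    rw [← integral_inner (hC'.integrable hg y), ← integral_conj]
    simp only [inner_conj_symm]
  rw [e1, e2, integral_integral_swap hint]

/-! ### Explicit estimates: soliton, sandwiched kernels, and the expansions in `ε` and `α`. -/

/-! ### Hyperbolic functions -/

theorem sech_pos (x : ℝ) : 0 < sech x := by
  have := Real.cosh_pos x
  unfold sech; positivity

theorem sech_le_exp (x : ℝ) : sech x ≤ 2 * Real.exp (-|x|) := by
  have h : Real.exp |x| / 2 ≤ Real.cosh x := by
    rw [← Real.cosh_abs, Real.cosh_eq]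
    have := Real.exp_pos (-|x|)
    linarith
  have h2 := Real.exp_pos |x|
  unfold sech
  rw [Real.exp_neg, div_le_iff₀ (Real.cosh_pos x)]
  calc (1 : ℝ) = 2 * (Real.exp |x|)⁻¹ * (Real.exp |x| / 2) := by field_simp
    _ ≤ _ := by gcongr

theorem sech_le_one (x : ℝ) : sech x ≤ 1 := by
  unfold sech
  rw [div_le_one (Real.cosh_pos x)]
  exact Real.one_le_cosh x

theorem inv_sech_le (x : ℝ) : (sech x)⁻¹ ≤ Real.exp |x| := by
  unfold sech
  rw [one_div, inv_inv, ← Real.cosh_abs, Real.cosh_eq]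
  have : Real.exp (-|x|) ≤ Real.exp |x| := Real.exp_le_exp.2 (by linarith [abs_nonneg x])
  linarith

theorem sech_sq_le (x : ℝ) : sech x ^ 2 ≤ 4 * Real.exp (-2 * |x|) := by
  have := pow_le_pow_left₀ (sech_pos x).le (sech_le_exp x) 2
  rw [mul_pow, ← Real.exp_nat_mul] at this
  refine this.trans (le_of_eq ?_)
  push_cast
  ring_nf

theorem tanh_sq (x : ℝ) : Real.tanh x ^ 2 = 1 - sech x ^ 2 := by
  have h := Real.cosh_pos x
  have := Real.cosh_sq x
  rw [Real.tanh_eq_sinh_div_cosh, sech]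
  field_simp
  linarith

theorem abs_tanh_le (x : ℝ) : |Real.tanh x| ≤ 1 := by
  rw [← sq_le_one_iff_abs_le_one, tanh_sq]
  have := sq_nonneg (sech x)
  linarith

theorem hasDerivAt_sech (x : ℝ) : HasDerivAt sech (-(Real.tanh x * sech x)) x := by
  have h := Real.cosh_pos x
  refine ((hasDerivAt_const x (1 : ℝ)).div (Real.hasDerivAt_cosh x) h.ne').congr_deriv ?_
  rw [Real.tanh_eq_sinh_div_cosh, sech]
  field_simp
  ring

theorem hasDerivAt_tanh (x : ℝ) : HasDerivAt Real.tanh (sech x ^ 2) x := by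
  have h := Real.cosh_pos x
  have e : Real.tanh = Real.sinh / Real.cosh := by
    ext1 y; exact Real.tanh_eq_sinh_div_cosh y
  rw [e]
  refine ((Real.hasDerivAt_sinh x).div (Real.hasDerivAt_cosh x) h.ne').congr_deriv ?_
  have := Real.cosh_sq x
  unfold sech
  field_simp
  linarith

theorem continuous_sech : Continuous sech :=
  continuous_iff_continuousAt.2 fun x => (hasDerivAt_sech x).continuousAt

theorem continuous_tanh : Continuous Real.tanh :=
  continuous_iff_continuousAt.2 fun x => (hasDerivAt_tanh x).continuousAt

theorem one_add_le_exp {c : ℝ} (hc : 0 < c) (hc1 : c ≤ 1) (r : ℝ) :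
    1 + r ≤ c⁻¹ * Real.exp (c * r) := by
  have h1 : 1 ≤ c⁻¹ := (one_le_inv₀ hc).2 hc1
  have h2 := Real.add_one_le_exp (c * r)
  calc 1 + r ≤ c⁻¹ * (c * r + 1) := by
        rw [mul_add, ← mul_assoc, inv_mul_cancel₀ hc.ne']; linarith
    _ ≤ _ := by gcongr

theorem one_add_pow_le_exp {c : ℝ} (hc : 0 < c) (hc1 : c ≤ 1) {r : ℝ} (hr : 0 ≤ r) (n : ℕ) :
    (1 + r) ^ n ≤ c⁻¹ ^ n * Real.exp (n * c * r) := by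
  refine (pow_le_pow_left₀ (by positivity) (one_add_le_exp hc hc1 r) n).trans (le_of_eq ?_)
  rw [mul_pow, ← Real.exp_nat_mul, mul_assoc]

/-! ### The soliton and the square root of the potential -/

theorem Q_eq (x : ℝ) : Q x = √2 * sech x := by
  have h := sech_pos x
  unfold Q soliton
  norm_num
  rw [← Real.sqrt_eq_rpow, Real.sqrt_mul (by norm_num), Real.sqrt_sq h.le]

theorem Q_sq (x : ℝ) : Q x ^ 2 = 2 * sech x ^ 2 := by
  rw [Q_eq, mul_pow, Real.sq_sqrt (by norm_num)]

/-- Only the power `Q_p^{p-1}` enters the potential, and there the outer exponent cancels. What is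
left depends on `p` through an affine factor and a dilation of `sech²`, which makes the expansion in
`p - 3` elementary. -/
theorem soliton_rpow {p : ℝ} (hp : 1 < p) (x : ℝ) :
    soliton p x ^ (p - 1) = (p + 1) / 2 * sech ((p - 1) / 2 * x) ^ 2 := by
  have h := sech_pos ((p - 1) / 2 * x)
  unfold soliton
  rw [← Real.rpow_mul (by positivity), one_div, inv_mul_cancel₀ (by linarith), Real.rpow_one]

/-- The constant matrix with `|V₀|^{1/2} = Q J`. -/
noncomputable def J : Mat :=
  !![(√3 + 1) / 2, (√3 - 1) / 2; (√3 - 1) / 2, (√3 + 1) / 2]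

/-- The inverse of `J`. -/
noncomputable def Ji : Mat :=
  !![(√3 + 1) / (2 * √3), -(√3 - 1) / (2 * √3); -(√3 - 1) / (2 * √3), (√3 + 1) / (2 * √3)]

theorem sqrt3_sq : √3 ^ 2 = (3 : ℝ) := Real.sq_sqrt (by norm_num)

theorem J_mul_Ji : J * Ji = 1 := by
  have := sqrt3_sq
  have h3 : (0 : ℝ) < √3 := by positivity
  ext i j
  fin_cases i <;> fin_cases j <;> simp [J, Ji, Matrix.mul_apply, Fin.sum_univ_two] <;>
    field_simp <;> ring_nf

theorem J_transpose : Jᵀ = J := by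
  ext i j; fin_cases i <;> fin_cases j <;> simp [J]

theorem sqrtAbsV0_eq (x : ℝ) : sqrtAbsV0 x = Q x • J := by
  ext i j; fin_cases i <;> fin_cases j <;> simp [sqrtAbsV0, J] <;> ring

theorem sqrtAbsV0_inv (x : ℝ) : (sqrtAbsV0 x)⁻¹ = (Q x)⁻¹ • Ji := by
  rw [sqrtAbsV0_eq]
  apply Matrix.inv_eq_right_inv
  rw [Matrix.smul_mul, Matrix.mul_smul, J_mul_Ji, smul_smul, mul_inv_cancel₀ (Q_pos x).ne',
    one_smul]

theorem abs_J_le (i j : Fin 2) : |J i j| ≤ 2 := by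
  have h3 : (1 : ℝ) ≤ √3 := Real.one_le_sqrt.2 (by norm_num)
  have h4 : (√3 : ℝ) ≤ 2 := Real.sqrt_le_iff.2 (by norm_num)
  fin_cases i <;> fin_cases j <;> simp [J] <;> rw [abs_le] <;> constructor <;> linarith

theorem abs_Ji_le (i j : Fin 2) : |Ji i j| ≤ 1 := by
  have h3 : (1 : ℝ) ≤ √3 := Real.one_le_sqrt.2 (by norm_num)
  have h : ∀ a : ℝ, |a| ≤ 2 * √3 → |a / (2 * √3)| ≤ 1 := fun a ha => by
    rw [abs_div, abs_of_pos (by positivity : (0 : ℝ) < 2 * √3)]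
    exact (div_le_one (by positivity)).2 ha
  have h1 : |(√3 + 1 : ℝ)| ≤ 2 * √3 := by rw [abs_le]; constructor <;> linarith
  have h2 : |-(√3 - 1 : ℝ)| ≤ 2 * √3 := by rw [abs_le]; constructor <;> linarith
  fin_cases i <;> fin_cases j
  exacts [h _ h1, h _ h2, h _ h2, h _ h1]

/-! ### Admissibility of the sandwiched kernels -/

/-- The kernel of `sandwich R V`. -/
noncomputable def sandwichKernel (R : ℝ → ℝ → Mat) (V : ℝ → Mat) (x y : ℝ) : Mat :=
  sqrtAbsV0 x * R x y * V y * (sqrtAbsV0 y)⁻¹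

theorem sandwich_eq_kint (R : ℝ → ℝ → Mat) (V : ℝ → Mat) :
    sandwich R V = kint (sandwichKernel R V) := rfl

theorem abs_mul_entry_le {M N : Mat} {a b : ℝ} (hM : ∀ i j, |M i j| ≤ a) (hN : ∀ i j, |N i j| ≤ b)
    (i j : Fin 2) : |(M * N) i j| ≤ 2 * (a * b) := by
  have ha : 0 ≤ a := (abs_nonneg _).trans (hM 0 0)
  rw [Matrix.mul_apply, Fin.sum_univ_two]
  refine (abs_add_le _ _).trans ?_
  rw [abs_mul, abs_mul]
  have := mul_le_mul (hM i 0) (hN 0 j) (abs_nonneg _) ha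
  have := mul_le_mul (hM i 1) (hN 1 j) (abs_nonneg _) ha
  linarith

/-- A measurable resolvent-type kernel with at most cubic growth off the diagonal. -/
structure ResBound (R : ℝ → ℝ → Mat) (c : ℝ) : Prop where
  meas : ∀ i j, Measurable fun p : ℝ × ℝ => R p.1 p.2 i j
  bound : ∀ x y i j, |R x y i j| ≤ c * (1 + |x - y|) ^ 3

/-- A measurable matrix potential with exponential decay. -/
structure PotBound (V : ℝ → Mat) (c : ℝ) : Prop where
  meas : ∀ i j, Measurable fun x => V x i j
  bound : ∀ x i j, |V x i j| ≤ c * Real.exp (-(3 / 2) * |x|)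

theorem measurable_mat_mul {X : Type*} [MeasurableSpace X] {M N : X → Mat}
    (hM : ∀ i j, Measurable fun x => M x i j) (hN : ∀ i j, Measurable fun x => N x i j)
    (i j : Fin 2) : Measurable fun x => (M x * N x) i j := by
  simp only [Matrix.mul_apply, Fin.sum_univ_two]
  exact ((hM i 0).mul (hN 0 j)).add ((hM i 1).mul (hN 1 j))

theorem continuous_Q : Continuous Q := by
  have : Q = fun x => √2 * sech x := by ext1 x; exact Q_eq x
  rw [this]
  exact continuous_const.mul continuous_sech

/-- The constant in the admissibility bound of sandwiched kernels. -/
def sandwichConst : ℝ := 32 * 1728 ^ 2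

/-- The exponents balance. The factor `Q x / Q y` costs `exp (|y| - |x|)`, the cubic growth of `R`
is paid for by `exp ((|x| + |y|) / 4)`, and the potential contributes `exp (-3|y| / 2)`. This leaves
`exp (-3|x| / 4)`, more than needed, and exactly `exp (-|y| / 4)`, the weight. -/
theorem isAdm_sandwich {R : ℝ → ℝ → Mat} {V : ℝ → Mat} {c d : ℝ} (hR : ResBound R c)
    (hV : PotBound V d) : IsAdm (sandwichKernel R V) (sandwichConst * c * d) where
  meas := by
    apply measurable_mat_mul
    · apply measurable_mat_mul
      · apply measurable_mat_mul _ hR.meas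
        intro i j
        simp only [sqrtAbsV0_eq, Matrix.smul_apply, smul_eq_mul]
        exact (continuous_Q.measurable.comp measurable_fst).mul_const _
      · exact fun i j => (hV.meas i j).comp measurable_snd
    · intro i j
      simp only [sqrtAbsV0_inv, Matrix.smul_apply, smul_eq_mul]
      exact (continuous_Q.measurable.comp measurable_snd).inv.mul_const _
  bound x y i j := by
    have e : sandwichKernel R V x y = (Q x * (Q y)⁻¹) • (J * R x y * V y * Ji) := by
      simp only [sandwichKernel, sqrtAbsV0_inv]
      simp only [sqrtAbsV0_eq, Matrix.smul_mul, Matrix.mul_smul, smul_smul]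
      congr 1; ring
    have h1 := abs_mul_entry_le (abs_mul_entry_le (abs_mul_entry_le abs_J_le (hR.bound x y))
      (hV.bound y)) abs_Ji_le i j
    have hQ : Q x * (Q y)⁻¹ ≤ 2 * Real.exp (-|x|) * Real.exp |y| := by
      rw [Q_eq, Q_eq]
      have : √2 * sech x * (√2 * sech y)⁻¹ = sech x * (sech y)⁻¹ := by
        have := (sech_pos y).ne'
        field_simp
      rw [this]
      have := sech_pos y
      exact mul_le_mul (sech_le_exp x) (inv_sech_le y) (by positivity) (by positivity)
    have hQ0 : 0 ≤ Q x * (Q y)⁻¹ := by have := Q_pos x; have := Q_pos y; positivity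
    have hc : 0 ≤ c := by
      have := (abs_nonneg _).trans (hR.bound 0 0 0 0); simpa using this
    have hd : 0 ≤ d := by
      have := (abs_nonneg _).trans (hV.bound 0 0 0); simpa using this
    -- `1728 = 12 ^ 3`: each cubic factor is absorbed by the cube of an exponential of rate `1 /
    -- 12`.
    have hp : (1 + |x - y|) ^ 3 ≤ 1728 ^ 2 * (Real.exp (|x| / 4) * Real.exp (|y| / 4)) := by
      have a1 : 1 + |x - y| ≤ (1 + |x|) * (1 + |y|) := by
        have := abs_sub x y
        nlinarith [mul_nonneg (abs_nonneg x) (abs_nonneg y)]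
      have a2 := one_add_pow_le_exp (c := 1 / 12) (by norm_num) (by norm_num) (abs_nonneg x) 3
      have a3 := one_add_pow_le_exp (c := 1 / 12) (by norm_num) (by norm_num) (abs_nonneg y) 3
      calc (1 + |x - y|) ^ 3 ≤ ((1 + |x|) * (1 + |y|)) ^ 3 := by gcongr
        _ = (1 + |x|) ^ 3 * (1 + |y|) ^ 3 := mul_pow _ _ _
        _ ≤ _ := mul_le_mul a2 a3 (by positivity) (by positivity)
        _ = _ := by
          norm_num
          rw [show 1 / 4 * |x| = |x| / 4 by ring, show 1 / 4 * |y| = |y| / 4 by ring]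
          ring
    rw [e, Matrix.smul_apply, smul_eq_mul, abs_mul, abs_of_nonneg hQ0]
    have hw : Real.exp (-|x|) * Real.exp (|x| / 4) ≤ wt x := by
      rw [← Real.exp_add, wt]
      exact Real.exp_le_exp.2 (by linarith [abs_nonneg x])
    have hw' : Real.exp |y| * Real.exp (|y| / 4) * Real.exp (-(3 / 2) * |y|) = wt y := by
      rw [← Real.exp_add, ← Real.exp_add, wt]
      congr 1; ring
    calc Q x * (Q y)⁻¹ * |(J * R x y * V y * Ji) i j|
        ≤ (2 * Real.exp (-|x|) * Real.exp |y|) * (2 * (2 * (2 * (2 *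
          (c * (1728 ^ 2 * (Real.exp (|x| / 4) * Real.exp (|y| / 4))))) *
          (d * Real.exp (-(3 / 2) * |y|))) * 1)) := by
            refine mul_le_mul hQ (h1.trans ?_) (abs_nonneg _) (by positivity)
            gcongr
      _ = 32 * 1728 ^ 2 * c * d * (Real.exp (-|x|) * Real.exp (|x| / 4)) *
          (Real.exp |y| * Real.exp (|y| / 4) * Real.exp (-(3 / 2) * |y|)) := by ring
      _ ≤ _ := by
        rw [hw', sandwichConst]
        have := wt_pos y
        gcongr

theorem adm_sandwich {R : ℝ → ℝ → Mat} {V : ℝ → Mat} {c d : ℝ} (hR : ResBound R c)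
    (hV : PotBound V d) : Adm (sandwichKernel R V) := (isAdm_sandwich hR hV).adm

theorem sandwichKernel_add_left (R R' : ℝ → ℝ → Mat) (V : ℝ → Mat) (x y : ℝ) :
    sandwichKernel (fun x y => R x y + R' x y) V x y =
      sandwichKernel R V x y + sandwichKernel R' V x y := by
  simp only [sandwichKernel, Matrix.mul_add, Matrix.add_mul]

theorem sandwichKernel_add_right (R : ℝ → ℝ → Mat) (V V' : ℝ → Mat) (x y : ℝ) :
    sandwichKernel R (fun x => V x + V' x) x y =
      sandwichKernel R V x y + sandwichKernel R V' x y := by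
  simp only [sandwichKernel, Matrix.mul_add, Matrix.add_mul]

theorem sandwichKernel_smul_left (c : ℝ) (R : ℝ → ℝ → Mat) (V : ℝ → Mat) (x y : ℝ) :
    sandwichKernel (fun x y => c • R x y) V x y = c • sandwichKernel R V x y := by
  simp only [sandwichKernel, Matrix.mul_smul, Matrix.smul_mul]

theorem sandwichKernel_smul_right (c : ℝ) (R : ℝ → ℝ → Mat) (V : ℝ → Mat) (x y : ℝ) :
    sandwichKernel R (fun x => c • V x) x y = c • sandwichKernel R V x y := by
  simp only [sandwichKernel, Matrix.mul_smul, Matrix.smul_mul]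

/-! ### Taylor remainders -/

theorem abs_le_of_mem_uIcc {σ τ : ℝ} (h : σ ∈ Set.uIcc 0 τ) : |σ| ≤ |τ| := by
  have := Set.abs_sub_left_of_mem_uIcc h
  simpa using this

theorem abs_sub_le_of_deriv_le {f f' : ℝ → ℝ} {τ M : ℝ} (hf : ∀ x, HasDerivAt f (f' x) x)
    (hM : ∀ σ ∈ Set.uIcc 0 τ, |f' σ| ≤ M) : |f τ - f 0| ≤ M * |τ| := by
  have := (convex_uIcc (0 : ℝ) τ).norm_image_sub_le_of_norm_hasDerivWithin_le (f := f) (f' := f')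
    (C := M) (fun x _ => (hf x).hasDerivWithinAt) (fun x hx => by simpa using hM x hx)
    Set.left_mem_uIcc Set.right_mem_uIcc
  simpa using this

theorem uIcc_zero_subset {σ τ : ℝ} (h : σ ∈ Set.uIcc 0 τ) : Set.uIcc 0 σ ⊆ Set.uIcc 0 τ :=
  Set.uIcc_subset_uIcc Set.left_mem_uIcc h

/-- Three successive mean value estimates on the segment from `0` to `τ`. The factor `1/6` of the
sharp remainder is not needed. -/
theorem taylor_third_order {f f₁ f₂ f₃ : ℝ → ℝ} {τ M : ℝ} (h0 : ∀ x, HasDerivAt f (f₁ x) x)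
    (h1 : ∀ x, HasDerivAt f₁ (f₂ x) x) (h2 : ∀ x, HasDerivAt f₂ (f₃ x) x)
    (hM : ∀ σ ∈ Set.uIcc 0 τ, |f₃ σ| ≤ M) :
    |f τ - f 0 - τ * f₁ 0 - τ ^ 2 / 2 * f₂ 0| ≤ M * |τ| ^ 3 := by
  have hM0 : 0 ≤ M := (abs_nonneg _).trans (hM 0 Set.left_mem_uIcc)
  have a2 : ∀ σ ∈ Set.uIcc 0 τ, |f₂ σ - f₂ 0| ≤ M * |τ| := fun σ hσ =>
    (abs_sub_le_of_deriv_le h2 fun s hs => hM s (uIcc_zero_subset hσ hs)).trans <| by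
      have := abs_le_of_mem_uIcc hσ
      gcongr
  have a1 : ∀ σ ∈ Set.uIcc 0 τ, |f₁ σ - f₁ 0 - σ * f₂ 0| ≤ M * |τ| ^ 2 := fun σ hσ => by
    have := abs_sub_le_of_deriv_le (f := fun s => f₁ s - s * f₂ 0) (f' := fun s => f₂ s - f₂ 0)
      (M := M * |τ|) (τ := σ)
      (fun x => ((h1 x).sub ((hasDerivAt_id x).mul_const _)).congr_deriv (by simp))
      fun s hs => a2 s (uIcc_zero_subset hσ hs)
    have e : f₁ σ - f₁ 0 - σ * f₂ 0 = f₁ σ - σ * f₂ 0 - (f₁ 0 - 0 * f₂ 0) := by ring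
    rw [e]
    refine this.trans ?_
    have := abs_le_of_mem_uIcc hσ
    rw [pow_two, ← mul_assoc]
    gcongr
  have := abs_sub_le_of_deriv_le (f := fun s => f s - s * f₁ 0 - s ^ 2 / 2 * f₂ 0)
      (f' := fun s => f₁ s - f₁ 0 - s * f₂ 0) (M := M * |τ| ^ 2) (τ := τ)
      (fun x => (((h0 x).sub ((hasDerivAt_id x).mul_const _)).sub
        ((((hasDerivAt_id x).pow 2).div_const 2).mul_const _)).congr_deriv (by simp))
      a1
  have e : f τ - f 0 - τ * f₁ 0 - τ ^ 2 / 2 * f₂ 0 =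
    f τ - τ * f₁ 0 - τ ^ 2 / 2 * f₂ 0 - (f 0 - 0 * f₁ 0 - 0 ^ 2 / 2 * f₂ 0) := by ring
  rw [e]
  refine this.trans (le_of_eq (by ring))

/-! ### Expansion of the potential -/

/-- Absorbing a power of `1 + |x|` costs an arbitrarily small part `a⁻¹` of the decay rate; the rate
`3/2` that remains is the one required of potentials. -/
theorem exp_decay_mul_pow (x : ℝ) {a : ℝ} (n : ℕ) (hn : 0 < n)
    {c : ℝ} (hc : 3 / 2 + a⁻¹ ≤ c) (ha0 : 0 < a) (hn1 : 1 ≤ a * n) :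
    (1 + |x|) ^ n * Real.exp (-c * |x|) ≤ (a * n) ^ n * Real.exp (-(3 / 2) * |x|) := by
  have hn' : (0 : ℝ) < n := by exact_mod_cast hn
  have h := one_add_pow_le_exp (c := (a * n)⁻¹) (by positivity) (inv_le_one_of_one_le₀ hn1)
    (abs_nonneg x) n
  rw [inv_inv] at h
  calc (1 + |x|) ^ n * Real.exp (-c * |x|)
      ≤ ((a * n) ^ n * Real.exp (n * (a * n)⁻¹ * |x|)) * Real.exp (-c * |x|) := by gcongr
    _ = (a * n) ^ n * Real.exp ((a⁻¹ - c) * |x|) := by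
        rw [mul_assoc, ← Real.exp_add]
        congr 2
        field_simp
        ring
    _ ≤ _ := by
        have : (a⁻¹ - c) * |x| ≤ -(3 / 2) * |x| :=
          mul_le_mul_of_nonneg_right (by linarith) (abs_nonneg x)
        gcongr

theorem sech_sq_decay (x : ℝ) (n : ℕ) (hn : n = 1 ∨ n = 2) :
    (1 + |x|) ^ n * sech x ^ 2 ≤ 64 * Real.exp (-(3 / 2) * |x|) := by
  have h0 := sech_sq_le x
  have h : (1 + |x|) ^ n * Real.exp (-2 * |x|) ≤ 16 * Real.exp (-(3 / 2) * |x|) := by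
    have hx := Real.exp_pos (-(3 / 2) * |x|)
    rcases hn with rfl | rfl
    · have := exp_decay_mul_pow x (a := 2) 1 (by norm_num) (c := 2) (by norm_num)
        (by norm_num) (by norm_num)
      refine this.trans ?_
      gcongr
      norm_num
    · have := exp_decay_mul_pow x (a := 2) 2 (by norm_num) (c := 2) (by norm_num)
        (by norm_num) (by norm_num)
      refine this.trans ?_
      gcongr
      norm_num
  calc (1 + |x|) ^ n * sech x ^ 2 ≤ (1 + |x|) ^ n * (4 * Real.exp (-2 * |x|)) := by gcongr
    _ ≤ _ := by linarith

theorem sech_sq_le_decay (x : ℝ) : sech x ^ 2 ≤ 64 * Real.exp (-(3 / 2) * |x|) := by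
  have := sech_sq_decay x 1 (Or.inl rfl)
  nlinarith [abs_nonneg x, sq_nonneg (sech x), mul_nonneg (abs_nonneg x) (sq_nonneg (sech x))]

theorem abs_q1_le (x : ℝ) : |q1 x| ≤ 128 * Real.exp (-(3 / 2) * |x|) := by
  have h := sech_sq_decay x 1 (Or.inl rfl)
  have ht := abs_tanh_le x
  have : |1 / 2 - 2 * x * Real.tanh x| ≤ 2 * (1 + |x|) ^ 1 := by
    refine (abs_sub _ _).trans ?_
    rw [abs_mul, abs_mul, abs_two, abs_of_pos (by norm_num : (0 : ℝ) < 1 / 2)]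
    nlinarith [abs_nonneg x]
  unfold q1
  rw [abs_mul, abs_of_nonneg (sq_nonneg _)]
  nlinarith [sq_nonneg (sech x), mul_le_mul_of_nonneg_left this (sq_nonneg (sech x))]

theorem q2_eq (x : ℝ) : q2 x = x ^ 2 * (sech x ^ 2 - 3 / 2 * (sech x ^ 2) ^ 2) -
    1 / 2 * x * Real.tanh x * sech x ^ 2 := by
  unfold q2
  rw [tanh_sq]; ring

theorem abs_q2_le (x : ℝ) : |q2 x| ≤ 256 * Real.exp (-(3 / 2) * |x|) := by
  have h := sech_sq_decay x 2 (Or.inr rfl)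
  have ht := abs_tanh_le x
  have hs0 := sq_nonneg (sech x)
  have hs1 : sech x ^ 2 ≤ 1 := pow_le_one₀ (sech_pos x).le (sech_le_one x)
  have e : q2 x = sech x ^ 2 * (x ^ 2 * (1 - 3 / 2 * sech x ^ 2) - 1 / 2 * x * Real.tanh x) := by
    rw [q2_eq]; ring
  have : |x ^ 2 * (1 - 3 / 2 * sech x ^ 2) - 1 / 2 * x * Real.tanh x| ≤ 4 * (1 + |x|) ^ 2 := by
    refine (abs_sub _ _).trans ?_
    rw [abs_mul, abs_mul, abs_mul, abs_of_pos (by norm_num : (0 : ℝ) < 1 / 2), ← sq_abs x, abs_sq]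
    have h1 : |1 - 3 / 2 * sech x ^ 2| ≤ 1 := by rw [abs_le]; constructor <;> linarith
    nlinarith [abs_nonneg x, mul_le_mul_of_nonneg_left h1 (sq_nonneg |x|),
      mul_le_mul_of_nonneg_left ht (abs_nonneg x)]
  rw [e, abs_mul, abs_of_nonneg hs0]
  nlinarith [mul_le_mul_of_nonneg_left this hs0]

theorem continuous_q1 : Continuous q1 := by
  unfold q1
  have := continuous_sech
  have := continuous_tanh
  fun_prop

theorem continuous_q2 : Continuous q2 := by
  unfold q2
  have := continuous_sech
  have := continuous_tanh
  fun_prop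

theorem potBound_V0 : PotBound V0 256 where
  meas i j := by
    have h := (continuous_Q.pow 2).measurable
    fin_cases i <;> fin_cases j <;> simp [V0] <;> first | exact h.mul_const _ | exact h
  bound x i j := by
    have h := sech_sq_le_decay x
    have h0 : 0 ≤ sech x ^ 2 := sq_nonneg _
    set e := Real.exp (-(3 / 2) * |x|)
    fin_cases i <;> fin_cases j <;> simp [V0, Q_sq, abs_mul] <;> linarith

theorem potBound_V1 : PotBound V1 1024 where
  meas i j := by
    have h := (continuous_Q.pow 2).measurable
    have h1 := continuous_q1.measurable
    have h2 := continuous_Q.measurable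
    fin_cases i <;> fin_cases j <;> simp [V1] <;> fun_prop
  bound x i j := by
    have h := sech_sq_le_decay x
    have h0 : 0 ≤ sech x ^ 2 := sq_nonneg _
    have h1 := abs_le.1 (abs_q1_le x)
    have he := Real.exp_pos (-(3 / 2) * |x|)
    set e := Real.exp (-(3 / 2) * |x|)
    rw [abs_le]
    fin_cases i <;> fin_cases j <;> simp [V1, Q_sq] <;> constructor <;> linarith

theorem potBound_V2 : PotBound V2 1024 where
  meas i j := by
    have h1 := continuous_q1.measurable
    have h2 := continuous_q2.measurable
    fin_cases i <;> fin_cases j <;> simp [V2] <;> fun_prop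
  bound x i j := by
    have h1 := abs_le.1 (abs_q1_le x)
    have h2 := abs_le.1 (abs_q2_le x)
    have he := Real.exp_pos (-(3 / 2) * |x|)
    set e := Real.exp (-(3 / 2) * |x|)
    rw [abs_le]
    fin_cases i <;> fin_cases j <;> simp [V2] <;> constructor <;> linarith

/-- The third order Taylor remainder of the potential in `p - 3`. -/
noncomputable def potRem (ε x : ℝ) : Mat := potential (3 + ε) x - V0 x - ε • V1 x - ε ^ 2 • V2 x

/-- Taylor expansion in the dilation parameter at fixed `x`. Each derivative in `τ` brings down a
factor `x`, and the cubic growth of the third one is absorbed by the surplus of decay over the rate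
`3/2`. -/
theorem sech_sq_taylor {τ : ℝ} (hτ : |τ| ≤ 1 / 20) (x : ℝ) :
    |sech ((1 + τ) * x) ^ 2 - sech x ^ 2 - τ * (-2 * x * Real.tanh x * sech x ^ 2) -
      τ ^ 2 / 2 * (x ^ 2 * (4 * sech x ^ 2 - 6 * (sech x ^ 2) ^ 2))| ≤
      54016 * Real.exp (-(3 / 2) * |x|) * |τ| ^ 3 := by
  have hd : ∀ σ : ℝ, HasDerivAt (fun σ => (1 + σ) * x) x σ := fun σ =>
    (((hasDerivAt_id σ).const_add 1).mul_const x).congr_deriv (by simp)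
  have hs : ∀ σ : ℝ, HasDerivAt (fun σ => sech ((1 + σ) * x))
      (-(Real.tanh ((1 + σ) * x) * sech ((1 + σ) * x)) * x) σ := fun σ =>
    (hasDerivAt_sech _).comp σ (hd σ)
  have ht : ∀ σ : ℝ, HasDerivAt (fun σ => Real.tanh ((1 + σ) * x))
      (sech ((1 + σ) * x) ^ 2 * x) σ := fun σ => (hasDerivAt_tanh _).comp σ (hd σ)
  have h := taylor_third_order (τ := τ) (M := 54016 * Real.exp (-(3 / 2) * |x|))
    (f := fun σ => sech ((1 + σ) * x) ^ 2)
    (f₁ := fun σ => -2 * x * Real.tanh ((1 + σ) * x) * sech ((1 + σ) * x) ^ 2)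
    (f₂ := fun σ => x ^ 2 * (4 * sech ((1 + σ) * x) ^ 2 - 6 * (sech ((1 + σ) * x) ^ 2) ^ 2))
    (f₃ := fun σ => x ^ 3 * (Real.tanh ((1 + σ) * x) * (-8 * sech ((1 + σ) * x) ^ 2 +
      24 * (sech ((1 + σ) * x) ^ 2) ^ 2)))
    (fun σ => ((hs σ).pow 2).congr_deriv (by simp; ring))
    (fun σ => (((ht σ).const_mul (-2 * x)).mul ((hs σ).pow 2)).congr_deriv (by
      have := tanh_sq ((1 + σ) * x)
      simp
      linear_combination (4 * x ^ 2 * sech ((1 + σ) * x) ^ 2) * this))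
    (fun σ => (((((hs σ).pow 2).const_mul 4).sub ((((hs σ).pow 2).pow 2).const_mul 6)).const_mul
      (x ^ 2)).congr_deriv (by simp; ring))
    (fun σ hσ => by
      have h1 := abs_le_of_mem_uIcc hσ
      set y := (1 + σ) * x with hy
      have hs0 := sq_nonneg (sech y)
      have hs1 : sech y ^ 2 ≤ 1 := pow_le_one₀ (sech_pos y).le (sech_le_one y)
      have hyx : 19 / 20 * |x| ≤ |y| := by
        rw [hy, abs_mul]
        have : 19 / 20 ≤ |1 + σ| := by
          have := neg_abs_le σ
          exact le_trans (by linarith) (le_abs_self _)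
        gcongr
      have hsy : sech y ^ 2 ≤ 4 * Real.exp (-(19 / 10) * |x|) :=
        (sech_sq_le y).trans (by gcongr ?_ * Real.exp ?_; linarith)
      have hb : |(-8 * sech y ^ 2 + 24 * (sech y ^ 2) ^ 2)| ≤ 32 * sech y ^ 2 := by
        rw [abs_le]; constructor <;> nlinarith
      have hx3 : |x| ^ 3 ≤ (1 + |x|) ^ 3 := by
        have := abs_nonneg x
        gcongr; linarith
      -- The dilation is at least `19/20`, which leaves the rate `19/10 = 3/2 + 2/5`; hence `a =
      -- 5/2`. The resulting constant is `128 · (15/2)³ = 54000`, rounded up in the statement.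
      have hE := exp_decay_mul_pow x (a := 5 / 2) 3 (by norm_num) (c := 19 / 10)
        (by norm_num) (by norm_num) (by norm_num)
      rw [abs_mul, abs_mul, abs_pow]
      calc |x| ^ 3 * (|Real.tanh y| * |(-8 * sech y ^ 2 + 24 * (sech y ^ 2) ^ 2)|)
          ≤ (1 + |x|) ^ 3 * (1 * (32 * (4 * Real.exp (-(19 / 10) * |x|)))) := by
            have := abs_tanh_le y
            gcongr
            exact hb.trans (by linarith)
        _ = 128 * ((1 + |x|) ^ 3 * Real.exp (-(19 / 10) * |x|)) := by ring
        _ ≤ 128 * (((5 / 2 : ℝ) * (3 : ℕ)) ^ 3 * Real.exp (-(3 / 2) * |x|)) := by gcongr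
        _ ≤ _ := by
          have he := Real.exp_pos (-(3 / 2) * |x|)
          rw [← mul_assoc]
          gcongr
          norm_num)
  simpa using h

/-- With `p = 3 + ε` the matrix of the potential is `2B + εE`, so a scalar remainder `ρ` of
`Q_p^{p-1}` after second order enters as `-ρB`. The `E` part already carries one factor `ε`, so
there the term `ε² q₂` belongs to the remainder as well. -/
theorem potRem_eq {ε : ℝ} (hε : |ε| ≤ 1 / 10) (x : ℝ) : ∃ ρ : ℝ,
    |ρ| ≤ 200000 * |ε| ^ 3 * Real.exp (-(3 / 2) * |x|) ∧
    potRem ε x = -(ρ • !![2, 1; 1, 2]) - (ε / 2 * (ε ^ 2 * q2 x + ρ)) • !![1, 1; 1, 1] := by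
  have hε' := abs_le.1 hε
  set S := sech ((1 + ε / 2) * x) ^ 2 with hS
  refine ⟨(2 + ε / 2) * S - 2 * sech x ^ 2 - ε * q1 x - ε ^ 2 * q2 x, ?_, ?_⟩
  · have hr := sech_sq_taylor (τ := ε / 2) (by rw [abs_div, abs_two]; linarith) x
    rw [← hS] at hr
    set r := S - sech x ^ 2 - ε / 2 * (-2 * x * Real.tanh x * sech x ^ 2) -
      (ε / 2) ^ 2 / 2 * (x ^ 2 * (4 * sech x ^ 2 - 6 * (sech x ^ 2) ^ 2)) with hrdef
    have e : (2 + ε / 2) * S - 2 * sech x ^ 2 - ε * q1 x - ε ^ 2 * q2 x =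
        (2 + ε / 2) * r + ε ^ 3 / 8 * (x ^ 2 * (2 * sech x ^ 2 - 3 * (sech x ^ 2) ^ 2)) := by
      rw [q2_eq, q1, hrdef]
      ring
    have h2 : |x ^ 2 * (2 * sech x ^ 2 - 3 * (sech x ^ 2) ^ 2)| ≤
        192 * Real.exp (-(3 / 2) * |x|) := by
      have hs0 := sq_nonneg (sech x)
      have hs1 : sech x ^ 2 ≤ 1 := pow_le_one₀ (sech_pos x).le (sech_le_one x)
      have := sech_sq_decay x 2 (Or.inr rfl)
      have hb : |2 * sech x ^ 2 - 3 * (sech x ^ 2) ^ 2| ≤ 3 * sech x ^ 2 := by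
        rw [abs_le]; constructor <;> nlinarith
      rw [abs_mul, abs_pow]
      have hx2 : |x| ^ 2 ≤ (1 + |x|) ^ 2 := by
        have := abs_nonneg x
        gcongr; linarith
      calc |x| ^ 2 * |2 * sech x ^ 2 - 3 * (sech x ^ 2) ^ 2| ≤ (1 + |x|) ^ 2 * (3 * sech x ^ 2) := by
            gcongr
        _ ≤ _ := by linarith
    have h3 : |2 + ε / 2| ≤ 3 := by rw [abs_le]; constructor <;> linarith
    rw [e]
    refine (abs_add_le _ _).trans ?_
    rw [abs_mul, abs_mul]
    rw [abs_div, abs_two] at hr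
    have h4 : |ε ^ 3 / 8| = |ε| ^ 3 / 8 := by rw [abs_div, abs_pow]; norm_num
    rw [h4]
    have he := Real.exp_pos (-(3 / 2) * |x|)
    have hp : 0 ≤ |ε| ^ 3 * Real.exp (-(3 / 2) * |x|) := by positivity
    calc _ ≤ 3 * (54016 * Real.exp (-(3 / 2) * |x|) * (|ε| / 2) ^ 3) +
          |ε| ^ 3 / 8 * (192 * Real.exp (-(3 / 2) * |x|)) := by gcongr
      _ ≤ _ := by nlinarith
  · have hp : soliton (3 + ε) x ^ (3 + ε - 1) = (2 + ε / 2) * S := by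
      rw [soliton_rpow (by linarith), hS]
      congr 1
      · ring
      · congr 3; ring
    ext i j
    fin_cases i <;> fin_cases j <;> simp [potRem, potential, hp, V0, V1, V2, Q_sq] <;> ring

theorem measurable_potential (p : ℝ) (hp : 1 < p) (i j : Fin 2) :
    Measurable fun x => potential p x i j := by
  have h : Continuous fun x => soliton p x ^ (p - 1) := by
    have := continuous_sech
    simp only [soliton_rpow hp]
    fun_prop
  simp only [potential, Matrix.smul_apply, smul_eq_mul]
  exact (h.const_mul _).measurable.mul_const _

theorem potBound_potRem {ε : ℝ} (hε : |ε| ≤ 1 / 10) : PotBound (potRem ε) (1000000 * |ε| ^ 3) where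
  meas i j := by
    have h := measurable_potential (3 + ε) (by have := abs_le.1 hε; linarith) i j
    exact ((h.sub (potBound_V0.meas i j)).sub ((potBound_V1.meas i j).const_mul _)).sub
      ((potBound_V2.meas i j).const_mul _)
  bound x i j := by
    obtain ⟨ρ, h1, h2⟩ := potRem_eq hε x
    have hq := abs_q2_le x
    set e := Real.exp (-(3 / 2) * |x|)
    have he : 0 < e := Real.exp_pos _
    have hp : 0 ≤ |ε| ^ 3 * e := by positivity
    have h3 : |ε / 2 * (ε ^ 2 * q2 x + ρ)| ≤ 200000 * (|ε| ^ 3 * e) := by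
      rw [abs_mul, abs_div, abs_two]
      have a1 : |ε| / 2 * (|ε| ^ 2 * |q2 x|) ≤ |ε| / 2 * (|ε| ^ 2 * (256 * e)) := by gcongr
      have a2 : |ε| / 2 * |ρ| ≤ 1 / 2 * (200000 * |ε| ^ 3 * e) := by
        gcongr; linarith
      have a3 : |ε ^ 2 * q2 x + ρ| ≤ |ε| ^ 2 * |q2 x| + |ρ| := by
        refine (abs_add_le _ _).trans ?_
        rw [abs_mul, abs_pow]
      have := mul_le_mul_of_nonneg_left a3 (by positivity : 0 ≤ |ε| / 2)
      nlinarith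
    rw [h2]
    have h1' := abs_le.1 h1
    have h3' := abs_le.1 h3
    rw [abs_le]
    fin_cases i <;> fin_cases j <;> simp <;> constructor <;> nlinarith

/-! ### Expansion of the resolvent kernel -/

/-- The Green function of `-∂ₓ² + σ²` as a function of the distance. -/
noncomputable def green (σ z : ℝ) : ℝ := 1 / (2 * σ) * Real.exp (-σ * z)

theorem hasDerivAt_green {σ : ℝ} (hσ : σ ≠ 0) (z : ℝ) :
    HasDerivAt (fun σ => green σ z) (-(z / (2 * σ) + 1 / (2 * σ ^ 2)) * Real.exp (-σ * z)) σ := by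
  have h1 : HasDerivAt (fun σ : ℝ => 1 / (2 * σ)) (-(1 / (2 * σ ^ 2))) σ := by
    refine ((hasDerivAt_const σ (1 : ℝ)).div ((hasDerivAt_id σ).const_mul 2) (by simpa)).congr_deriv
      ?_
    simp; field_simp
  have h2 : HasDerivAt (fun σ : ℝ => Real.exp (-σ * z)) (Real.exp (-σ * z) * (-z)) σ :=
    ((((hasDerivAt_id σ).neg).mul_const z).exp).congr_deriv (by simp)
  refine (h1.mul h2).congr_deriv ?_
  field_simp
  ring

/-- Mean value theorem in the spectral parameter: away from `σ = 0` the derivative grows only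
linearly in `z`. -/
theorem abs_green_sub_le {m σ σ' z : ℝ} (hm : 0 < m) (hm1 : m ≤ 1) (hσ : m ≤ σ) (hσ' : m ≤ σ')
    (hz : 0 ≤ z) : |green σ z - green σ' z| ≤ (m⁻¹) ^ 2 * |σ - σ'| * (1 + z) := by
  have := (convex_Ici m).norm_image_sub_le_of_norm_hasDerivWithin_le
    (f := fun σ => green σ z) (C := (m⁻¹) ^ 2 * (1 + z))
    (fun s hs => (hasDerivAt_green (ne_of_gt (lt_of_lt_of_le hm hs)) z).hasDerivWithinAt)
    (fun s hs => ?_) (x := σ') (y := σ) hσ' hσ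
  · simp only [Real.norm_eq_abs] at this
    refine this.trans (le_of_eq (by ring))
  · have hs : m ≤ s := hs
    have hs0 : 0 < s := lt_of_lt_of_le hm hs
    have he : Real.exp (-s * z) ≤ 1 := Real.exp_le_one_iff.2 (by nlinarith)
    rw [norm_mul, norm_neg, Real.norm_of_nonneg (by positivity),
      Real.norm_of_nonneg (Real.exp_pos _).le]
    have hi : s⁻¹ ≤ m⁻¹ := inv_anti₀ hm hs
    have hi1 : 1 ≤ m⁻¹ := (one_le_inv₀ hm).2 hm1
    have hi0 : 0 < s⁻¹ := by positivity
    calc (z / (2 * s) + 1 / (2 * s ^ 2)) * Real.exp (-s * z)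
        ≤ (z / (2 * s) + 1 / (2 * s ^ 2)) * 1 := by gcongr
      _ = 1 / 2 * (z * s⁻¹ + s⁻¹ ^ 2) := by field_simp
      _ ≤ 1 / 2 * (z * m⁻¹ ^ 2 + m⁻¹ ^ 2) := by
          have : s⁻¹ ≤ m⁻¹ ^ 2 := hi.trans (by nlinarith)
          gcongr
      _ ≤ _ := by nlinarith [mul_nonneg hz (sq_nonneg m⁻¹), sq_nonneg m⁻¹]

theorem abs_green_taylor {α z : ℝ} (hα : 0 < α) (hz : 0 ≤ z) :
    |green α z - α⁻¹ * (1 / 2) - -z / 2 - α * (z ^ 2 / 4)| ≤ α ^ 2 * (1 + z) ^ 3 := by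
  have hd : ∀ σ : ℝ, HasDerivAt (fun σ : ℝ => Real.exp (-σ)) (-Real.exp (-σ)) σ := fun σ =>
    ((hasDerivAt_id σ).neg.exp).congr_deriv (by simp)
  have h := taylor_third_order (τ := α * z) (M := 1) (fun σ => hd σ)
    (fun σ => (hd σ).neg.congr_deriv (neg_neg _)) (fun σ => hd σ) (fun σ hσ => by
      rw [Set.uIcc_of_le (by positivity)] at hσ
      rw [abs_neg, abs_of_pos (Real.exp_pos _)]
      exact Real.exp_le_one_iff.2 (by linarith [hσ.1]))
  -- The expansion is that of `exp (-s)` at `s = α z`, divided by `2α`; the division turns the cubic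
  -- remainder into `α² z³`.
  have e : green α z - α⁻¹ * (1 / 2) - -z / 2 - α * (z ^ 2 / 4) =
      (2 * α)⁻¹ * (Real.exp (-(α * z)) - Real.exp (-0) - α * z * -Real.exp (-0) -
        (α * z) ^ 2 / 2 * Real.exp (-0)) := by
    simp only [green, neg_zero, Real.exp_zero, neg_mul]
    field_simp
    ring
  rw [e, abs_mul, abs_of_pos (by positivity)]
  rw [abs_of_nonneg (by positivity : 0 ≤ α * z)] at h
  have hz3 : z ^ 3 ≤ (1 + z) ^ 3 := by gcongr; linarith
  calc _ ≤ (2 * α)⁻¹ * (1 * (α * z) ^ 3) := by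
        have := inv_pos.2 (by positivity : 0 < 2 * α)
        gcongr
    _ = α ^ 2 * (z ^ 3 / 2) := by field_simp
    _ ≤ _ := by
      have : 0 ≤ z ^ 3 := by positivity
      gcongr
      linarith

theorem one_le_sqrt_two_sub {α : ℝ} (hα0 : 0 ≤ α) (hα : α ≤ 1) : 1 ≤ √(2 - α ^ 2) :=
  Real.one_le_sqrt.2 (by nlinarith)

theorem abs_sqrt_two_sub_le {α α' : ℝ} (h0 : 0 ≤ α) (h1 : α ≤ 1) (h0' : 0 ≤ α') (h1' : α' ≤ 1) :
    |√(2 - α ^ 2) - √(2 - α' ^ 2)| ≤ |α ^ 2 - α' ^ 2| := by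
  have a := one_le_sqrt_two_sub h0 h1
  have b := one_le_sqrt_two_sub h0' h1'
  have ea : √(2 - α ^ 2) ^ 2 = 2 - α ^ 2 := Real.sq_sqrt (by nlinarith)
  have eb : √(2 - α' ^ 2) ^ 2 = 2 - α' ^ 2 := Real.sq_sqrt (by nlinarith)
  have : α ^ 2 - α' ^ 2 =
      -((√(2 - α ^ 2) - √(2 - α' ^ 2)) * (√(2 - α ^ 2) + √(2 - α' ^ 2))) := by nlinarith
  rw [this, abs_neg, abs_mul]
  have h2 : 1 ≤ |√(2 - α ^ 2) + √(2 - α' ^ 2)| := le_trans (by linarith) (le_abs_self _)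
  nlinarith [abs_nonneg (√(2 - α ^ 2) - √(2 - α' ^ 2))]

theorem resolventKernel_eq (α x y : ℝ) :
    resolventKernel α x y = !![green α |x - y|, 0; 0, green √(2 - α ^ 2) |x - y|] := rfl

theorem R0_eq (x y : ℝ) : R0 x y = !![-|x - y| / 2, 0; 0, green √2 |x - y|] := by
  have h : 1 / (2 * √2) * Real.exp (-√2 * |x - y|) = Real.exp (-√2 * |x - y|) / (2 * √2) := by
    ring
  simp only [R0, green, h]

theorem measurable_abs_sub : Measurable fun p : ℝ × ℝ => |p.1 - p.2| := by
  have : Continuous fun p : ℝ × ℝ => |p.1 - p.2| := by fun_prop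
  exact this.measurable

theorem measurable_green (σ : ℝ) : Measurable (green σ) := by
  unfold green; fun_prop

theorem one_add_abs_le_pow (z : ℝ) : 1 ≤ (1 + |z|) ^ 3 ∧ 1 + |z| ≤ (1 + |z|) ^ 3 ∧
    |z| ^ 2 ≤ (1 + |z|) ^ 3 := by
  have := abs_nonneg z
  refine ⟨one_le_pow₀ (by linarith), ?_, ?_⟩ <;> nlinarith [pow_nonneg this 3, pow_nonneg this 2]

theorem resBound_diag {f g : ℝ → ℝ} (hf : Measurable f) (hg : Measurable g) {c : ℝ} (hc : 0 ≤ c)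
    (hfc : ∀ z, 0 ≤ z → |f z| ≤ c * (1 + z) ^ 3) (hgc : ∀ z, 0 ≤ z → |g z| ≤ c * (1 + z) ^ 3) :
    ResBound (fun x y => !![f |x - y|, 0; 0, g |x - y|]) c where
  meas i j := by
    fin_cases i <;> fin_cases j <;> simp
    · exact hf.comp measurable_abs_sub
    · exact hg.comp measurable_abs_sub
  bound x y i j := by
    have h0 : 0 ≤ c * (1 + |x - y|) ^ 3 := by positivity
    fin_cases i <;> fin_cases j <;> simp
    exacts [hfc _ (abs_nonneg _), h0, h0, hgc _ (abs_nonneg _)]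

theorem abs_green_le {σ z : ℝ} (hσ : 1 ≤ σ) (hz : 0 ≤ z) : |green σ z| ≤ 1 := by
  have hp : 0 < σ := by linarith
  have h1 : Real.exp (-σ * z) ≤ 1 := Real.exp_le_one_iff.2 (by nlinarith)
  have h2 : 1 / (2 * σ) ≤ 1 := (div_le_one (by positivity)).2 (by linarith)
  unfold green
  rw [abs_of_nonneg (by positivity)]
  exact mul_le_one₀ h2 (Real.exp_pos _).le h1

theorem one_le_sqrt_two : (1 : ℝ) ≤ √2 := Real.one_le_sqrt.2 (by norm_num)

theorem resBound_Rm1 : ResBound Rm1 1 := by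
  refine resBound_diag (f := fun _ => 1 / 2) (g := fun _ => 0) measurable_const measurable_const
    zero_le_one (fun z hz => ?_) (fun z hz => ?_)
  · have : 1 ≤ (1 + z) ^ 3 := one_le_pow₀ (by linarith)
    rw [abs_of_pos (by norm_num)]; linarith
  · rw [abs_zero]; positivity

theorem resBound_R0 : ResBound R0 1 := by
  have e : R0 = fun x y => !![(fun z => -z / 2) |x - y|, 0; 0, green √2 |x - y|] := by
    ext1 x; ext1 y; exact R0_eq x y
  rw [e]
  refine resBound_diag (f := fun z => -z / 2) (by fun_prop) (measurable_green _) zero_le_one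
    (fun z hz => ?_) (fun z hz => ?_)
  · have h := (one_add_abs_le_pow z).2.1
    rw [abs_of_nonneg hz] at h
    rw [abs_le]; constructor <;> linarith
  · have : 1 ≤ (1 + z) ^ 3 := one_le_pow₀ (by linarith)
    linarith [abs_green_le one_le_sqrt_two hz]

theorem resBound_R1 : ResBound R1 1 := by
  refine resBound_diag (f := fun z => z ^ 2 / 4) (g := fun _ => 0) (by fun_prop) measurable_const
    zero_le_one (fun z hz => ?_) (fun z hz => ?_)
  · have h := (one_add_abs_le_pow z).2.2
    rw [abs_of_nonneg hz] at h
    rw [abs_of_nonneg (by positivity)]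
    have := sq_nonneg z
    linarith
  · rw [abs_zero]; positivity

/-- The resolvent kernel without its singular part. -/
noncomputable def resReg (α x y : ℝ) : Mat := resolventKernel α x y - α⁻¹ • Rm1 x y

/-- The second order remainder of the expansion of the resolvent kernel at `α = 0`. -/
noncomputable def resRem (α x y : ℝ) : Mat := resReg α x y - R0 x y - α • R1 x y

/-- The first component is the Taylor remainder of the Green function. The second is regular at `α =
0` and depends on `α` through `√(2 - α²)` only, hence differs from its limit by `O(α²)`. -/
theorem resBound_resRem {α : ℝ} (h0 : 0 < α) (h1 : α ≤ 1) : ResBound (resRem α) (α ^ 2) := by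
  have e : resRem α = fun x y =>
      !![(fun z => green α z - α⁻¹ * (1 / 2) - -z / 2 - α * (z ^ 2 / 4)) |x - y|, 0; 0,
        (fun z => green √(2 - α ^ 2) z - green √2 z) |x - y|] := by
    ext x y i j
    fin_cases i <;> fin_cases j <;> simp [resRem, resReg, resolventKernel_eq, R0_eq, Rm1, R1]
  rw [e]
  refine resBound_diag ?_ ((measurable_green _).sub (measurable_green _)) (by positivity)
    (fun z hz => abs_green_taylor h0 hz) (fun z hz => ?_)
  · have := measurable_green α
    fun_prop
  · have h := abs_green_sub_le (m := 1) one_pos le_rfl (one_le_sqrt_two_sub h0.le h1)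
      one_le_sqrt_two hz
    have h2 := abs_sqrt_two_sub_le h0.le h1 le_rfl zero_le_one
    norm_num at h h2
    refine h.trans ?_
    have h3 := (one_add_abs_le_pow z).2.1
    rw [abs_of_nonneg hz] at h3
    gcongr

/-- Serves the continuity of the operator family in `α > 0`, which the intermediate value theorem
needs. -/
theorem resBound_resolventKernel_sub {m α α' : ℝ} (hm : 0 < m) (h0 : m ≤ α) (h1 : α ≤ 1)
    (h0' : m ≤ α') (h1' : α' ≤ 1) :
    ResBound (fun x y => resolventKernel α x y - resolventKernel α' x y)
      (2 * (m⁻¹) ^ 2 * |α - α'|) := by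
  have e : (fun x y => resolventKernel α x y - resolventKernel α' x y) = fun x y =>
      !![(fun z => green α z - green α' z) |x - y|, 0; 0,
        (fun z => green √(2 - α ^ 2) z - green √(2 - α' ^ 2) z) |x - y|] := by
    ext x y i j
    fin_cases i <;> fin_cases j <;> simp [resolventKernel_eq]
  have hm1 : m ≤ 1 := h0.trans h1
  rw [e]
  refine resBound_diag ((measurable_green _).sub (measurable_green _))
    ((measurable_green _).sub (measurable_green _)) (by positivity) (fun z hz => ?_)
    (fun z hz => ?_)
  all_goals
    have h3 := (one_add_abs_le_pow z).2.1
    rw [abs_of_nonneg hz] at h3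
  · refine (abs_green_sub_le hm hm1 h0 h0' hz).trans ?_
    gcongr ?_ * ?_
    nlinarith [mul_nonneg (sq_nonneg m⁻¹) (abs_nonneg (α - α'))]
  · refine (abs_green_sub_le hm hm1 (hm1.trans (one_le_sqrt_two_sub (by linarith) h1))
      (hm1.trans (one_le_sqrt_two_sub (by linarith) h1')) hz).trans ?_
    have h2 := abs_sqrt_two_sub_le (by linarith) h1 (by linarith) h1'
    have h4 : |α ^ 2 - α' ^ 2| ≤ 2 * |α - α'| := by
      rw [show α ^ 2 - α' ^ 2 = (α + α') * (α - α') by ring, abs_mul]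
      gcongr
      rw [abs_of_nonneg (by linarith)]
      linarith
    gcongr ?_ * ?_
    nlinarith [mul_nonneg (sq_nonneg m⁻¹) (abs_nonneg (α - α')), sq_nonneg m⁻¹,
      mul_le_mul_of_nonneg_left (h2.trans h4) (sq_nonneg m⁻¹)]

theorem resBound_resolventKernel {α : ℝ} (h0 : 0 < α) (h1 : α ≤ 1) :
    ResBound (resolventKernel α) (α⁻¹) := by
  refine resBound_diag (measurable_green _) (measurable_green _) (by positivity) (fun z hz => ?_)
    (fun z hz => ?_)
  · have h : Real.exp (-α * z) ≤ 1 := Real.exp_le_one_iff.2 (by nlinarith)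
    have h2 : 1 ≤ (1 + z) ^ 3 := one_le_pow₀ (by linarith)
    unfold green
    rw [abs_of_nonneg (by positivity)]
    have : 1 / (2 * α) ≤ α⁻¹ := by
      rw [one_div]; exact inv_anti₀ h0 (by linarith)
    gcongr
    linarith
  · have h := abs_green_le (one_le_sqrt_two_sub h0.le h1) hz
    have h2 : 1 ≤ (1 + z) ^ 3 := one_le_pow₀ (by linarith)
    have h3 : 1 ≤ α⁻¹ := (one_le_inv₀ h0).2 h1
    nlinarith

theorem ResBound.add {R R' : ℝ → ℝ → Mat} {c c' : ℝ} (h : ResBound R c) (h' : ResBound R' c') :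
    ResBound (fun x y => R x y + R' x y) (c + c') where
  meas i j := (h.meas i j).add (h'.meas i j)
  bound x y i j := by
    have := abs_add_le (R x y i j) (R' x y i j)
    have := h.bound x y i j
    have := h'.bound x y i j
    simp only [Matrix.add_apply]
    linarith

theorem ResBound.smul {R : ℝ → ℝ → Mat} {c : ℝ} (h : ResBound R c) (a : ℝ) :
    ResBound (fun x y => a • R x y) (|a| * c) where
  meas i j := (h.meas i j).const_mul a
  bound x y i j := by
    simp only [Matrix.smul_apply, smul_eq_mul, abs_mul]
    have := mul_le_mul_of_nonneg_left (h.bound x y i j) (abs_nonneg a)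
    linarith

theorem PotBound.add {V V' : ℝ → Mat} {c c' : ℝ} (h : PotBound V c) (h' : PotBound V' c') :
    PotBound (fun x => V x + V' x) (c + c') where
  meas i j := (h.meas i j).add (h'.meas i j)
  bound x i j := by
    have := abs_add_le (V x i j) (V' x i j)
    have := h.bound x i j
    have := h'.bound x i j
    simp only [Matrix.add_apply]
    linarith

theorem PotBound.smul {V : ℝ → Mat} {c : ℝ} (h : PotBound V c) (a : ℝ) :
    PotBound (fun x => a • V x) (|a| * c) where
  meas i j := (h.meas i j).const_mul a
  bound x i j := by
    simp only [Matrix.smul_apply, smul_eq_mul, abs_mul]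
    have := mul_le_mul_of_nonneg_left (h.bound x i j) (abs_nonneg a)
    linarith

open Filter Topology

/-! ### The differential equations solved by the resolvent kernels. -/

/-! ### Exponentially decaying functions -/

/-- Exponential decay at infinity. -/
def ExpDecay {E : Type*} [NormedAddCommGroup E] (f : ℝ → E) : Prop :=
  ∃ C c : ℝ, 0 < c ∧ ∀ x, ‖f x‖ ≤ C * Real.exp (-c * |x|)

namespace ExpDecay

variable {E : Type*} [NormedAddCommGroup E] {f g : ℝ → E}

theorem add (hf : ExpDecay f) (hg : ExpDecay g) : ExpDecay fun x => f x + g x := by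
  obtain ⟨C, c, hc, h⟩ := hf
  obtain ⟨D, d, hd, h'⟩ := hg
  have hC : 0 ≤ C := by simpa using (norm_nonneg _).trans (h 0)
  have hD : 0 ≤ D := by simpa using (norm_nonneg _).trans (h' 0)
  refine ⟨C + D, min c d, lt_min hc hd, fun x => (norm_add_le _ _).trans ?_⟩
  have h1 : Real.exp (-c * |x|) ≤ Real.exp (-(min c d) * |x|) := by
    have := min_le_left c d
    have := abs_nonneg x
    gcongr
  have h2 : Real.exp (-d * |x|) ≤ Real.exp (-(min c d) * |x|) := by
    have := min_le_right c d
    have := abs_nonneg x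
    gcongr
  have a1 := (h x).trans (mul_le_mul_of_nonneg_left h1 hC)
  have a2 := (h' x).trans (mul_le_mul_of_nonneg_left h2 hD)
  linarith

theorem of_le {F : Type*} [NormedAddCommGroup F] {g : ℝ → F} (hf : ExpDecay f) (M : ℝ)
    (h : ∀ x, ‖g x‖ ≤ M * ‖f x‖) (hM : 0 ≤ M) : ExpDecay g := by
  obtain ⟨C, c, hc, h'⟩ := hf
  refine ⟨M * C, c, hc, fun x => (h x).trans ?_⟩
  rw [mul_assoc]
  exact mul_le_mul_of_nonneg_left (h' x) hM

theorem neg (hf : ExpDecay f) : ExpDecay fun x => -f x :=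
  hf.of_le 1 (fun x => by simp) zero_le_one

theorem sub (hf : ExpDecay f) (hg : ExpDecay g) : ExpDecay fun x => f x - g x := by
  simpa only [sub_eq_add_neg] using hf.add hg.neg

theorem const_mul {f : ℝ → ℝ} (hf : ExpDecay f) (a : ℝ) : ExpDecay fun x => a * f x :=
  hf.of_le |a| (fun x => by simp) (abs_nonneg a)

theorem bdd_mul {f b : ℝ → ℝ} (hf : ExpDecay f) {M : ℝ} (hb : ∀ x, |b x| ≤ M) :
    ExpDecay fun x => b x * f x :=
  hf.of_le M (fun x => by
    rw [norm_mul]; exact mul_le_mul_of_nonneg_right (hb x) (norm_nonneg _))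
    ((abs_nonneg _).trans (hb 0))

theorem id_mul {f : ℝ → ℝ} (hf : ExpDecay f) : ExpDecay fun x => x * f x := by
  obtain ⟨C, c, hc, h⟩ := hf
  have hC : 0 ≤ C := by simpa using (norm_nonneg _).trans (h 0)
  refine ⟨C * (c / 2)⁻¹, c / 2, by positivity, fun x => ?_⟩
  have h1 : |x| ≤ (c / 2)⁻¹ * Real.exp (c / 2 * |x|) := by
    have := Real.add_one_le_exp (c / 2 * |x|)
    rw [le_inv_mul_iff₀ (by positivity)]
    linarith
  rw [norm_mul, Real.norm_eq_abs]
  calc |x| * ‖f x‖ ≤ ((c / 2)⁻¹ * Real.exp (c / 2 * |x|)) * (C * Real.exp (-c * |x|)) := by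
        have := h x
        gcongr
    _ = C * (c / 2)⁻¹ * (Real.exp (c / 2 * |x|) * Real.exp (-c * |x|)) := by ring
    _ = _ := by rw [← Real.exp_add]; congr 2; ring

theorem integrable (hf : ExpDecay f) (hm : Continuous f) : Integrable f := by
  obtain ⟨C, c, hc, h⟩ := hf
  exact (((integral_exp_neg_abs hc).1).const_mul C).mono' hm.aestronglyMeasurable (ae_of_all _ h)

theorem memLp_two (hf : ExpDecay f) (hm : Continuous f) : MemLp f 2 volume := by
  rw [← memLp_norm_iff hm.aestronglyMeasurable,
    memLp_two_iff_integrable_sq hm.norm.aestronglyMeasurable]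
  obtain ⟨C, c, hc, h⟩ := hf
  refine (((integral_exp_neg_abs (c := 2 * c) (by positivity)).1).const_mul (C ^ 2)).mono'
    (hm.norm.pow 2).aestronglyMeasurable (ae_of_all _ fun x => ?_)
  rw [Real.norm_of_nonneg (by positivity)]
  refine (pow_le_pow_left₀ (norm_nonneg _) (h x) 2).trans (le_of_eq ?_)
  rw [mul_pow, ← Real.exp_nat_mul]
  congr 2; push_cast; ring

theorem tendsto_exp {c : ℝ} (hc : 0 < c) {l : Filter ℝ} (hl : Tendsto (fun x : ℝ => |x|) l atTop)
    (C : ℝ) : Tendsto (fun x : ℝ => C * Real.exp (-c * |x|)) l (𝓝 0) := by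
  rw [← mul_zero C]
  refine Tendsto.const_mul C (Real.tendsto_exp_atBot.comp ?_)
  exact hl.const_mul_atTop_of_neg (neg_lt_zero.2 hc)

theorem tendsto_atTop (hf : ExpDecay f) : Tendsto f atTop (𝓝 0) := by
  obtain ⟨C, c, hc, h⟩ := hf
  exact squeeze_zero_norm h (tendsto_exp hc tendsto_abs_atTop_atTop C)

theorem tendsto_atBot (hf : ExpDecay f) : Tendsto f atBot (𝓝 0) := by
  obtain ⟨C, c, hc, h⟩ := hf
  exact squeeze_zero_norm h (tendsto_exp hc tendsto_abs_atBot_atTop C)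

/-- The integral of the derivative of a decaying function vanishes. -/
theorem integral_deriv_eq_zero {f f' : ℝ → ℝ} (hf : ExpDecay f)
    (hd : ∀ x, HasDerivAt f (f' x) x) (hi : Integrable f') : ∫ x, f' x = 0 := by
  have := integral_of_hasDerivAt_of_tendsto hd hi hf.tendsto_atBot hf.tendsto_atTop
  simpa using this

end ExpDecay

/-! ### Half line integrals -/

theorem integral_split {E : Type*} [NormedAddCommGroup E] [NormedSpace ℝ E] {f : ℝ → E}
    (hi : Integrable f) (x : ℝ) :
    ∫ y, f y = (∫ y in Set.Iic x, f y) + ∫ y in Set.Ioi x, f y :=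
  (intervalIntegral.integral_Iic_add_Ioi hi.integrableOn hi.integrableOn).symm

section HalfLine

variable {E : Type*} [NormedAddCommGroup E] [NormedSpace ℝ E] [CompleteSpace E] {f : ℝ → E}

theorem hasDerivAt_integral_Iic (hc : Continuous f) (hi : ∀ x, IntegrableOn f (Set.Iic x)) (x : ℝ) :
    HasDerivAt (fun x => ∫ y in Set.Iic x, f y) (f x) x := by
  have e : (fun x => ∫ y in Set.Iic x, f y) =
      fun x => (∫ y in Set.Iic 0, f y) + ∫ y in (0 : ℝ)..x, f y := by
    ext1 x
    rw [← intervalIntegral.integral_Iic_sub_Iic (hi 0) (hi x)]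
    abel
  rw [e]
  exact (intervalIntegral.integral_hasDerivAt_right (hc.intervalIntegrable _ _)
    hc.aestronglyMeasurable.stronglyMeasurableAtFilter hc.continuousAt).const_add _

theorem hasDerivAt_integral_Ioi (hc : Continuous f) (hi : ∀ x, IntegrableOn f (Set.Ioi x)) (x : ℝ) :
    HasDerivAt (fun x => ∫ y in Set.Ioi x, f y) (-f x) x := by
  have e : (fun x => ∫ y in Set.Ioi x, f y) =
      fun x => (∫ y in Set.Ioi 0, f y) - ∫ y in (0 : ℝ)..x, f y := by
    ext1 x
    rw [← intervalIntegral.integral_interval_add_Ioi (hi 0) (hi x)]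
    abel
  rw [e]
  exact (intervalIntegral.integral_hasDerivAt_right (hc.intervalIntegrable _ _)
    hc.aestronglyMeasurable.stronglyMeasurableAtFilter hc.continuousAt).const_sub _

end HalfLine

/-! ### The resolvent of the Laplacian in one dimension -/

section Green

variable {f : ℝ → ℂ}

theorem integrable_smul_of_bdd {g : ℝ → ℝ} (hg : Continuous g) {M : ℝ} (hM : ∀ x, |g x| ≤ M)
    (hi : Integrable f) : Integrable fun y => g y • f y := by
  refine (hi.norm.const_mul M).mono' (hg.aestronglyMeasurable.smul hi.aestronglyMeasurable)
    (ae_of_all _ fun x => ?_)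
  rw [norm_smul]
  exact mul_le_mul_of_nonneg_right (hM x) (norm_nonneg _)

/-- `(-∂ₓ² + σ²)⁻¹` produces classical, exponentially decaying solutions. -/
theorem green_solution {σ : ℝ} (hσ : 0 < σ) (hf : Continuous f) {M c s : ℝ} (hs : 0 < s)
    (hsσ : s ≤ σ) (hsc : s < c) (hM : ∀ y, ‖f y‖ ≤ M * Real.exp (-c * |y|)) :
    ∃ φ' : ℝ → ℂ, (∀ x, HasDerivAt (fun x => ∫ y, green σ |x - y| • f y) (φ' x) x) ∧
      (∀ x, HasDerivAt φ' (σ ^ 2 • (∫ y, green σ |x - y| • f y) - f x) x) ∧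
      (∃ C, ∀ x, ‖∫ y, green σ |x - y| • f y‖ ≤ C * Real.exp (-s * |x|)) ∧
      ∃ C, ∀ x, ‖φ' x‖ ≤ C * Real.exp (-s * |x|) := by
  have hfi : Integrable f := ExpDecay.integrable ⟨M, c, hs.trans hsc, hM⟩ hf
  have hL : ∀ x, IntegrableOn (fun y => Real.exp (σ * y) • f y) (Set.Iic x) := fun x => by
    refine ((hfi.norm.const_mul (Real.exp (σ * x))).integrableOn (s := Set.Iic x)).mono'
      ((by fun_prop : Continuous fun y => Real.exp (σ * y) • f y).aestronglyMeasurable.restrict)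
      ((ae_restrict_mem measurableSet_Iic).mono fun y hy => ?_)
    rw [norm_smul, Real.norm_of_nonneg (Real.exp_pos _).le]
    have : y ≤ x := hy
    gcongr
  have hR : ∀ x, IntegrableOn (fun y => Real.exp (-σ * y) • f y) (Set.Ioi x) := fun x => by
    refine ((hfi.norm.const_mul (Real.exp (-σ * x))).integrableOn (s := Set.Ioi x)).mono'
      ((by fun_prop : Continuous fun y => Real.exp (-σ * y) • f y).aestronglyMeasurable.restrict)
      ((ae_restrict_mem measurableSet_Ioi).mono fun y hy => ?_)
    rw [norm_smul, Real.norm_of_nonneg (Real.exp_pos _).le]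
    have : x < y := hy
    gcongr ?_ * ‖f y‖
    exact Real.exp_le_exp.2 (by nlinarith)
  -- Splitting the integral at `y = x` factors the kernel: the solution is `(e^{-σx} L + e^{σx} R) /
  -- (2σ)`, and both half line integrals can be differentiated directly.
  set L : ℝ → ℂ := fun x => ∫ y in Set.Iic x, Real.exp (σ * y) • f y with hLdef
  set R : ℝ → ℂ := fun x => ∫ y in Set.Ioi x, Real.exp (-σ * y) • f y with hRdef
  have hexpM : ∀ z : ℝ, |Real.exp (-σ * |z|)| ≤ 1 := fun z => by
    rw [abs_of_pos (Real.exp_pos _)]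
    exact Real.exp_le_one_iff.2 (by nlinarith [abs_nonneg z])
  have hint : ∀ x, Integrable fun y => Real.exp (-σ * |x - y|) • f y := fun x =>
    integrable_smul_of_bdd (by fun_prop) (fun y => hexpM _) hfi
  have eL : ∀ x, ∫ y in Set.Iic x, Real.exp (-σ * |x - y|) • f y = Real.exp (-σ * x) • L x := by
    intro x
    rw [hLdef, ← integral_smul]
    refine setIntegral_congr_fun measurableSet_Iic fun y hy => ?_
    have : y ≤ x := hy
    rw [smul_smul, ← Real.exp_add, abs_of_nonneg (by linarith)]
    congr 2; ring
  have eR : ∀ x, ∫ y in Set.Ioi x, Real.exp (-σ * |x - y|) • f y = Real.exp (σ * x) • R x := by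
    intro x
    rw [hRdef, ← integral_smul]
    refine setIntegral_congr_fun measurableSet_Ioi fun y hy => ?_
    have : x < y := hy
    rw [smul_smul, ← Real.exp_add, abs_of_neg (by linarith)]
    congr 2; ring
  have eφ : ∀ x, ∫ y, green σ |x - y| • f y =
      (1 / (2 * σ)) • (Real.exp (-σ * x) • L x + Real.exp (σ * x) • R x) := by
    intro x
    rw [← eL, ← eR, ← integral_split (hint x), ← integral_smul]
    simp only [green, smul_smul]
  have dL : ∀ x, HasDerivAt L (Real.exp (σ * x) • f x) x :=
    hasDerivAt_integral_Iic (by fun_prop) hL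
  have dR : ∀ x, HasDerivAt R (-(Real.exp (-σ * x) • f x)) x :=
    hasDerivAt_integral_Ioi (by fun_prop) hR
  have dE : ∀ (a x : ℝ), HasDerivAt (fun x => Real.exp (a * x)) (a * Real.exp (a * x)) x :=
    fun a x => (((hasDerivAt_id x).const_mul a).exp).congr_deriv (by simp; ring)
  have hee : ∀ x : ℝ, Real.exp (-σ * x) * Real.exp (σ * x) = 1 := fun x => by
    rw [← Real.exp_add]; simp
  have hA : ∀ x, HasDerivAt (fun x => Real.exp (-σ * x) • L x)
      (f x - σ • (Real.exp (-σ * x) • L x)) x := fun x => by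
    refine ((dE (-σ) x).smul (dL x)).congr_deriv ?_
    rw [smul_smul, hee, one_smul]
    module
  have hB : ∀ x, HasDerivAt (fun x => Real.exp (σ * x) • R x)
      (-f x + σ • (Real.exp (σ * x) • R x)) x := fun x => by
    refine ((dE σ x).smul (dR x)).congr_deriv ?_
    rw [smul_neg, smul_smul, mul_comm (Real.exp (σ * x)), hee, one_smul]
    module
  -- Since `|x - y| ≥ |x| - |y|` and `s ≤ σ`, decay `e^{-s|x|}` can be extracted from the kernel at
  -- the price `e^{s|y|}`, which the rate `c > s` of `f` pays.
  obtain ⟨I, hI⟩ : ∃ I : ℝ, ∀ x, ∫ y, Real.exp (-σ * |x - y|) * ‖f y‖ ≤ I * Real.exp (-s * |x|) := by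
    have hM0 : 0 ≤ M := by simpa using (norm_nonneg _).trans (hM 0)
    have h := (integral_exp_neg_abs (c := c - s) (by linarith)).1
    refine ⟨M * ∫ y : ℝ, Real.exp (-(c - s) * |y|), fun x => ?_⟩
    rw [mul_right_comm, ← integral_const_mul]
    refine integral_mono_of_nonneg (ae_of_all _ fun y => by positivity) (h.const_mul _)
      (ae_of_all _ fun y => ?_)
    calc Real.exp (-σ * |x - y|) * ‖f y‖
        ≤ Real.exp (-s * (|x| - |y|)) * (M * Real.exp (-c * |y|)) := by
          have h1 := abs_sub_abs_le_abs_sub x y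
          have h2 := abs_nonneg (x - y)
          have h3 := hM y
          have h4 : -σ * |x - y| ≤ -s * (|x| - |y|) := by
            nlinarith [mul_le_mul_of_nonneg_left h1 hs.le, mul_le_mul_of_nonneg_right hsσ h2]
          exact mul_le_mul (Real.exp_le_exp.2 h4) h3 (norm_nonneg _) (Real.exp_pos _).le
      _ = M * Real.exp (-s * |x|) * Real.exp (-(c - s) * |y|) := by
        rw [mul_left_comm, mul_assoc M, ← Real.exp_add, ← Real.exp_add]
        congr 2; ring
  have hnorm : ∀ x, ‖Real.exp (-σ * x) • L x‖ ≤ I * Real.exp (-s * |x|) ∧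
      ‖Real.exp (σ * x) • R x‖ ≤ I * Real.exp (-s * |x|) := by
    intro x
    rw [← eL, ← eR]
    have hn : ∀ y, ‖Real.exp (-σ * |x - y|) • f y‖ = Real.exp (-σ * |x - y|) * ‖f y‖ := fun y => by
      rw [norm_smul, Real.norm_of_nonneg (Real.exp_pos _).le]
    have hni : Integrable fun y => Real.exp (-σ * |x - y|) * ‖f y‖ :=
      (hint x).norm.congr (ae_of_all _ hn)
    constructor <;>
    · refine (norm_integral_le_integral_norm _).trans (le_trans ?_ (hI x))
      simp only [hn]
      exact setIntegral_le_integral hni (ae_of_all _ fun y => by positivity)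
  refine ⟨fun x => (1 / 2 : ℝ) • (Real.exp (σ * x) • R x - Real.exp (-σ * x) • L x), fun x => ?_,
    fun x => ?_, ⟨(1 / (2 * σ)) * (I + I), fun x => ?_⟩, ⟨1 / 2 * (I + I), fun x => ?_⟩⟩
  · simp only [eφ]
    refine (((hA x).add (hB x)).const_smul (1 / (2 * σ))).congr_deriv ?_
    have : (1 / (2 * σ)) * σ = 1 / 2 := by field_simp
    rw [← this]
    module
  · simp only [eφ]
    refine (((hB x).sub (hA x)).const_smul (1 / 2 : ℝ)).congr_deriv ?_
    have : σ ^ 2 * (1 / (2 * σ)) = 1 / 2 * σ := by field_simp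
    rw [smul_smul (σ ^ 2), this]
    module
  · rw [eφ, norm_smul, Real.norm_of_nonneg (by positivity), mul_assoc, add_mul]
    have := norm_add_le (Real.exp (-σ * x) • L x) (Real.exp (σ * x) • R x)
    have := hnorm x
    gcongr
    linarith
  · rw [norm_smul, Real.norm_of_nonneg (by positivity), mul_assoc, add_mul]
    have := norm_sub_le (Real.exp (σ * x) • R x) (Real.exp (-σ * x) • L x)
    have := hnorm x
    gcongr
    linarith

/-- The kernel `-|x - y| / 2` inverts `-∂ₓ²`. -/
theorem newton_solution (hf : Continuous f) (hd : ExpDecay f) :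
    ∃ φ' : ℝ → ℂ, (∀ x, HasDerivAt (fun x => ∫ y, (-|x - y| / 2) • f y) (φ' x) x) ∧
      (∀ x, HasDerivAt φ' (-f x) x) ∧ (∃ C, ∀ x, ‖φ' x‖ ≤ C) ∧
      (∫ y, f y = 0 → ∃ C, ∀ x, ‖∫ y, (-|x - y| / 2) • f y‖ ≤ C) := by
  have hfi : Integrable f := hd.integrable hf
  have hxf : Integrable fun y : ℝ => y • f y := by
    have h1 : ExpDecay fun x => x * ‖f x‖ := ExpDecay.id_mul (hd.of_le 1 (by simp) zero_le_one)
    exact (h1.of_le (g := fun y : ℝ => y • f y) 1 (by simp) zero_le_one).integrable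
      (by fun_prop)
  have hxs : ∀ x : ℝ, Integrable fun y : ℝ => x • f y := fun x => hfi.smul x
  set L0 : ℝ → ℂ := fun x => ∫ y in Set.Iic x, f y with hL0
  set R0 : ℝ → ℂ := fun x => ∫ y in Set.Ioi x, f y with hR0
  set L1 : ℝ → ℂ := fun x => ∫ y in Set.Iic x, y • f y with hL1
  set R1 : ℝ → ℂ := fun x => ∫ y in Set.Ioi x, y • f y with hR1
  have hint : ∀ x : ℝ, Integrable fun y => |x - y| • f y := fun x => by
    refine (((hfi.smul x).sub hxf).norm).mono'
      ((by fun_prop : Continuous fun y => |x - y| • f y).aestronglyMeasurable)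
      (ae_of_all _ fun y => ?_)
    simp only [Pi.sub_apply, Pi.smul_apply, ← sub_smul, norm_smul, Real.norm_eq_abs, abs_abs, le_refl]
  have eφ : ∀ x, ∫ y, (-|x - y| / 2) • f y =
      (-1 / 2 : ℝ) • (x • L0 x - L1 x + (R1 x - x • R0 x)) := by
    intro x
    have e1 : ∫ y, |x - y| • f y = x • L0 x - L1 x + (R1 x - x • R0 x) := by
      rw [integral_split (hint x) x]
      congr 1
      · have e : ∫ y in Set.Iic x, |x - y| • f y = ∫ y in Set.Iic x, (x • f y - y • f y) := by
          refine setIntegral_congr_fun measurableSet_Iic fun y hy => ?_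
          have : y ≤ x := hy
          simp only [← sub_smul]
          rw [abs_of_nonneg (by linarith)]
        rw [e, integral_sub (hxs x).integrableOn hxf.integrableOn, integral_smul]
      · have e : ∫ y in Set.Ioi x, |x - y| • f y = ∫ y in Set.Ioi x, (y • f y - x • f y) := by
          refine setIntegral_congr_fun measurableSet_Ioi fun y hy => ?_
          have : x < y := hy
          simp only [← sub_smul]
          rw [abs_of_neg (by linarith), neg_sub]
        rw [e, integral_sub hxf.integrableOn (hxs x).integrableOn, integral_smul]
    rw [← e1, ← integral_smul]
    refine integral_congr_ae (ae_of_all _ fun y => ?_)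
    simp only [smul_smul]
    congr 1; ring
  have dL0 : ∀ x, HasDerivAt L0 (f x) x := hasDerivAt_integral_Iic hf fun x => hfi.integrableOn
  have dR0 : ∀ x, HasDerivAt R0 (-f x) x := hasDerivAt_integral_Ioi hf fun x => hfi.integrableOn
  have dL1 : ∀ x, HasDerivAt L1 (x • f x) x :=
    hasDerivAt_integral_Iic (by fun_prop) fun x => hxf.integrableOn
  have dR1 : ∀ x, HasDerivAt R1 (-(x • f x)) x :=
    hasDerivAt_integral_Ioi (by fun_prop) fun x => hxf.integrableOn
  refine ⟨fun x => (-1 / 2 : ℝ) • (L0 x - R0 x), fun x => ?_, fun x => ?_,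
    ⟨1 / 2 * ((∫ y, ‖f y‖) + ∫ y, ‖f y‖), fun x => ?_⟩,
    fun h0 => ⟨1 / 2 * ∫ y, ‖y • f y‖, fun x => ?_⟩⟩
  · simp only [eφ]
    refine (((((hasDerivAt_id x).smul (dL0 x)).sub (dL1 x)).add
      ((dR1 x).sub ((hasDerivAt_id x).smul (dR0 x)))).const_smul (-1 / 2 : ℝ)).congr_deriv ?_
    simp only [id]
    module
  · refine (((dL0 x).sub (dR0 x)).const_smul (-1 / 2 : ℝ)).congr_deriv ?_
    module
  · have h1 : ‖L0 x‖ ≤ ∫ y, ‖f y‖ := (norm_integral_le_integral_norm _).trans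
      (setIntegral_le_integral hfi.norm (ae_of_all _ fun y => norm_nonneg _))
    have h2 : ‖R0 x‖ ≤ ∫ y, ‖f y‖ := (norm_integral_le_integral_norm _).trans
      (setIntegral_le_integral hfi.norm (ae_of_all _ fun y => norm_nonneg _))
    rw [norm_smul]
    have := norm_sub_le (L0 x) (R0 x)
    norm_num
    linarith
  -- The vanishing mean allows `|x| / 2` to be added to the kernel, and `||x| - |x - y|| ≤ |y|`
  -- makes the modified kernel bounded uniformly in `x` against the finite first moment of `f`.
  · have e : ∫ y, (-|x - y| / 2) • f y = ∫ y, (1 / 2 * (|x| - |x - y|)) • f y := by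
      have e2 : ∀ y, (1 / 2 * (|x| - |x - y|)) • f y =
          (-|x - y| / 2) • f y + (1 / 2 * |x|) • f y := fun y => by module
      have hi : Integrable fun y => (-|x - y| / 2) • f y := by
        refine ((hint x).smul (-1 / 2 : ℝ)).congr (ae_of_all _ fun y => ?_)
        simp only [Pi.smul_apply, smul_smul]
        congr 1; ring
      simp only [e2]
      rw [integral_add hi (hxs _), integral_smul, h0, smul_zero, add_zero]
    rw [e, ← integral_const_mul]
    refine norm_integral_le_of_norm_le (hxf.norm.const_mul _) (ae_of_all _ fun y => ?_)
    rw [norm_smul, norm_smul, norm_mul, mul_assoc]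
    have h1 : ‖|x| - |x - y|‖ ≤ ‖y‖ := by
      have := abs_abs_sub_abs_le x (x - y)
      simpa using this
    rw [Real.norm_of_nonneg (by norm_num : (0 : ℝ) ≤ 1 / 2)]
    gcongr

end Green

/-! ### Representation of decaying functions -/

/-- Integration by parts in closed form: `(x - y) φ'(y) + φ(y)` is a primitive of `(x - y) φ''(y)`,
equals `φ x` at `y = x`, and vanishes at both ends. -/
theorem newton_repr {φ φ' φ'' : ℝ → ℝ} (h0 : ExpDecay φ) (h1 : ExpDecay φ') (h2 : ExpDecay φ'')
    (hc : Continuous φ'') (d0 : ∀ x, HasDerivAt φ (φ' x) x) (d1 : ∀ x, HasDerivAt φ' (φ'' x) x)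
    (x : ℝ) : ∫ y, -|x - y| / 2 * φ'' y = -φ x := by
  have hi : Integrable fun y => (x - y) * φ'' y := by
    have : ExpDecay fun y => x * φ'' y - y * φ'' y := (h2.const_mul x).sub h2.id_mul
    refine (this.integrable (by fun_prop)).congr (ae_of_all _ fun y => ?_)
    simp only; ring
  have hdec : ExpDecay fun y => (x * φ' y - y * φ' y) + φ y := ((h1.const_mul x).sub h1.id_mul).add h0
  have hder : ∀ y, HasDerivAt (fun y => (x * φ' y - y * φ' y) + φ y) ((x - y) * φ'' y) y := fun y =>
    ((((d1 y).const_mul x).sub ((hasDerivAt_id y).mul (d1 y))).add (d0 y)).congr_deriv (by simp; ring)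
  have a1 := integral_Iic_of_hasDerivAt_of_tendsto' (a := x) (fun y _ => hder y) hi.integrableOn
    hdec.tendsto_atBot
  have a2 := integral_Ioi_of_hasDerivAt_of_tendsto' (a := x) (fun y _ => hder y) hi.integrableOn
    hdec.tendsto_atTop
  have hi' : Integrable fun y => -|x - y| / 2 * φ'' y := by
    refine (hi.norm.const_mul (1 / 2)).mono' (by fun_prop) (ae_of_all _ fun y => ?_)
    simp; linarith
  rw [integral_split hi' x]
  have b1 : ∫ y in Set.Iic x, -|x - y| / 2 * φ'' y =
      ∫ y in Set.Iic x, (-1 / 2) * ((x - y) * φ'' y) := by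
    refine setIntegral_congr_fun measurableSet_Iic fun y hy => ?_
    have : y ≤ x := hy
    rw [abs_of_nonneg (by linarith)]
    ring
  have b2 : ∫ y in Set.Ioi x, -|x - y| / 2 * φ'' y =
      ∫ y in Set.Ioi x, (1 / 2) * ((x - y) * φ'' y) := by
    refine setIntegral_congr_fun measurableSet_Ioi fun y hy => ?_
    have : x < y := hy
    rw [abs_of_neg (by linarith)]
    ring
  rw [b1, b2, integral_const_mul, integral_const_mul, a1, a2]
  ring

/-- On each side of `x` the integrand is exact, with primitive `e^{∓σ(x-y)} (φ' ∓ σφ)` up to the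
factor `1/(2σ)`. At `y = x` the derivative terms cancel and the two terms in `φ` add up to `-φ x`.
-/
theorem green_repr {φ φ' φ'' : ℝ → ℝ} (h0 : ExpDecay φ) (h1 : ExpDecay φ') (h2 : ExpDecay φ'')
    (hc0 : Continuous φ) (hc : Continuous φ'') (d0 : ∀ x, HasDerivAt φ (φ' x) x)
    (d1 : ∀ x, HasDerivAt φ' (φ'' x) x) {σ : ℝ} (hσ : 0 < σ) (x : ℝ) :
    ∫ y, green σ |x - y| * (φ'' y - σ ^ 2 * φ y) = -φ x := by
  set F := fun y => φ'' y - σ ^ 2 * φ y with hF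
  have hFi : Integrable F := (h2.sub (h0.const_mul _)).integrable (by fun_prop)
  have hb : ∀ y, ‖green σ |x - y|‖ ≤ 1 / (2 * σ) := fun y => by
    unfold green
    rw [Real.norm_of_nonneg (by positivity)]
    have : Real.exp (-σ * |x - y|) ≤ 1 :=
      Real.exp_le_one_iff.2 (by nlinarith [abs_nonneg (x - y)])
    have h3 : 0 ≤ 1 / (2 * σ) := by positivity
    nlinarith
  have hi' : Integrable fun y => green σ |x - y| * F y := by
    refine (hFi.norm.const_mul (1 / (2 * σ))).mono' ?_ (ae_of_all _ fun y => ?_)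
    · have : Continuous fun y => green σ |x - y| * F y := by unfold green; fun_prop
      exact this.aestronglyMeasurable
    · rw [norm_mul]
      exact mul_le_mul_of_nonneg_right (hb y) (norm_nonneg _)
  have dE : ∀ (a y : ℝ), HasDerivAt (fun y => Real.exp (a * (x - y)))
      (-a * Real.exp (a * (x - y))) y := fun a y =>
    ((((hasDerivAt_id y).const_sub x).const_mul a).exp).congr_deriv (by simp; ring)
  have e1 : ∀ y ∈ Set.Iic x, green σ |x - y| * F y =
      1 / (2 * σ) * (Real.exp (-σ * (x - y)) * F y) := fun y hy => by
    have : y ≤ x := hy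
    rw [green, abs_of_nonneg (by linarith)]; ring
  have e2 : ∀ y ∈ Set.Ioi x, green σ |x - y| * F y =
      1 / (2 * σ) * (Real.exp (σ * (x - y)) * F y) := fun y hy => by
    have : x < y := hy
    rw [green, abs_of_neg (by linarith), neg_mul_neg]; ring
  have hσ2 : 2 * σ * (1 / (2 * σ)) = 1 := by field_simp
  have a1 := integral_Iic_of_hasDerivAt_of_tendsto' (a := x)
    (f := fun y => 1 / (2 * σ) * (Real.exp (-σ * (x - y)) * (φ' y - σ * φ y)))
    (f' := fun y => 1 / (2 * σ) * (Real.exp (-σ * (x - y)) * F y))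
    (m := 0) (fun y _ => (((dE (-σ) y).mul ((d1 y).sub ((d0 y).const_mul σ))).const_mul _).congr_deriv
      (by simp only [hF, Pi.sub_apply]; ring))
    (hi'.integrableOn.congr_fun e1 measurableSet_Iic) (by
      refine (squeeze_zero_norm' (a := fun y => 1 / (2 * σ) * |φ' y - σ * φ y|) ?_ ?_)
      · filter_upwards [Iic_mem_atBot x] with y hy
        have hy : y ≤ x := hy
        rw [norm_mul, norm_mul, Real.norm_of_nonneg (by positivity),
          Real.norm_of_nonneg (by positivity)]
        have : Real.exp (-σ * (x - y)) ≤ 1 := Real.exp_le_one_iff.2 (by nlinarith)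
        gcongr
        exact mul_le_of_le_one_left (abs_nonneg _) this
      · have := ((h1.sub (h0.const_mul σ)).tendsto_atBot).norm.const_mul (1 / (2 * σ))
        simpa using this)
  have a2 := integral_Ioi_of_hasDerivAt_of_tendsto' (a := x)
    (f := fun y => 1 / (2 * σ) * (Real.exp (σ * (x - y)) * (φ' y + σ * φ y)))
    (f' := fun y => 1 / (2 * σ) * (Real.exp (σ * (x - y)) * F y))
    (m := 0) (fun y _ => (((dE σ y).mul ((d1 y).add ((d0 y).const_mul σ))).const_mul _).congr_deriv
      (by simp only [hF, Pi.add_apply]; ring))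
    (hi'.integrableOn.congr_fun e2 measurableSet_Ioi) (by
      refine (squeeze_zero_norm' (a := fun y => 1 / (2 * σ) * |φ' y + σ * φ y|) ?_ ?_)
      · filter_upwards [Ici_mem_atTop x] with y hy
        have hy : x ≤ y := hy
        rw [norm_mul, norm_mul, Real.norm_of_nonneg (by positivity),
          Real.norm_of_nonneg (by positivity)]
        have : Real.exp (σ * (x - y)) ≤ 1 := Real.exp_le_one_iff.2 (by nlinarith)
        gcongr
        exact mul_le_of_le_one_left (abs_nonneg _) this
      · have := ((h1.add (h0.const_mul σ)).tendsto_atTop).norm.const_mul (1 / (2 * σ))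
        simpa using this)
  rw [integral_split hi' x, setIntegral_congr_fun measurableSet_Iic e1,
    setIntegral_congr_fun measurableSet_Ioi e2, a1, a2]
  simp only [sub_self, mul_zero, Real.exp_zero]
  linear_combination (-φ x) * hσ2

/-! ### The cubic threshold: resonance, uniqueness of bounded solutions, invertibility of `K₀₀ + 1`.
-/

/-! ### Real vectors -/

/-- A vector with real components. -/
noncomputable def cvec (a b : ℝ) : Vec := !₂[(a : ℂ), (b : ℂ)]

@[simp] theorem cvec_zero (a b : ℝ) : cvec a b 0 = a := rfl

@[simp] theorem cvec_one (a b : ℝ) : cvec a b 1 = b := rfl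

theorem act_cvec (M : Mat) (a b : ℝ) :
    act M (cvec a b) = cvec (M 0 0 * a + M 0 1 * b) (M 1 0 * a + M 1 1 * b) := by
  apply vec_ext <;> simp [act_apply]

theorem inner_cvec (a b c d : ℝ) : inner ℂ (cvec a b) (cvec c d) = ((a * c + b * d : ℝ) : ℂ) := by
  rw [inner_vec]; simp; ring

theorem cvec_add (a b c d : ℝ) : cvec a b + cvec c d = cvec (a + c) (b + d) := by
  apply vec_ext <;> simp

theorem cvec_neg (a b : ℝ) : -cvec a b = cvec (-a) (-b) := by
  apply vec_ext <;> simp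

theorem continuous_cvec {a b : ℝ → ℝ} (ha : Continuous a) (hb : Continuous b) :
    Continuous fun x => cvec (a x) (b x) := by
  unfold cvec
  apply (PiLp.continuous_toLp 2 _).comp
  refine continuous_pi fun i => ?_
  fin_cases i
  · exact Complex.continuous_ofReal.comp ha
  · exact Complex.continuous_ofReal.comp hb

theorem isL2_cvec {a b : ℝ → ℝ} (ha : Continuous a) (hb : Continuous b) (hea : ExpDecay a)
    (heb : ExpDecay b) : IsL2 fun x => cvec (a x) (b x) := by
  refine ExpDecay.memLp_two ?_ (continuous_cvec ha hb)
  refine ((hea.of_le (g := fun x => ‖a x‖) 1 (by simp) zero_le_one).add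
    (heb.of_le (g := fun x => ‖b x‖) 1 (by simp) zero_le_one)).of_le 1 (fun x => ?_) zero_le_one
  have := norm_le_comp (cvec (a x) (b x))
  rw [one_mul, Real.norm_of_nonneg (by positivity)]
  simpa using this

theorem integral_vec_apply {F : ℝ → Vec} (hF : Integrable F) (i : Fin 2) :
    (∫ y, F y) i = ∫ y, F y i :=
  ((EuclideanSpace.proj (𝕜 := ℂ) i).integral_comp_comm hF).symm

/-! ### The weight `|V₀|^{1/2}` -/

theorem act_inv_sqrt (x : ℝ) (z : Vec) : act (sqrtAbsV0 x)⁻¹ (act (sqrtAbsV0 x) z) = z := by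
  rw [← act_mul, Matrix.nonsing_inv_mul _ (isUnit_det_sqrtAbsV0 x), act_one]

theorem act_sqrt_inv (x : ℝ) (z : Vec) : act (sqrtAbsV0 x) (act (sqrtAbsV0 x)⁻¹ z) = z := by
  rw [← act_mul, Matrix.mul_nonsing_inv _ (isUnit_det_sqrtAbsV0 x), act_one]

theorem sqrtAbsV0_transpose (x : ℝ) : (sqrtAbsV0 x)ᵀ = sqrtAbsV0 x := by
  rw [sqrtAbsV0_eq, Matrix.transpose_smul, J_transpose]

theorem inner_sqrt (x : ℝ) (z z' : Vec) :
    inner ℂ (act (sqrtAbsV0 x) z) (act (sqrtAbsV0 x) z') = inner ℂ z (act (-V0 x) z') := by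
  rw [← sqrtAbsV0_mul_self, act_mul, inner_act (sqrtAbsV0 x) z, sqrtAbsV0_transpose]

theorem V0_act_cvec (x a b : ℝ) : act (V0 x) (cvec a b) =
    cvec (-(2 * sech x ^ 2) * (2 * a + b)) (-(2 * sech x ^ 2) * (a + 2 * b)) := by
  rw [act_cvec]
  simp only [V0, Q_sq]
  congr 1 <;> simp <;> ring

theorem V1_act_cvec (x a b : ℝ) : act (V1 x) (cvec a b) =
    cvec (-(sech x ^ 2 * (a + b)) - q1 x * (2 * a + b))
      (-(sech x ^ 2 * (a + b)) - q1 x * (a + 2 * b)) := by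
  rw [act_cvec]
  simp only [V1, Q_sq]
  congr 1 <;> simp <;> ring

theorem V2_act_cvec (x a b : ℝ) : act (V2 x) (cvec a b) =
    cvec (-(1 / 2 * q1 x * (a + b)) - q2 x * (2 * a + b))
      (-(1 / 2 * q1 x * (a + b)) - q2 x * (a + 2 * b)) := by
  rw [act_cvec]
  simp only [V2]
  congr 1 <;> simp <;> ring

theorem v_eq (x : ℝ) : v x = act (sqrtAbsV0 x) (cvec 1 0) := by
  unfold v cvec; simp

theorem u0_eq (x : ℝ) : u0 x = cvec (2 - 2 * sech x ^ 2) (-(2 * sech x ^ 2)) := by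
  unfold u0 cvec; rw [Q_sq]

theorem w0_eq (x : ℝ) : w0 x = act (sqrtAbsV0 x) (cvec (2 - 2 * sech x ^ 2) (-(2 * sech x ^ 2))) := by
  unfold w0; rw [u0_eq]

/-! ### Decay of the elementary functions -/

theorem expDecay_sech : ExpDecay sech :=
  ⟨2, 1, one_pos, fun x => by
    rw [Real.norm_of_nonneg (sech_pos x).le, neg_one_mul]; exact sech_le_exp x⟩

theorem expDecay_sech_sq : ExpDecay fun x => sech x ^ 2 :=
  ⟨4, 2, two_pos, fun x => by
    rw [Real.norm_of_nonneg (sq_nonneg _)]; exact sech_sq_le x⟩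

theorem abs_sech_sq_le (x : ℝ) : |sech x ^ 2| ≤ 1 := by
  rw [abs_of_nonneg (sq_nonneg _)]
  exact pow_le_one₀ (sech_pos x).le (sech_le_one x)

theorem hasDerivAt_sech_sq (x : ℝ) :
    HasDerivAt (fun x => sech x ^ 2) (-2 * (Real.tanh x * sech x ^ 2)) x :=
  ((hasDerivAt_sech x).pow 2).congr_deriv (by simp; ring)

theorem hasDerivAt_tanh_sech_sq (x : ℝ) :
    HasDerivAt (fun x => Real.tanh x * sech x ^ 2) (3 * (sech x ^ 2) ^ 2 - 2 * sech x ^ 2) x :=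
  ((hasDerivAt_tanh x).mul (hasDerivAt_sech_sq x)).congr_deriv (by
    have := tanh_sq x
    linear_combination (-2 * sech x ^ 2) * this)

theorem expDecay_tanh_sech_sq : ExpDecay fun x => Real.tanh x * sech x ^ 2 :=
  expDecay_sech_sq.bdd_mul abs_tanh_le

theorem continuous_sech_sq : Continuous fun x => sech x ^ 2 := continuous_sech.pow 2

theorem isL2_sqrt_cvec {a b : ℝ → ℝ} (ha : Continuous a) (hb : Continuous b) {C : ℝ}
    (hCa : ∀ x, |a x| ≤ C) (hCb : ∀ x, |b x| ≤ C) :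
    IsL2 fun x => act (sqrtAbsV0 x) (cvec (a x) (b x)) := by
  have hQ : ExpDecay Q := by
    have : Q = fun x => √2 * sech x := by ext1 x; exact Q_eq x
    rw [this]
    exact expDecay_sech.const_mul _
  have hd : ∀ r s : ℝ, ExpDecay fun x => (r * a x + s * b x) * Q x := fun r s => by
    refine hQ.bdd_mul (M := |r| * C + |s| * C) fun x => (abs_add_le _ _).trans ?_
    rw [abs_mul, abs_mul]
    have := hCa x
    have := hCb x
    gcongr
  have hc := continuous_Q
  have e : ∀ x, act (sqrtAbsV0 x) (cvec (a x) (b x)) =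
      cvec ((J 0 0 * a x + J 0 1 * b x) * Q x) ((J 1 0 * a x + J 1 1 * b x) * Q x) := fun x => by
    rw [sqrtAbsV0_eq, act_cvec]
    congr 1 <;> simp only [Matrix.smul_apply, smul_eq_mul] <;> ring
  simp only [e]
  exact isL2_cvec (by fun_prop) (by fun_prop) (hd _ _) (hd _ _)

theorem isL2_v : IsL2 v := by
  have : v = fun x => act (sqrtAbsV0 x) (cvec 1 0) := by ext1 x; exact v_eq x
  rw [this]
  exact isL2_sqrt_cvec (C := 1) continuous_const continuous_const (by simp) (by simp)

theorem isL2_w0 : IsL2 w0 := by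
  have : w0 = fun x => act (sqrtAbsV0 x) (cvec (2 - 2 * sech x ^ 2) (-(2 * sech x ^ 2))) := by
    ext1 x; exact w0_eq x
  rw [this]
  have := continuous_sech_sq
  refine isL2_sqrt_cvec (C := 4) (by fun_prop) (by fun_prop) (fun x => ?_) (fun x => ?_)
  all_goals
    have h1 := abs_le.1 (abs_sech_sq_le x)
    have h2 := sq_nonneg (sech x)
    rw [abs_le]; constructor <;> linarith

/-! ### Integrals of hyperbolic functions -/

theorem tendsto_tanh_atTop : Tendsto Real.tanh atTop (𝓝 1) := by
  have h : ∀ x, 0 < x → Real.tanh x = √(1 - sech x ^ 2) := fun x hx => by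
    rw [← tanh_sq, Real.sqrt_sq]
    rw [Real.tanh_eq_sinh_div_cosh]
    exact div_nonneg (Real.sinh_nonneg_iff.2 hx.le) (Real.cosh_pos x).le
  have h2 : Tendsto (fun x => √(1 - sech x ^ 2)) atTop (𝓝 (√(1 - 0))) :=
    ((expDecay_sech_sq.tendsto_atTop).const_sub 1).sqrt
  rw [sub_zero, Real.sqrt_one] at h2
  refine h2.congr' ?_
  filter_upwards [eventually_gt_atTop 0] with x hx
  exact (h x hx).symm

theorem tendsto_tanh_atBot : Tendsto Real.tanh atBot (𝓝 (-1)) := by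
  have := (tendsto_tanh_atTop.comp tendsto_neg_atBot_atTop).neg
  refine this.congr fun x => ?_
  simp

theorem integral_sech_sq : ∫ x, sech x ^ 2 = 2 := by
  rw [integral_of_hasDerivAt_of_tendsto hasDerivAt_tanh
    (expDecay_sech_sq.integrable continuous_sech_sq) tendsto_tanh_atBot tendsto_tanh_atTop]
  norm_num

theorem ip_v_v : ip v v = 8 := by
  have e : ∀ x, inner ℂ (v x) (v x) = ((4 * sech x ^ 2 : ℝ) : ℂ) := fun x => by
    rw [v_eq, inner_sqrt, neg_act, V0_act_cvec, cvec_neg, inner_cvec]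
    congr 1; ring
  unfold ip
  simp only [e]
  rw [integral_complex_ofReal, integral_const_mul, integral_sech_sq]
  norm_num

/-- The integrand is an exact derivative, that of `-4 tanh x sech² x`. -/
theorem ip_v_w0 : ip v w0 = 0 := by
  have e : ∀ x, inner ℂ (v x) (w0 x) =
      ((-4 * (3 * (sech x ^ 2) ^ 2 - 2 * sech x ^ 2) : ℝ) : ℂ) := fun x => by
    rw [v_eq, w0_eq, inner_sqrt, neg_act, V0_act_cvec, cvec_neg, inner_cvec]
    congr 1; ring
  unfold ip
  simp only [e]
  rw [integral_complex_ofReal, integral_const_mul,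
    expDecay_tanh_sech_sq.integral_deriv_eq_zero hasDerivAt_tanh_sech_sq]
  · simp
  · have h2 : ExpDecay fun x => (sech x ^ 2) ^ 2 := by
      simpa only [pow_two (sech _ ^ 2)] using expDecay_sech_sq.bdd_mul abs_sech_sq_le
    have := continuous_sech_sq
    exact ((h2.const_mul 3).sub (expDecay_sech_sq.const_mul 2)).integrable (by fun_prop)

/-! ### Componentwise form of the sandwiched operators -/

/-- The outer matrix `|V₀|^{1/2}(x)` does not depend on `y` and is invertible, so integrability
survives its removal. -/
theorem sandwich_integrable {R : ℝ → ℝ → Mat} {V : ℝ → Mat} (hk : Adm (sandwichKernel R V))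
    {f : ℝ → Vec} (hf : IsL2 f) (x : ℝ) :
    Integrable fun y => act (R x y) (act (V y) (act (sqrtAbsV0 y)⁻¹ (f y))) := by
  have := (actL (sqrtAbsV0 x)⁻¹).integrable_comp (hk.integrable hf x)
  refine this.congr (ae_of_all _ fun y => ?_)
  simp only [actL_apply, sandwichKernel, act_mul, act_inv_sqrt]

theorem kint_sandwich {R : ℝ → ℝ → Mat} {V : ℝ → Mat} (hk : Adm (sandwichKernel R V))
    {f : ℝ → Vec} (hf : IsL2 f) (x : ℝ) : kint (sandwichKernel R V) f x =
      act (sqrtAbsV0 x) (∫ y, act (R x y) (act (V y) (act (sqrtAbsV0 y)⁻¹ (f y)))) := by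
  rw [← actL_apply, ← (actL (sqrtAbsV0 x)).integral_comp_comm (sandwich_integrable hk hf x)]
  simp only [kint, sandwichKernel, act_mul, actL_apply]

theorem act_R0 (x y : ℝ) (z : Vec) :
    act (R0 x y) z = !₂[(-|x - y| / 2) • z 0, green √2 |x - y| • z 1] := by
  rw [R0_eq]
  apply vec_ext <;> simp [act_apply]

/-- A real vector field is recovered from its image under `-R₀⁻¹`. -/
theorem R0_repr {φ φ' φ'' ψ ψ' ψ'' : ℝ → ℝ} (h0 : ExpDecay φ) (h1 : ExpDecay φ')
    (h2 : ExpDecay φ'') (hc : Continuous φ'') (d0 : ∀ x, HasDerivAt φ (φ' x) x)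
    (d1 : ∀ x, HasDerivAt φ' (φ'' x) x) (h0' : ExpDecay ψ) (h1' : ExpDecay ψ')
    (h2' : ExpDecay ψ'') (hc' : Continuous ψ'') (d0' : ∀ x, HasDerivAt ψ (ψ' x) x)
    (d1' : ∀ x, HasDerivAt ψ' (ψ'' x) x) {F : ℝ → Vec}
    (hF : ∀ y, F y = cvec (φ'' y) (ψ'' y - 2 * ψ y)) (x : ℝ)
    (hi : Integrable fun y => act (R0 x y) (F y)) :
    ∫ y, act (R0 x y) (F y) = -cvec (φ x) (ψ x) := by
  apply vec_ext
  · rw [integral_vec_apply hi]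
    have e : ∀ y, act (R0 x y) (F y) 0 = ((-|x - y| / 2 * φ'' y : ℝ) : ℂ) := fun y => by
      rw [act_R0, hF]; simp
    simp only [e]
    rw [integral_complex_ofReal, newton_repr h0 h1 h2 hc d0 d1]
    simp
  · rw [integral_vec_apply hi]
    have e : ∀ y, act (R0 x y) (F y) 1 =
        ((green √2 |x - y| * (ψ'' y - √2 ^ 2 * ψ y) : ℝ) : ℂ) := fun y => by
      rw [act_R0, hF, Real.sq_sqrt (by norm_num)]; simp
    have hc0 : Continuous ψ := continuous_iff_continuousAt.2 fun x => (d0' x).continuousAt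
    simp only [e]
    rw [integral_complex_ofReal, green_repr h0' h1' h2' hc0 hc' d0' d1' (by positivity)]
    simp

theorem adm00 : Adm (sandwichKernel R0 V0) := adm_sandwich resBound_R0 potBound_V0
theorem adm01 : Adm (sandwichKernel R0 V1) := adm_sandwich resBound_R0 potBound_V1
theorem adm02 : Adm (sandwichKernel R0 V2) := adm_sandwich resBound_R0 potBound_V2
theorem adm10 : Adm (sandwichKernel R1 V0) := adm_sandwich resBound_R1 potBound_V0
theorem adm_m11 : Adm (sandwichKernel Rm1 V1) := adm_sandwich resBound_Rm1 potBound_V1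
theorem adm_m12 : Adm (sandwichKernel Rm1 V2) := adm_sandwich resBound_Rm1 potBound_V2

theorem act_inv_w0 (x : ℝ) :
    act (sqrtAbsV0 x)⁻¹ (w0 x) = cvec (2 - 2 * sech x ^ 2) (-(2 * sech x ^ 2)) := by
  rw [w0_eq, act_inv_sqrt]

/-- The threshold resonance solves `u₀ + R₀ V₀ u₀ = (2, 0)`. -/
theorem R0_V0_u0 (x : ℝ) :
    ∫ y, act (R0 x y) (act (V0 y) (act (sqrtAbsV0 y)⁻¹ (w0 y))) =
      cvec (2 * sech x ^ 2) (2 * sech x ^ 2) := by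
  have h4 : ExpDecay fun x => (sech x ^ 2) ^ 2 := by
    simpa only [pow_two (sech _ ^ 2)] using expDecay_sech_sq.bdd_mul abs_sech_sq_le
  have hc := continuous_sech_sq
  -- Both components of the representation are `-2 sech²`: with `φ = ψ = -2 sech²` one has `V₀ u₀ =
  -- (φ'', ψ'' - 2ψ)`.
  have D0 : ExpDecay fun x => -2 * sech x ^ 2 := expDecay_sech_sq.const_mul _
  have D1 : ExpDecay fun x => 4 * (Real.tanh x * sech x ^ 2) := expDecay_tanh_sech_sq.const_mul _
  have D2 : ExpDecay fun x => 4 * (3 * (sech x ^ 2) ^ 2 - 2 * sech x ^ 2) :=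
    ((h4.const_mul 3).sub (expDecay_sech_sq.const_mul 2)).const_mul _
  have d0 : ∀ x, HasDerivAt (fun x => -2 * sech x ^ 2) (4 * (Real.tanh x * sech x ^ 2)) x :=
    fun x => ((hasDerivAt_sech_sq x).const_mul _).congr_deriv (by ring)
  have d1 : ∀ x, HasDerivAt (fun x => 4 * (Real.tanh x * sech x ^ 2))
      (4 * (3 * (sech x ^ 2) ^ 2 - 2 * sech x ^ 2)) x :=
    fun x => (hasDerivAt_tanh_sech_sq x).const_mul _
  rw [R0_repr D0 D1 D2 (by fun_prop) d0 d1 D0 D1 D2 (by fun_prop) d0 d1 (fun y => ?_) x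
    (sandwich_integrable adm00 isL2_w0 x), cvec_neg]
  · congr 1 <;> ring
  · rw [act_inv_w0, V0_act_cvec]
    congr 1 <;> ring

/-- This is how the resonance is seen at the level of operators: `w₀` is not in the kernel of `K₀₀ +
1`, but its image lies in the range of the singular part. -/
theorem K00_w0 (x : ℝ) : K00 w0 x + w0 x = (2 : ℂ) • v x := by
  unfold K00
  rw [sandwich_eq_kint, kint_sandwich adm00 isL2_w0, R0_V0_u0, w0_eq, v_eq, ← act_add, ← act_smul,
    cvec_add]
  congr 1
  apply vec_ext <;> simp

/-! ### Bounded solutions of linear equations -/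

theorem eq_const_of_deriv_zero {f : ℝ → ℂ} (h : ∀ x, HasDerivAt f 0 x) (x : ℝ) : f x = f 0 :=
  is_const_of_deriv_eq_zero (fun x => (h x).differentiableAt) (fun x => (h x).deriv) x 0

/-- A bounded function with constant derivative has zero derivative. -/
theorem deriv_eq_zero_of_bounded {f : ℝ → ℂ} {c : ℂ} (h : ∀ x, HasDerivAt f c x) {C : ℝ}
    (hb : ∀ x, ‖f x‖ ≤ C) : c = 0 := by
  have h1 : ∀ x : ℝ, HasDerivAt (fun x : ℝ => f x - x • c) 0 x := fun x =>
    ((h x).sub ((hasDerivAt_id x).smul_const c)).congr_deriv (by simp)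
  by_contra hc
  have hc' : 0 < ‖c‖ := norm_pos_iff.2 hc
  have h2 := eq_const_of_deriv_zero h1 ((2 * C + 1) / ‖c‖)
  simp only [zero_smul, sub_zero] at h2
  have h3 : ((2 * C + 1) / ‖c‖) • c = f ((2 * C + 1) / ‖c‖) - f 0 := by rw [← h2]; abel
  have hC : 0 ≤ C := (norm_nonneg _).trans (hb 0)
  have h4 := congrArg norm h3
  rw [norm_smul, Real.norm_of_nonneg (by positivity), div_mul_cancel₀ _ hc'.ne'] at h4
  have := norm_sub_le (f ((2 * C + 1) / ‖c‖)) (f 0)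
  linarith [hb ((2 * C + 1) / ‖c‖), hb 0]

/-- Bounded solutions of `p' = r p` with `r ≠ 0` vanish. -/
theorem eq_zero_of_deriv_eq_smul {p : ℝ → ℂ} {r : ℝ} (hr : r ≠ 0)
    (h : ∀ x, HasDerivAt p (r • p x) x) {C : ℝ} (hb : ∀ x, ‖p x‖ ≤ C) (x : ℝ) : p x = 0 := by
  have dE : ∀ x : ℝ, HasDerivAt (fun x => Real.exp (-r * x)) (-r * Real.exp (-r * x)) x := fun x =>
    (((hasDerivAt_id x).const_mul (-r)).exp).congr_deriv (by simp; ring)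
  have h1 : ∀ x, HasDerivAt (fun x => Real.exp (-r * x) • p x) 0 x := fun x =>
    ((dE x).smul (h x)).congr_deriv (by module)
  have h2 := eq_const_of_deriv_zero h1
  have key : p 0 = 0 := by
    have ht : Tendsto (fun x : ℝ => C * Real.exp (-r * (r * x))) atTop (𝓝 0) := by
      have : Tendsto (fun x : ℝ => -(r ^ 2) * x) atTop atBot :=
        tendsto_id.const_mul_atTop_of_neg (by have := sq_pos_of_ne_zero hr; linarith)
      have := (Real.tendsto_exp_atBot.comp this).const_mul C
      rw [mul_zero] at this
      refine this.congr fun x => ?_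
      simp only [Function.comp_apply]
      congr 2; ring
    have : ‖p 0‖ ≤ 0 := ge_of_tendsto' ht fun x => by
      have h3 := h2 (r * x)
      simp only [mul_zero, Real.exp_zero, one_smul] at h3
      rw [← h3, norm_smul, Real.norm_of_nonneg (Real.exp_pos _).le, mul_comm]
      exact mul_le_mul_of_nonneg_right (hb _) (Real.exp_pos _).le
    exact norm_le_zero_iff.1 this
  have h3 := h2 x
  simp only [mul_zero, Real.exp_zero, one_smul, key, smul_eq_zero] at h3
  exact h3.resolve_left (Real.exp_pos _).ne'

/-- Bounded solutions of the threshold equations `L₊ a = b`, `L₋ b = a` are multiples of the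
resonance. -/
theorem threshold_uniqueness {a b a' b' : ℝ → ℂ} (da : ∀ x, HasDerivAt a (a' x) x)
    (db : ∀ x, HasDerivAt b (b' x) x)
    (da' : ∀ x, HasDerivAt a' (a x - b x - 6 * ((sech x ^ 2 : ℝ) : ℂ) * a x) x)
    (db' : ∀ x, HasDerivAt b' (b x - a x - 2 * ((sech x ^ 2 : ℝ) : ℂ) * b x) x) {C : ℝ}
    (ha : ∀ x, ‖a x‖ ≤ C) (hb : ∀ x, ‖b x‖ ≤ C) (ha' : ∀ x, ‖a' x‖ ≤ C) (hb' : ∀ x, ‖b' x‖ ≤ C) :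
    ∃ A : ℂ, ∀ x, b x = A ∧ a x = A * (1 - 2 * ((sech x ^ 2 : ℝ) : ℂ)) := by
  set t : ℝ → ℂ := fun x => ((Real.tanh x : ℝ) : ℂ) with ht
  set s : ℝ → ℂ := fun x => ((sech x ^ 2 : ℝ) : ℂ) with hs
  change ∀ x, HasDerivAt a' (a x - b x - 6 * s x * a x) x at da'
  change ∀ x, HasDerivAt b' (b x - a x - 2 * s x * b x) x at db'
  have dt : ∀ x, HasDerivAt t (s x) x := fun x => (hasDerivAt_tanh x).ofReal_comp
  have ds : ∀ x, HasDerivAt s (-2 * (t x * s x)) x := fun x =>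
    (hasDerivAt_sech_sq x).ofReal_comp.congr_deriv (by simp [ht, hs])
  have hts : ∀ x, t x ^ 2 = 1 - s x := fun x => by
    have := tanh_sq x
    simp only [ht, hs]
    exact_mod_cast this
  have bt : ∀ x, ‖t x‖ ≤ 1 := fun x => by
    simp only [ht, Complex.norm_real]; exact abs_tanh_le x
  have bs : ∀ x, ‖s x‖ ≤ 1 := fun x => by
    simp only [hs, Complex.norm_real]; exact abs_sech_sq_le x
  have hC : 0 ≤ C := (norm_nonneg _).trans (ha 0)
  have bmul : ∀ {f g : ℝ → ℂ} {M N : ℝ}, (∀ x, ‖f x‖ ≤ M) → (∀ x, ‖g x‖ ≤ N) →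
      ∀ x, ‖f x * g x‖ ≤ M * N := fun {f g M N} hf hg x => by
    rw [norm_mul]
    exact mul_le_mul (hf x) (hg x) (norm_nonneg _) ((norm_nonneg _).trans (hf x))
  have btb := bmul bt hb
  have bta := bmul bt ha
  have btb' := bmul bt hb'
  have bta' := bmul bt ha'
  have bsb := bmul bs hb
  have bsa := bmul bs ha
  have bsa' := bmul bs ha'
  have btsa := bmul bt bsa
  -- This is `h = S² b` for `S = ∂ₓ + tanh x`, with `b''` eliminated. The intertwining relation `S²
  -- L₊ L₋ = (1 - ∂ₓ²)² S²` and `L₊ L₋ b = b` turn the system into `h'''' = 2 h''`, with constant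
  -- coefficients; `k` is `h'' - 2h`, so that `k'' = 0`.
  set h : ℝ → ℂ := fun x => 2 * (t x * b' x) + 2 * b x - 2 * (s x * b x) - a x with hh
  set h' : ℝ → ℂ := fun x => 2 * (t x * b x) - 2 * (t x * a x) + 2 * b' x - a' x with hh'
  set k : ℝ → ℂ := fun x => -2 * (t x * b' x) - 2 * (t x * a' x) + (2 * s x - 1) * b x +
    (4 * s x - 1) * a x with hk
  set k' : ℝ → ℂ := fun x => -b' x + (2 * s x - 1) * a' x + 4 * (t x * s x) * a x with hk'
  have dh : ∀ x, HasDerivAt h (h' x) x := fun x =>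
    ((((((dt x).mul (db' x)).const_mul 2).add ((db x).const_mul 2)).sub
      (((ds x).mul (db x)).const_mul 2)).sub (da x)).congr_deriv (by simp only [hh']; ring)
  have dh' : ∀ x, HasDerivAt h' (k x + 2 * h x) x := fun x =>
    ((((((dt x).mul (db x)).const_mul 2).sub (((dt x).mul (da x)).const_mul 2)).add
      ((db' x).const_mul 2)).sub (da' x)).congr_deriv (by simp only [hk, hh]; ring)
  have dk : ∀ x, HasDerivAt k (k' x) x := fun x =>
    ((((((dt x).mul (db' x)).const_mul (-2)).sub (((dt x).mul (da' x)).const_mul 2)).add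
      ((((ds x).const_mul 2).sub_const 1).mul (db x))).add
      ((((ds x).const_mul 4).sub_const 1).mul (da x))).congr_deriv (by simp only [hk']; ring)
  have dk' : ∀ x, HasDerivAt k' 0 x := fun x =>
    ((((db' x).neg).add ((((ds x).const_mul 2).sub_const 1).mul (da' x))).add
      ((((dt x).mul (ds x)).const_mul 4).mul (da x))).congr_deriv (by
        have := hts x
        simp only [Pi.mul_apply]
        linear_combination (-8 * s x * a x) * this)
  have bk : ∀ x, ‖k x‖ ≤ 20 * C := fun x => by
    have e : k x = -2 * (t x * b' x) - 2 * (t x * a' x) + 2 * (s x * b x) - b x +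
      4 * (s x * a x) - a x := by simp only [hk]; ring
    rw [e]
    have n1 := norm_sub_le (-2 * (t x * b' x) - 2 * (t x * a' x) + 2 * (s x * b x) - b x +
      4 * (s x * a x)) (a x)
    have n2 := norm_add_le (-2 * (t x * b' x) - 2 * (t x * a' x) + 2 * (s x * b x) - b x)
      (4 * (s x * a x))
    have n3 := norm_sub_le (-2 * (t x * b' x) - 2 * (t x * a' x) + 2 * (s x * b x)) (b x)
    have n4 := norm_add_le (-2 * (t x * b' x) - 2 * (t x * a' x)) (2 * (s x * b x))
    have n5 := norm_sub_le (-2 * (t x * b' x)) (2 * (t x * a' x))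
    have m1 : ‖-2 * (t x * b' x)‖ = 2 * ‖t x * b' x‖ := by rw [norm_mul]; simp
    have m2 : ‖2 * (t x * a' x)‖ = 2 * ‖t x * a' x‖ := by rw [norm_mul]; simp
    have m3 : ‖2 * (s x * b x)‖ = 2 * ‖s x * b x‖ := by rw [norm_mul]; simp
    have m4 : ‖4 * (s x * a x)‖ = 4 * ‖s x * a x‖ := by rw [norm_mul]; simp
    linarith [btb' x, bta' x, bsb x, bsa x, ha x, hb x]
  have bh : ∀ x, ‖h x‖ ≤ 20 * C := fun x => by
    have n1 := norm_sub_le (2 * (t x * b' x) + 2 * b x - 2 * (s x * b x)) (a x)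
    have n2 := norm_sub_le (2 * (t x * b' x) + 2 * b x) (2 * (s x * b x))
    have n3 := norm_add_le (2 * (t x * b' x)) (2 * b x)
    have m1 : ‖2 * (t x * b' x)‖ = 2 * ‖t x * b' x‖ := by rw [norm_mul]; simp
    have m2 : ‖2 * b x‖ = 2 * ‖b x‖ := by rw [norm_mul]; simp
    have m3 : ‖2 * (s x * b x)‖ = 2 * ‖s x * b x‖ := by rw [norm_mul]; simp
    simp only [hh]
    linarith [btb' x, bsb x, ha x, hb x]
  have bh' : ∀ x, ‖h' x‖ ≤ 20 * C := fun x => by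
    have n1 := norm_sub_le (2 * (t x * b x) - 2 * (t x * a x) + 2 * b' x) (a' x)
    have n2 := norm_add_le (2 * (t x * b x) - 2 * (t x * a x)) (2 * b' x)
    have n3 := norm_sub_le (2 * (t x * b x)) (2 * (t x * a x))
    have m1 : ‖2 * (t x * b x)‖ = 2 * ‖t x * b x‖ := by rw [norm_mul]; simp
    have m2 : ‖2 * (t x * a x)‖ = 2 * ‖t x * a x‖ := by rw [norm_mul]; simp
    have m3 : ‖2 * b' x‖ = 2 * ‖b' x‖ := by rw [norm_mul]; simp
    simp only [hh']
    linarith [btb x, bta x, ha' x, hb' x]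
  -- `k` is affine and bounded, hence constant.
  have k'const := eq_const_of_deriv_zero dk'
  have k'zero : k' 0 = 0 :=
    deriv_eq_zero_of_bounded (fun x => (dk x).congr_deriv (k'const x)) bk
  have kconst := eq_const_of_deriv_zero (fun x => (dk x).congr_deriv ((k'const x).trans k'zero))
  -- `g = h + k / 2` satisfies `g'' = 2 g`
  have h2 : ((√2 : ℝ) : ℂ) * ((√2 : ℝ) : ℂ) = 2 := by
    rw [← Complex.ofReal_mul, Real.mul_self_sqrt (by norm_num)]; norm_num
  have n2 : ‖((√2 : ℝ) : ℂ)‖ ≤ 2 := by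
    rw [Complex.norm_real, Real.norm_of_nonneg (Real.sqrt_nonneg _)]
    exact Real.sqrt_le_iff.2 (by norm_num)
  have bg : ∀ x, ‖((√2 : ℝ) : ℂ) * (h x + k 0 / 2)‖ ≤ 80 * C := fun x => by
    rw [norm_mul]
    have : ‖h x + k 0 / 2‖ ≤ 30 * C := by
      refine (norm_add_le _ _).trans ?_
      rw [norm_div]
      have := bk 0
      have := bh x
      norm_num
      linarith
    nlinarith [norm_nonneg (h x + k 0 / 2)]
  -- The equation `g'' = 2g` factors: `g' ± √2 g` solve first order equations with rates `±√2`, and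
  -- both are bounded.
  have gp := eq_zero_of_deriv_eq_smul (p := fun x => h' x + ((√2 : ℝ) : ℂ) * (h x + k 0 / 2))
    (r := √2) (by positivity) (fun x => ((dh' x).add (((dh x).add_const _).const_mul _)).congr_deriv
      (by rw [Complex.real_smul, kconst x]; linear_combination (-(h x) - k 0 / 2) * h2))
    (C := 100 * C) (fun x => (norm_add_le _ _).trans (by linarith [bh' x, bg x]))
  have gm := eq_zero_of_deriv_eq_smul (p := fun x => h' x - ((√2 : ℝ) : ℂ) * (h x + k 0 / 2))
    (r := -√2) (by simp) (fun x => ((dh' x).sub (((dh x).add_const _).const_mul _)).congr_deriv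
      (by
        rw [Complex.real_smul, kconst x, Complex.ofReal_neg]
        linear_combination (-(h x) - k 0 / 2) * h2))
    (C := 100 * C) (fun x => (norm_sub_le _ _).trans (by linarith [bh' x, bg x]))
  have hA : ∀ x, h x = -(k 0 / 2) := fun x => by
    have e1 := gp x
    have e2 := gm x
    have e3 : ((√2 : ℝ) : ℂ) * (((√2 : ℝ) : ℂ) * (h x + k 0 / 2)) = 0 := by
      linear_combination ((√2 : ℝ) : ℂ) * (e1 - e2) / 2
    rw [← mul_assoc, h2] at e3
    linear_combination e3 / 2
  obtain ⟨A, hA⟩ : ∃ A, ∀ x, h x = A := ⟨_, hA⟩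
  -- `cosh * (b - A)` is affine
  set q : ℝ → ℂ := fun x => ((sech x : ℝ) : ℂ) with hq
  set c : ℝ → ℂ := fun x => ((Real.cosh x : ℝ) : ℂ) with hcdef
  have dc : ∀ x, HasDerivAt c (c x * t x) x := fun x =>
    (Real.hasDerivAt_cosh x).ofReal_comp.congr_deriv (by
      have := (Real.cosh_pos x).ne'
      simp only [hcdef, ht]
      rw [← Complex.ofReal_mul, Real.tanh_eq_sinh_div_cosh]
      congr 1; field_simp)
  have hqc : ∀ x, q x * c x = 1 := fun x => by
    have := (Real.cosh_pos x).ne'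
    simp only [hq, hcdef]
    rw [← Complex.ofReal_mul, sech]
    norm_num [this]
  have hqq : ∀ x, q x * q x = s x := fun x => by
    simp only [hq, hs]; push_cast; ring
  have dq : ∀ x, HasDerivAt q (-(t x * q x)) x := fun x =>
    (hasDerivAt_sech x).ofReal_comp.congr_deriv (by simp [ht, hq])
  -- The function is the derivative of `cosh · (b - A)`, since `cosh · S = ∂ₓ ∘ cosh`. It is
  -- constant because `S² b = A` and `S² 1 = 1`.
  have dy : ∀ x, HasDerivAt (fun x => c x * (b' x + t x * (b x - A))) 0 x := fun x =>
    ((dc x).mul ((db' x).add ((dt x).mul ((db x).sub_const A)))).congr_deriv (by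
      have e1 := hts x
      have e2 := hA x
      simp only [hh, Pi.add_apply, Pi.mul_apply] at e1 e2 ⊢
      linear_combination c x * e2 + (c x * (b x - A)) * e1)
  obtain ⟨D, hD⟩ : ∃ D, D = c 0 * (b' 0 + t 0 * (b 0 - A)) := ⟨_, rfl⟩
  have eb' : ∀ x, b' x = D * q x - t x * (b x - A) := fun x => by
    have e1 := eq_const_of_deriv_zero dy x
    have e2 := hqc x
    rw [← hD] at e1
    linear_combination (-(b' x) - t x * (b x - A)) * e2 + q x * e1
  -- Differentiating the formula for `b'` once more and comparing with `L₋ b = a` determines `a`.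
  have ea : ∀ x, a x = A * (1 - 2 * s x) + 2 * D * (t x * q x) := fun x => by
    have d2 : HasDerivAt b' (D * -(t x * q x) - (s x * (b x - A) + t x * b' x)) x := by
      exact (((dq x).const_mul D).sub ((dt x).mul ((db x).sub_const A))).congr_of_eventuallyEq
        (Eventually.of_forall eb')
    have e := (db' x).unique d2
    have e1 := hts x
    have e3 := eb' x
    linear_combination -e + t x * e3 - (b x - A) * e1
  have ea' : ∀ x, a' x = 4 * A * (t x * s x) + 2 * D * (s x * q x - t x ^ 2 * q x) := fun x => by
    have d2 : HasDerivAt a (A * -(2 * (-2 * (t x * s x))) +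
        2 * D * (s x * q x + t x * -(t x * q x))) x := by
      have : a = fun x => A * (1 - 2 * s x) + 2 * D * (t x * q x) := funext ea
      rw [this]
      exact ((((ds x).const_mul 2).const_sub 1).const_mul A).add
        (((dt x).mul (dq x)).const_mul (2 * D))
    rw [(da x).unique d2]; ring
  -- Inserted into `L₊ a = b`, the terms with `D` cancel and `b = A` remains; then `b' = 0` gives `D
  -- = 0`.
  have hbA : ∀ x, b x = A := fun x => by
    have e' : ∀ x, a' x = 4 * A * (t x * s x) + 2 * D * (2 * (s x * q x) - q x) := fun x => by
      rw [ea', hts]; ring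
    have d2 : HasDerivAt a' (4 * A * (s x * s x + t x * (-2 * (t x * s x))) +
        2 * D * (2 * (-2 * (t x * s x) * q x + s x * -(t x * q x)) - -(t x * q x))) x := by
      have : a' = fun x => 4 * A * (t x * s x) + 2 * D * (2 * (s x * q x) - q x) := funext e'
      rw [this]
      exact (((dt x).mul (ds x)).const_mul (4 * A)).add
        (((((ds x).mul (dq x)).const_mul 2).sub (dq x)).const_mul (2 * D))
    have e := (da' x).unique d2
    have e1 := hts x
    have e2 := ea x
    linear_combination -e + 8 * A * s x * e1 + (1 - 6 * s x) * e2
  have hD0 : D = 0 := by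
    have d : HasDerivAt b 0 0 := by
      have : b = fun _ => A := funext hbA
      rw [this]; exact hasDerivAt_const _ _
    have e1 := eb' 0
    rw [(db 0).unique d, hbA 0] at e1
    have e2 := hqc 0
    linear_combination -D * e2 - c 0 * e1
  refine ⟨A, fun x => ⟨hbA x, ?_⟩⟩
  rw [ea x, hD0]; ring

/-! ### Regularity of the range -/

theorem wt_le_one (x : ℝ) : wt x ≤ 1 := Real.exp_le_one_iff.2 (by linarith [abs_nonneg x])

theorem continuous_kint {k : ℝ → ℝ → Mat} (hk : Adm k)
    (hc : ∀ y i j, Continuous fun x => k x y i j) {f : ℝ → Vec} (hf : IsL2 f) :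
    Continuous (kint k f) := by
  obtain ⟨C, hC⟩ := hk
  refine continuous_of_dominated (bound := fun y => 4 * C * (wt y * ‖f y‖))
    (fun x => (hC.integrable hf x).aestronglyMeasurable) (fun x => ae_of_all _ fun y => ?_)
    ((integrable_wt_mul_norm hf).const_mul _) (ae_of_all _ fun y => ?_)
  · refine (hC.norm_act_le x y _).trans ?_
    have h1 := wt_le_one x
    have h2 := hC.nonneg
    have h3 : 0 ≤ wt y * ‖f y‖ := mul_nonneg (wt_pos y).le (norm_nonneg _)
    nlinarith [mul_nonneg h2 h3, wt_pos x]
  · have h : ∀ x, act (k x y) (f y) = ∑ i, ∑ j, k x y i j • unitL i j (f y) := fun x =>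
      act_eq_sum _ _
    simp only [h]
    exact continuous_finsetSum _ fun i _ => continuous_finsetSum _ fun j _ =>
      (hc y i j).smul continuous_const

theorem continuous_act_apply {M : ℝ → Mat} {f : ℝ → Vec} (hM : ∀ i j, Continuous fun x => M x i j)
    (hf : Continuous f) : Continuous fun x => act (M x) (f x) := by
  simp only [act_eq_sum]
  exact continuous_finsetSum _ fun i _ => continuous_finsetSum _ fun j _ =>
    (hM i j).smul ((unitL i j).continuous.comp hf)

theorem continuous_green_abs (σ y : ℝ) : Continuous fun x => green σ |x - y| := by
  unfold green; fun_prop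

theorem continuous_sandwichKernel {R : ℝ → ℝ → Mat} (V : ℝ → Mat)
    (hR : ∀ y i j, Continuous fun x => R x y i j) (y : ℝ) (i j : Fin 2) :
    Continuous fun x => sandwichKernel R V x y i j := by
  have hQ := continuous_Q
  have h0 := hR y 0 0
  have h1 := hR y 0 1
  have h2 := hR y 1 0
  have h3 := hR y 1 1
  have e : ∀ x, sandwichKernel R V x y i j =
      ∑ l, (∑ m, (∑ n, Q x * J i n * R x y n m) * V y m l) * (sqrtAbsV0 y)⁻¹ l j := fun x => by
    rw [sandwichKernel, sqrtAbsV0_eq x]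
    simp only [Matrix.mul_apply, Matrix.smul_apply, smul_eq_mul]
  simp only [e, Fin.sum_univ_two]
  fun_prop

theorem abs_inv_sqrt_le (y : ℝ) (i j : Fin 2) : |(sqrtAbsV0 y)⁻¹ i j| ≤ Real.exp |y| := by
  rw [sqrtAbsV0_inv, Matrix.smul_apply, smul_eq_mul, abs_mul,
    abs_of_pos (inv_pos.2 (Q_pos y)), Q_eq, mul_inv]
  have h1 : (√2 : ℝ)⁻¹ ≤ 1 := inv_le_one_of_one_le₀ one_le_sqrt_two
  have h2 := inv_sech_le y
  have h3 := abs_Ji_le i j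
  have h4 : 0 < (sech y)⁻¹ := inv_pos.2 (sech_pos y)
  calc (√2)⁻¹ * (sech y)⁻¹ * |Ji i j| ≤ 1 * Real.exp |y| * 1 := by gcongr
    _ = _ := by ring

/-- The rates add up to `-3/2 + 1 - 1/4 = -3/4`: potential, inverse square root, weight. -/
theorem expDecay_source {V : ℝ → Mat} {d : ℝ} (hV : PotBound V d) {f : ℝ → Vec} {c : ℝ}
    (hf : ∀ x, ‖f x‖ ≤ c * wt x) (y : ℝ) :
    ‖act (V y) (act (sqrtAbsV0 y)⁻¹ (f y))‖ ≤ 16 * d * c * Real.exp (-(3 / 4) * |y|) := by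
  have hd : 0 ≤ d := by
    have := (abs_nonneg _).trans (hV.bound 0 0 0); simpa using this
  have h1 := norm_act_le (hV.bound y) (act (sqrtAbsV0 y)⁻¹ (f y))
  have h2 := norm_act_le (abs_inv_sqrt_le y) (f y)
  have h3 := hf y
  calc _ ≤ 4 * (d * Real.exp (-(3 / 2) * |y|)) * (4 * Real.exp |y| * (c * wt y)) := by
        refine h1.trans ?_
        gcongr
        refine h2.trans ?_
        gcongr
    _ = 16 * d * c * (Real.exp (-(3 / 2) * |y|) * Real.exp |y| * wt y) := by ring
    _ = _ := by
      rw [wt, ← Real.exp_add, ← Real.exp_add]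
      congr 2; ring

theorem continuous_inv_sqrt (i j : Fin 2) : Continuous fun x => (sqrtAbsV0 x)⁻¹ i j := by
  simp only [sqrtAbsV0_inv, Matrix.smul_apply, smul_eq_mul]
  exact (continuous_Q.inv₀ fun x => (Q_pos x).ne').mul_const _

theorem continuous_V0 (i j : Fin 2) : Continuous fun x => V0 x i j := by
  have := continuous_Q
  fin_cases i <;> fin_cases j <;> simp [V0] <;> fun_prop

theorem continuous_R0 (y : ℝ) (i j : Fin 2) : Continuous fun x => R0 x y i j := by
  have := continuous_green_abs √2 y
  simp only [R0_eq]
  fin_cases i <;> fin_cases j <;> simp <;> fun_prop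

/-! ### Symmetry of `K₀₀` -/

theorem R0_symm (x y : ℝ) : (R0 y x)ᵀ = R0 x y := by
  rw [R0_eq, R0_eq, abs_sub_comm]
  ext i j; fin_cases i <;> fin_cases j <;> simp

/-- Because `V₀` is minus a square, the two halves of the potential can be distributed over both
sides of the resolvent; this makes `K₀₀` symmetric. -/
theorem V0_mul_inv (x : ℝ) : V0 x * (sqrtAbsV0 x)⁻¹ = -sqrtAbsV0 x := by
  have : V0 x = -(sqrtAbsV0 x * sqrtAbsV0 x) := by rw [sqrtAbsV0_mul_self, neg_neg]
  rw [this, Matrix.neg_mul, Matrix.mul_assoc, Matrix.mul_nonsing_inv _ (isUnit_det_sqrtAbsV0 x),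
    Matrix.mul_one]

theorem sandwichKernel_V0 (R : ℝ → ℝ → Mat) (x y : ℝ) :
    sandwichKernel R V0 x y = -(sqrtAbsV0 x * R x y * sqrtAbsV0 y) := by
  rw [sandwichKernel, Matrix.mul_assoc (sqrtAbsV0 x * R x y), V0_mul_inv, Matrix.mul_neg]

theorem k00_symm (x y : ℝ) : (sandwichKernel R0 V0 y x)ᵀ = sandwichKernel R0 V0 x y := by
  rw [sandwichKernel_V0, sandwichKernel_V0, Matrix.transpose_neg, Matrix.transpose_mul,
    Matrix.transpose_mul, R0_symm, sqrtAbsV0_transpose, sqrtAbsV0_transpose, Matrix.mul_assoc]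

theorem ip_K00 {f g : ℝ → Vec} (hf : IsL2 f) (hg : IsL2 g) : ip g (K00 f) = ip (K00 g) f := by
  unfold K00
  rw [sandwich_eq_kint, ip_kint adm00 hf hg]
  simp only [k00_symm]

theorem isL2_K00 {f : ℝ → Vec} (hf : IsL2 f) : IsL2 (K00 f) := adm00.isL2_kint hf

theorem ip_add {f g h : ℝ → Vec} (hf : IsL2 f) (hg : IsL2 g) (hh : IsL2 h) :
    ip h (f + g) = ip h f + ip h g := by
  rw [← inner_toL2 hh (hf.add hg), toL2_add hf hg, inner_add_right, inner_toL2, inner_toL2]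

theorem ip_smul (c : ℂ) (f h : ℝ → Vec) : ip h (c • f) = c * ip h f := by
  unfold ip
  rw [← integral_const_mul]
  simp only [Pi.smul_apply, inner_smul_right]

theorem ip_conj (f g : ℝ → Vec) : starRingEnd ℂ (ip f g) = ip g f := by
  unfold ip
  rw [← integral_conj]
  simp only [inner_conj_symm]

theorem ip_congr {f f' g g' : ℝ → Vec} (h : f =ᵐ[volume] f') (h' : g =ᵐ[volume] g') :
    ip f g = ip f' g' := by
  apply integral_congr_ae
  filter_upwards [h, h'] with x hx hx'
  rw [hx, hx']

/-- `⟨w₀, (K₀₀ + 1) f⟩ = 2 ⟨v, f⟩`. -/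
theorem ip_w0_K00_add {f : ℝ → Vec} (hf : IsL2 f) : ip w0 (K00 f + f) = 2 * ip v f := by
  rw [ip_add (isL2_K00 hf) hf isL2_w0, ip_K00 hf isL2_w0]
  have : K00 w0 + w0 = (2 : ℂ) • v := by ext1 x; exact K00_w0 x
  rw [← ip_conj f (K00 w0), ← ip_conj f w0, ← map_add, ← ip_add (isL2_K00 isL2_w0) isL2_w0 hf, this,
    ip_smul, map_mul, ip_conj, Complex.conj_ofNat]

/-- `1 + K₀₀` is injective on `L²`. -/
theorem K00_injective {f : ℝ → Vec} (hf : IsL2 f) (h : K00 f + f =ᵐ[volume] 0) :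
    f =ᵐ[volume] 0 := by
  -- The image under the integral operator is a representative of `f` that is continuous and
  -- pointwise dominated by the weight.
  set g : ℝ → Vec := fun x => -K00 f x with hg
  have hfg : f =ᵐ[volume] g := by
    filter_upwards [h] with x hx
    exact eq_neg_of_add_eq_zero_right hx
  have hgL : IsL2 g := by
    exact MemLp.neg (isL2_K00 hf)
  have hgK : ∀ x, g x = -K00 g x := fun x => by
    have : K00 f = K00 g := kint_congr hfg
    rw [← this]
  obtain ⟨C, hC⟩ := adm00
  have hgb : ∀ x, ‖g x‖ ≤ (8 * C * ‖toL2 f hf‖) * wt x := fun x => by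
    rw [hg, norm_neg]; exact hC.norm_kint_le hf x
  have hgc : Continuous g := by
    have : Continuous (K00 f) :=
      continuous_kint adm00 (continuous_sandwichKernel V0 continuous_R0) hf
    exact this.neg
  set u : ℝ → Vec := fun x => act (sqrtAbsV0 x)⁻¹ (g x) with hu
  have huc : Continuous u := continuous_act_apply continuous_inv_sqrt hgc
  set F : ℝ → Vec := fun y => act (V0 y) (u y) with hF
  have hFc : Continuous F := continuous_act_apply continuous_V0 huc
  have hFb := expDecay_source potBound_V0 hgb
  have hFi := sandwich_integrable adm00 hgL
  have hur : ∀ x, u x = -∫ y, act (R0 x y) (F y) := fun x => by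
    simp only [hu]
    rw [hgK x, act_neg]
    unfold K00
    rw [sandwich_eq_kint, kint_sandwich adm00 hgL, act_inv_sqrt]
  have hproj : ∀ i : Fin 2, Continuous fun z : Vec => z i := fun i =>
    (EuclideanSpace.proj (𝕜 := ℂ) i).continuous
  have hb : ∀ i y, ‖F y i‖ ≤ (16 * 256 * (8 * C * ‖toL2 f hf‖)) * Real.exp (-(3 / 4) * |y|) :=
    fun i y => (norm_comp_le _ i).trans (hFb y)
  obtain ⟨φ', p1, p2, ⟨Cp, p3⟩, p4⟩ := newton_solution ((hproj 0).comp hFc)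
    ⟨_, _, by norm_num, hb 0⟩
  obtain ⟨ψ', r1, r2, ⟨Cr, r3⟩, ⟨Cr', r4⟩⟩ := green_solution (σ := √2) (by positivity)
    ((hproj 1).comp hFc) (M := 16 * 256 * (8 * C * ‖toL2 f hf‖)) (c := 3 / 4) (s := 1 / 2)
    (by norm_num) (le_trans (by norm_num) one_le_sqrt_two) (by norm_num) (hb 1)
  -- Pairing the equation with `w₀` gives `⟨v, f⟩ = 0`, that is, the first component of `V₀ u` has
  -- mean zero. This is what keeps its Newton potential, and so `u`, bounded.
  have hm : ∫ y, F y 0 = 0 := by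
    have h1 := ip_w0_K00_add hf
    have h2 : ip w0 (K00 f + f) = 0 := by
      rw [ip_congr (ae_eq_refl w0) h]; simp [ip]
    rw [h2, ip_congr (ae_eq_refl v) hfg] at h1
    have h3 : ip v g = -∫ y, F y 0 := by
      unfold ip
      rw [← integral_neg]
      refine integral_congr_ae (ae_of_all _ fun y => ?_)
      have : g y = act (sqrtAbsV0 y) (u y) := by simp only [hu, act_sqrt_inv]
      simp only
      rw [this, v_eq, inner_sqrt, neg_act, inner_neg_right, inner_vec]
      simp [hF]
    rw [h3] at h1
    simpa using h1
  obtain ⟨Cp', p4⟩ := p4 hm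
  have hu0 : ∀ x, u x 0 = -∫ y, (-|x - y| / 2) • F y 0 := fun x => by
    rw [hur, PiLp.neg_apply, integral_vec_apply (hFi x)]
    congr 1
    refine integral_congr_ae (ae_of_all _ fun y => ?_)
    simp only [hF, hu, act_R0]
    rfl
  have hu1 : ∀ x, u x 1 = -∫ y, green √2 |x - y| • F y 1 := fun x => by
    rw [hur, PiLp.neg_apply, integral_vec_apply (hFi x)]
    congr 1
    refine integral_congr_ae (ae_of_all _ fun y => ?_)
    simp only [hF, hu, act_R0]
    rfl
  have du0 : ∀ x, HasDerivAt (fun x => u x 0) (-φ' x) x := fun x => by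
    simp only [hu0]; exact (p1 x).neg
  have du1 : ∀ x, HasDerivAt (fun x => u x 1) (-ψ' x) x := fun x => by
    simp only [hu1]; exact (r1 x).neg
  have hF0 : ∀ x, F x 0 = -(2 * ((sech x ^ 2 : ℝ) : ℂ)) * (2 * u x 0 + u x 1) := fun x => by
    simp only [hF, act_apply, V0, Q_sq]
    simp
    ring
  have hF1 : ∀ x, F x 1 = -(2 * ((sech x ^ 2 : ℝ) : ℂ)) * (u x 0 + 2 * u x 1) := fun x => by
    simp only [hF, act_apply, V0, Q_sq]
    simp
    ring
  have d2u0 : ∀ x, HasDerivAt (fun x => -φ' x) (F x 0) x := fun x =>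
    (p2 x).neg.congr_deriv (neg_neg _)
  have d2u1 : ∀ x, HasDerivAt (fun x => -ψ' x) (2 * u x 1 + F x 1) x := fun x =>
    (r2 x).neg.congr_deriv (by
      rw [hu1, Real.sq_sqrt (by norm_num)]
      simp [two_smul]
      ring)
  have hexp : ∀ x : ℝ, Real.exp (-(1 / 2) * |x|) ≤ 1 := fun x =>
    Real.exp_le_one_iff.2 (by linarith [abs_nonneg x])
  have bu0 : ∀ x, ‖u x 0‖ ≤ |Cp'| := fun x => by
    rw [hu0, norm_neg]; exact (p4 x).trans (le_abs_self _)
  have bu1 : ∀ x, ‖u x 1‖ ≤ |Cr| := fun x => by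
    rw [hu1, norm_neg]
    refine (r3 x).trans ?_
    have := hexp x
    have := Real.exp_pos (-(1 / 2) * |x|)
    nlinarith [le_abs_self Cr, abs_nonneg Cr]
  have bφ : ∀ x, ‖φ' x‖ ≤ |Cp| := fun x => (p3 x).trans (le_abs_self _)
  have bψ : ∀ x, ‖ψ' x‖ ≤ |Cr'| := fun x => by
    refine (r4 x).trans ?_
    have := hexp x
    have := Real.exp_pos (-(1 / 2) * |x|)
    nlinarith [le_abs_self Cr', abs_nonneg Cr']
  -- Sum and difference of the two components decouple the potential into `L₊` and `L₋`.
  obtain ⟨A, hA⟩ := threshold_uniqueness (a := fun x => u x 0 + u x 1)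
    (b := fun x => u x 0 - u x 1) (a' := fun x => -φ' x + -ψ' x) (b' := fun x => -φ' x - -ψ' x)
    (C := |Cp'| + |Cr| + |Cp| + |Cr'|)
    (fun x => (du0 x).add (du1 x)) (fun x => (du0 x).sub (du1 x))
    (fun x => ((d2u0 x).add (d2u1 x)).congr_deriv (by rw [hF0, hF1]; ring))
    (fun x => ((d2u0 x).sub (d2u1 x)).congr_deriv (by rw [hF0, hF1]; ring))
    (fun x => (norm_add_le _ _).trans (by
      linarith [bu0 x, bu1 x, abs_nonneg Cp, abs_nonneg Cr']))
    (fun x => (norm_sub_le _ _).trans (by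
      linarith [bu0 x, bu1 x, abs_nonneg Cp, abs_nonneg Cr']))
    (fun x => (norm_add_le _ _).trans (by
      rw [norm_neg, norm_neg]; linarith [bφ x, bψ x, abs_nonneg Cp', abs_nonneg Cr]))
    (fun x => (norm_sub_le _ _).trans (by
      rw [norm_neg, norm_neg]; linarith [bφ x, bψ x, abs_nonneg Cp', abs_nonneg Cr]))
  have hgw : g = (A / 2) • w0 := by
    ext1 x
    have e : u x = (A / 2) • cvec (2 - 2 * sech x ^ 2) (-(2 * sech x ^ 2)) := by
      obtain ⟨h1, h2⟩ := hA x
      simp only at h1 h2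
      push_cast at h2
      apply vec_ext
      · simp; linear_combination (h1 + h2) / 2
      · simp; linear_combination (h2 - h1) / 2
    have : g x = act (sqrtAbsV0 x) (u x) := by simp only [hu, act_sqrt_inv]
    rw [this, e, act_smul, Pi.smul_apply, w0_eq]
  -- A multiple of `w₀` is mapped by `K₀₀ + 1` to the same multiple of `2v`, which does not vanish
  -- at the origin.
  have hAv : A • v 0 = 0 := by
    have h1 := hgK 0
    rw [hgw] at h1
    have h2 : K00 ((A / 2) • w0) = (A / 2) • K00 w0 := kint_smul _ _ _
    rw [h2, Pi.smul_apply, Pi.smul_apply] at h1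
    have h3 := K00_w0 0
    have h4 : (A / 2) • (K00 w0 0 + w0 0) = 0 := by rw [smul_add, h1]; simp
    rw [h3, smul_smul] at h4
    rw [← h4]
    congr 1; ring
  have hv0 : v 0 ≠ 0 := by
    intro h0
    have h1 : act (sqrtAbsV0 0)⁻¹ (v 0) = cvec 1 0 := by rw [v_eq, act_inv_sqrt]
    rw [h0, act_zero] at h1
    have := congrArg (fun z : Vec => z 0) h1
    simp at this
  have hA0 : A = 0 := (smul_eq_zero.1 hAv).resolve_right hv0
  rw [hA0] at hgw
  simp only [zero_div, zero_smul] at hgw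
  rw [hgw] at hfg
  exact hfg

/-! ### Compactness -/

theorem isCompactOperator_of_range_le {E : Type*} [NormedAddCommGroup E] [NormedSpace ℂ E]
    (T : E →L[ℂ] E) (W : Submodule ℂ E) [FiniteDimensional ℂ W] (h : ∀ x, T x ∈ W) :
    IsCompactOperator T := by
  have : ProperSpace W := FiniteDimensional.proper ℂ W
  exact (isCompactOperator_id.comp_clm (T.codRestrict W h)).clm_comp W.subtypeL

/-- Kernels of compact operators. -/
def CompactKernel (k : ℝ → ℝ → Mat) : Prop := ∃ hk : Adm k, IsCompactOperator (op k hk)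

theorem CompactKernel.add {k l : ℝ → ℝ → Mat} (hk : CompactKernel k) (hl : CompactKernel l) :
    CompactKernel fun x y => k x y + l x y := by
  obtain ⟨⟨C, hC⟩, hk'⟩ := hk
  obtain ⟨⟨D, hD⟩, hl'⟩ := hl
  refine ⟨(hC.add hD).adm, ?_⟩
  rw [op_add hC.adm hD.adm]
  exact hk'.add hl'

theorem CompactKernel.zero : CompactKernel fun _ _ => 0 := by
  have h : IsAdm (fun _ _ => (0 : Mat)) 0 := ⟨fun _ _ => measurable_const, fun _ _ _ _ => by simp⟩
  refine ⟨h.adm, ?_⟩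
  have : op _ h.adm = 0 := by
    have := norm_op_le h
    rw [mul_zero] at this
    exact norm_le_zero_iff.1 this
  rw [this]
  exact isCompactOperator_zero

theorem CompactKernel.sum {ι : Type*} (s : Finset ι) {k : ι → ℝ → ℝ → Mat}
    (h : ∀ i ∈ s, CompactKernel (k i)) : CompactKernel fun x y => ∑ i ∈ s, k i x y := by
  classical
  induction s using Finset.induction_on with
  | empty => simpa using CompactKernel.zero
  | insert a s ha ih =>
    simp only [Finset.sum_insert ha]
    exact (h a (Finset.mem_insert_self _ _)).add
      (ih fun i hi => h i (Finset.mem_insert_of_mem hi))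

-- A kernel whose dependence on `x` is a fixed indicator function has range spanned by the indicator
-- times the two basis vectors. The bound on `A` is needed to compare the indicator with the weight.
open Classical in
theorem CompactKernel.indicator {A : Set ℝ} (hA : MeasurableSet A) {N : ℝ} (hN : ∀ x ∈ A, |x| ≤ N)
    {κ : ℝ → Mat} (hm : ∀ i j, Measurable fun y => κ y i j) {C : ℝ}
    (hC : ∀ y i j, |κ y i j| ≤ C * wt y) :
    CompactKernel fun x y => if x ∈ A then κ y else 0 := by
  have hC0 : 0 ≤ C := by
    have h1 := (abs_nonneg _).trans (hC 0 0 0)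
    have h2 : wt 0 = 1 := by simp [wt]
    rwa [h2, mul_one] at h1
  have hk : IsAdm (fun x y => if x ∈ A then κ y else 0) (C * (wt N)⁻¹) := by
    refine ⟨fun i j => ?_, fun x y i j => ?_⟩
    · have e : (fun p : ℝ × ℝ => (if p.1 ∈ A then κ p.2 else 0) i j) =
          fun p => if p.1 ∈ A then κ p.2 i j else 0 := by
        ext1 p; split_ifs <;> rfl
      rw [e]
      exact Measurable.ite (measurable_fst hA) ((hm i j).comp measurable_snd) measurable_const
    · have hw := wt_pos x
      have hw' := wt_pos y
      have hwN := wt_pos N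
      split_ifs with hx
      · have : wt N ≤ wt x := by
          refine Real.exp_le_exp.2 ?_
          have := hN x hx
          have := le_abs_self N
          linarith
        calc |κ y i j| ≤ C * wt y := hC y i j
          _ = C * (wt N)⁻¹ * wt N * wt y := by field_simp
          _ ≤ _ := by gcongr
      · simp only [Matrix.zero_apply, abs_zero]
        positivity
  have hL : ∀ c : Vec, IsL2 (A.indicator fun _ => c) := fun c => by
    refine memLp_indicator_const 2 hA c (Or.inr ?_)
    refine ((measure_mono fun x hx => ?_).trans_lt (measure_Icc_lt_top (a := -N) (b := N))).ne
    exact abs_le.1 (hN x hx)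
  refine ⟨hk.adm, ?_⟩
  set e : Fin 2 → L2Space := fun i => toL2 _ (hL (EuclideanSpace.single i 1))
  have : FiniteDimensional ℂ (Submodule.span ℂ (Set.range e)) :=
    FiniteDimensional.span_of_finite ℂ (Set.finite_range e)
  refine isCompactOperator_of_range_le _ (Submodule.span ℂ (Set.range e)) fun f => ?_
  set c : Vec := ∫ y, act (κ y) (f y)
  have : op _ hk.adm f = c 0 • e 0 + c 1 • e 1 := by
    simp only [e, op_coe, ← toL2_smul, ← toL2_add]
    rw [toL2_eq_iff]
    refine ae_of_all _ fun x => ?_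
    simp only [kint, Pi.add_apply, Pi.smul_apply, Set.indicator_apply]
    split_ifs
    · apply vec_ext <;> simp [c]
    · have h0 : ∀ z : Vec, act 0 z = 0 := fun z => by apply vec_ext <;> simp [act_apply]
      simp [h0]
  rw [this]
  exact Submodule.add_mem _ (Submodule.smul_mem _ _ (Submodule.subset_span ⟨0, rfl⟩))
    (Submodule.smul_mem _ _ (Submodule.subset_span ⟨1, rfl⟩))

open Classical in
/-- A kernel that is locally Lipschitz in its first variable and decays faster than the weight
defines a compact operator. -/
theorem CompactKernel.of_lipschitz {k : ℝ → ℝ → Mat}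
    (hm : ∀ i j, Measurable fun p : ℝ × ℝ => k p.1 p.2 i j) {C L : ℝ} (hC0 : 0 < C)
    (hC : ∀ x y i j, |k x y i j| ≤ C * wt x ^ 2 * wt y)
    (hL : ∀ x x' y i j, |k x y i j - k x' y i j| ≤ L * (1 + |x|) * |x - x'| * wt y)
    (hL0 : 0 ≤ L) : CompactKernel k := by
  have hC1 : ∀ x y i j, |k x y i j| ≤ C * wt x * wt y := fun x y i j => (hC x y i j).trans <| by
    have := wt_pos x
    have := wt_pos y
    have := wt_le_one x
    rw [pow_two]
    gcongr
    nlinarith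
  have hk : IsAdm k C := ⟨hm, hC1⟩
  refine ⟨hk.adm, ?_⟩
  have hcl : IsClosed {T : L2Space →L[ℂ] L2Space | IsCompactOperator T} :=
    isClosed_setOfPred_isCompactOperator
  refine hcl.closure_subset (Metric.mem_closure_iff.2 fun η hη => ?_)
  -- For `|x| ≥ N` the approximant is zero, and the spare factor `wt x ≤ wt N` in the bound of `k`
  -- makes the error small.
  obtain ⟨N, hN0, hN⟩ : ∃ N : ℝ, 0 ≤ N ∧ 16 * (C * wt N) < η := by
    have h : Tendsto (fun N : ℝ => 16 * C * Real.exp (-(1 / 4) * |N|)) atTop (𝓝 0) :=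
      ExpDecay.tendsto_exp (by norm_num) tendsto_abs_atTop_atTop _
    obtain ⟨N, h1, h2⟩ := ((h.eventually (gt_mem_nhds hη)).and (eventually_ge_atTop 0)).exists
    refine ⟨N, h2, ?_⟩
    have : wt N = Real.exp (-(1 / 4) * |N|) := by rw [wt]; congr 1; ring
    rw [this]; linarith
  have hwN := wt_pos N
  obtain ⟨D, hD⟩ : ∃ D, D = C * wt N := ⟨_, rfl⟩
  have hDp : 0 < D := hD ▸ mul_pos hC0 hwN
  -- For `|x| < N` the kernel is frozen at the left end of a cell of length `δ`. Its variation over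
  -- a cell must be small even relative to `wt x ≥ wt N`.
  obtain ⟨δ, hδ, hδ'⟩ : ∃ δ : ℝ, 0 < δ ∧ L * (1 + N) * δ ≤ D * wt N := by
    refine ⟨D * wt N / (L * (1 + N) + 1), by positivity, ?_⟩
    rw [mul_div_assoc', div_le_iff₀ (by positivity)]
    nlinarith [mul_pos hDp hwN]
  -- All cells that meet `|x| < N` have indices between `-M` and `M`, so the approximant is a finite
  -- sum of operators of finite rank.
  obtain ⟨M, hM⟩ : ∃ M : ℤ, N / δ + 1 ≤ M := ⟨⌈N / δ + 1⌉, Int.le_ceil _⟩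
  obtain ⟨A, hAm, hA⟩ : ∃ A : ℤ → Set ℝ, (∀ m x, x ∈ A m ↔ |x| < N ∧ ⌊x / δ⌋ = m) ∧
      ∀ m, MeasurableSet (A m) := ⟨fun m => {x | |x| < N ∧ ⌊x / δ⌋ = m}, fun _ _ => Iff.rfl,
    fun m => (measurableSet_lt (f := fun x : ℝ => |x|) (by fun_prop) measurable_const).inter
      ((measurable_id.div_const δ).floor (measurableSet_singleton m))⟩
  obtain ⟨hl, hlc⟩ := CompactKernel.sum (Finset.Icc (-M) M)
    (k := fun m x y => if x ∈ A m then k (δ * m) y else 0) fun m _ =>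
      CompactKernel.indicator (hA m) (κ := k (δ * m)) (C := C) (fun x hx => ((hAm m x).1 hx).1.le)
        (fun i j => (hm i j).comp measurable_prodMk_left) fun y i j => (hC1 _ y i j).trans <| by
          have h1 := wt_le_one (δ * m)
          have h2 := wt_pos y
          have : C * wt (δ * m) ≤ C := mul_le_of_le_one_right hC0.le h1
          gcongr
  refine ⟨op _ hl, hlc, ?_⟩
  have hval : ∀ x y, (∑ m ∈ Finset.Icc (-M) M, if x ∈ A m then k (δ * m) y else 0) =
      if |x| < N then k (δ * ⌊x / δ⌋) y else 0 := by
    intro x y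
    split_ifs with hx
    · rw [Finset.sum_eq_single ⌊x / δ⌋]
      · rw [if_pos ((hAm _ _).2 ⟨hx, rfl⟩)]
      · intro m _ hm'
        exact if_neg fun h => hm' ((hAm _ _).1 h).2.symm
      · intro hmem
        exfalso
        apply hmem
        obtain ⟨h1, h2⟩ := abs_lt.1 hx
        have h3 : -(N / δ) < x / δ := by rw [← neg_div]; exact div_lt_div_of_pos_right h1 hδ
        have h4 : x / δ < N / δ := div_lt_div_of_pos_right h2 hδ
        rw [Finset.mem_Icc]
        constructor
        · rw [Int.le_floor]; push_cast; linarith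
        · have := Int.floor_le (x / δ)
          exact_mod_cast (by linarith : ((⌊x / δ⌋ : ℤ) : ℝ) ≤ M)
    · exact Finset.sum_eq_zero fun m _ => if_neg fun h => hx ((hAm _ _).1 h).1
  have hsub : IsAdm (fun x y => k x y - ∑ m ∈ Finset.Icc (-M) M,
      if x ∈ A m then k (δ * m) y else 0) D := by
    refine ⟨fun i j => ?_, fun x y i j => ?_⟩
    · exact (hm i j).sub (hl.choose_spec.meas i j)
    · rw [hval]
      have := wt_pos x
      have := wt_pos y
      split_ifs with hx
      · have hwx : wt N ≤ wt x := by
          refine Real.exp_le_exp.2 ?_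
          have := le_abs_self N
          linarith
        have h1 : |x - δ * ⌊x / δ⌋| ≤ δ := by
          have h2 := Int.floor_le (x / δ)
          have h3 := (Int.lt_floor_add_one (x / δ)).le
          rw [le_div_iff₀ hδ] at h2
          rw [div_le_iff₀ hδ] at h3
          rw [abs_of_nonneg (by linarith)]
          linarith
        calc _ ≤ L * (1 + |x|) * |x - δ * ⌊x / δ⌋| * wt y := hL _ _ _ _ _
          _ ≤ L * (1 + N) * δ * wt y := by gcongr
          _ ≤ D * wt N * wt y := by gcongr
          _ ≤ _ := by gcongr
      · have hwx : wt x ≤ wt N := by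
          refine Real.exp_le_exp.2 ?_
          have := abs_of_nonneg hN0
          linarith [not_lt.1 hx]
        rw [sub_zero]
        calc _ ≤ C * wt x ^ 2 * wt y := hC _ _ _ _
          _ = C * wt x * wt x * wt y := by ring
          _ ≤ C * wt N * wt x * wt y := by gcongr
          _ = _ := by rw [hD]
  rw [dist_eq_norm, ← op_sub hk.adm hl hsub.adm]
  calc _ ≤ 16 * D := norm_op_le hsub
    _ < η := hD ▸ hN

theorem abs_exp_neg_sub_le {σ a b : ℝ} (hσ : 0 ≤ σ) (ha : 0 ≤ a) (hb : 0 ≤ b) :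
    |Real.exp (-σ * a) - Real.exp (-σ * b)| ≤ σ * |a - b| := by
  have := (convex_Ici (0 : ℝ)).norm_image_sub_le_of_norm_hasDerivWithin_le
    (f := fun s => Real.exp (-σ * s)) (C := σ)
    (fun s _ => (((hasDerivAt_id s).const_mul (-σ)).exp).hasDerivWithinAt)
    (fun s hs => ?_) (x := b) (y := a) hb ha
  · simpa only [Real.norm_eq_abs] using this
  · have : Real.exp (-σ * s) ≤ 1 := Real.exp_le_one_iff.2 (by nlinarith [Set.mem_Ici.1 hs])
    have h2 := Real.exp_pos (-σ * s)
    simp only [id, mul_one, Real.norm_eq_abs, abs_mul, abs_neg, abs_of_nonneg hσ, Real.abs_exp]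
    nlinarith

theorem Q_le_wt (x : ℝ) : Q x ≤ 4 * wt x ^ 4 := by
  rw [Q_eq]
  have h1 : wt x ^ 4 = Real.exp (-|x|) := by rw [wt, ← Real.exp_nat_mul]; congr 1; push_cast; ring
  have h2 := sech_le_exp x
  have h3 : (√2 : ℝ) ≤ 2 := Real.sqrt_le_iff.2 (by norm_num)
  have h4 := sech_pos x
  rw [h1]
  nlinarith

theorem Q_le_two (x : ℝ) : Q x ≤ 2 := by
  rw [Q_eq]
  have h2 := sech_le_one x
  have h3 : (√2 : ℝ) ≤ 2 := Real.sqrt_le_iff.2 (by norm_num)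
  have h4 := sech_pos x
  nlinarith

theorem abs_Q_sub_le (x y : ℝ) : |Q x - Q y| ≤ 2 * |x - y| := by
  have := convex_univ.norm_image_sub_le_of_norm_hasDerivWithin_le
    (f := fun s => √2 * sech s) (C := 2)
    (fun s _ => ((hasDerivAt_sech s).const_mul (√2)).hasDerivWithinAt)
    (fun s hs => ?_) (x := y) (y := x) trivial trivial
  · simpa only [Real.norm_eq_abs, ← Q_eq] using this
  · have h1 := abs_tanh_le s
    have h2 := sech_le_one s
    have h3 : (√2 : ℝ) ≤ 2 := Real.sqrt_le_iff.2 (by norm_num)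
    have h4 := sech_pos s
    simp only [Real.norm_eq_abs, abs_mul, abs_neg, abs_of_pos h4, abs_of_nonneg (Real.sqrt_nonneg 2)]
    have : sech s * |Real.tanh s| ≤ 1 := mul_le_one₀ h2 (abs_nonneg _) h1
    have h0 : 0 ≤ sech s * |Real.tanh s| := by positivity
    nlinarith

theorem one_add_abs_mul_wt_le (x : ℝ) : (1 + |x|) * wt x ≤ 4 := by
  have h := Real.add_one_le_exp (|x| / 4)
  have h2 := wt_pos x
  have h3 : Real.exp (|x| / 4) * wt x = 1 := by
    rw [wt, ← Real.exp_add, neg_div, add_neg_cancel, Real.exp_zero]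
  have : (|x| / 4 + 1) * wt x ≤ 1 := (mul_le_mul_of_nonneg_right h h2.le).trans_eq h3
  nlinarith

theorem abs_J_mul_diag_le {M : Mat} (h1 : M 0 1 = 0) (h2 : M 1 0 = 0) {c : ℝ}
    (h3 : |M 0 0| ≤ c) (h4 : |M 1 1| ≤ c) (i j : Fin 2) : |(J * M * J) i j| ≤ 8 * c := by
  have e : (J * M * J) i j = J i 0 * M 0 0 * J 0 j + J i 1 * M 1 1 * J 1 j := by
    simp [Matrix.mul_apply, Fin.sum_univ_two, h1, h2]
  have hc := (abs_nonneg _).trans h3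
  have hJ := abs_J_le
  calc |(J * M * J) i j| ≤ |J i 0| * |M 0 0| * |J 0 j| + |J i 1| * |M 1 1| * |J 1 j| := by
        rw [e, ← abs_mul, ← abs_mul, ← abs_mul, ← abs_mul]; exact abs_add_le _ _
    _ ≤ 2 * c * 2 + 2 * c * 2 := by
        gcongr <;> apply hJ
    _ = _ := by ring

theorem k00_apply (x y : ℝ) (i j : Fin 2) :
    sandwichKernel R0 V0 x y i j = -(Q x * Q y * (J * R0 x y * J) i j) := by
  rw [sandwichKernel_V0, sqrtAbsV0_eq, sqrtAbsV0_eq, Matrix.smul_mul, Matrix.smul_mul,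
    Matrix.mul_smul, smul_smul]
  simp

theorem abs_JRJ_le (x y : ℝ) (i j : Fin 2) :
    |(J * R0 x y * J) i j| ≤ 8 * ((1 + |x|) * (1 + |y|)) := by
  have h0 : |x - y| ≤ |x| + |y| := abs_sub _ _
  have hx := abs_nonneg x
  have hy := abs_nonneg y
  refine abs_J_mul_diag_le (by simp [R0]) (by simp [R0]) ?_ ?_ i j
  · simp only [R0, Matrix.of_apply, Matrix.cons_val', Matrix.cons_val_zero, abs_div, abs_neg,
      abs_abs, abs_two]
    nlinarith [mul_nonneg hx hy]
  · have h2 := one_le_sqrt_two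
    have h3 : Real.exp (-√2 * |x - y|) ≤ 1 :=
      Real.exp_le_one_iff.2 (by nlinarith [abs_nonneg (x - y)])
    have h4 : R0 x y 1 1 = Real.exp (-√2 * |x - y|) / (2 * √2) := rfl
    rw [h4, abs_of_nonneg (by positivity), div_le_iff₀ (by positivity)]
    nlinarith [mul_nonneg hx hy, mul_nonneg (mul_nonneg hx hy) (Real.sqrt_nonneg 2)]

theorem abs_JRJ_sub_le (x x' y : ℝ) (i j : Fin 2) :
    |(J * R0 x y * J) i j - (J * R0 x' y * J) i j| ≤ 8 * |x - x'| := by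
  have h0 : |(|x - y| - |x' - y|)| ≤ |x - x'| := by
    refine (abs_abs_sub_abs_le _ _).trans (le_of_eq ?_)
    congr 1; ring
  have hx := abs_nonneg (x - x')
  have e : (J * R0 x y * J) i j - (J * R0 x' y * J) i j = (J * (R0 x y - R0 x' y) * J) i j := by
    rw [Matrix.mul_sub, Matrix.sub_mul, Matrix.sub_apply]
  rw [e]
  refine abs_J_mul_diag_le (by simp [R0]) (by simp [R0]) ?_ ?_ i j
  · have h4 : (R0 x y - R0 x' y) 0 0 = -(|x - y| - |x' - y|) / 2 := by
      simp only [R0, Matrix.sub_apply, Matrix.of_apply, Matrix.cons_val', Matrix.cons_val_zero]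
      ring
    rw [h4, abs_div, abs_neg, abs_two]
    linarith
  · have h2 := one_le_sqrt_two
    have h3 := abs_exp_neg_sub_le (Real.sqrt_nonneg 2) (abs_nonneg (x - y)) (abs_nonneg (x' - y))
    have h4 : (R0 x y - R0 x' y) 1 1 =
        (Real.exp (-√2 * |x - y|) - Real.exp (-√2 * |x' - y|)) / (2 * √2) := by
      rw [sub_div]; rfl
    rw [h4, abs_div, abs_of_nonneg (by positivity : 0 ≤ 2 * √2), div_le_iff₀ (by positivity)]
    nlinarith

/-- The kernel is `-Q(x) Q(y) J R₀ J`. The matrix `R₀` is Lipschitz and grows linearly, while `Q ≤ 4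
wt⁴`, so there are powers of the weight to spare in both variables. -/
theorem compactKernel_k00 : CompactKernel (sandwichKernel R0 V0) := by
  refine CompactKernel.of_lipschitz (C := 2048) (L := 512)
    (fun i j => adm00.choose_spec.meas i j) (by norm_num) (fun x y i j => ?_)
    (fun x x' y i j => ?_) (by norm_num)
  · rw [k00_apply, abs_neg, abs_mul, abs_mul, abs_of_pos (Q_pos x), abs_of_pos (Q_pos y)]
    have hx := wt_pos x
    have hy := wt_pos y
    have hx1 := wt_le_one x
    have hy1 := wt_le_one y
    calc _ ≤ (4 * wt x ^ 4) * (4 * wt y ^ 4) * (8 * ((1 + |x|) * (1 + |y|))) := by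
          have := (Q_pos y).le
          gcongr
          · exact Q_le_wt x
          · exact Q_le_wt y
          · exact abs_JRJ_le x y i j
      _ = 128 * ((1 + |x|) * wt x) * ((1 + |y|) * wt y) * wt x ^ 3 * wt y ^ 3 := by ring
      _ ≤ 128 * 4 * 4 * wt x ^ 2 * wt y ^ 1 := by
          gcongr 128 * ?_ * ?_ * ?_ * ?_
          · exact one_add_abs_mul_wt_le x
          · exact one_add_abs_mul_wt_le y
          · exact pow_le_pow_of_le_one hx.le hx1 (by norm_num)
          · exact pow_le_pow_of_le_one hy.le hy1 (by norm_num)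
      _ = _ := by ring
  · have hy := wt_pos y
    have hy1 := wt_le_one y
    have e : sandwichKernel R0 V0 x y i j - sandwichKernel R0 V0 x' y i j =
        -(Q y * ((Q x - Q x') * (J * R0 x y * J) i j +
          Q x' * ((J * R0 x y * J) i j - (J * R0 x' y * J) i j))) := by
      rw [k00_apply, k00_apply]; ring
    have hxx := abs_nonneg x
    have hyy := abs_nonneg y
    have hd := abs_nonneg (x - x')
    rw [e, abs_neg, abs_mul, abs_of_pos (Q_pos y)]
    calc _ ≤ (4 * wt y ^ 4) * (2 * |x - x'| * (8 * ((1 + |x|) * (1 + |y|))) +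
          2 * (8 * |x - x'|)) := by
          refine mul_le_mul (Q_le_wt y) ((abs_add_le _ _).trans ?_) (abs_nonneg _) (by positivity)
          rw [abs_mul, abs_mul, abs_of_pos (Q_pos x')]
          gcongr
          · exact abs_Q_sub_le x x'
          · exact abs_JRJ_le x y i j
          · exact Q_le_two x'
          · exact abs_JRJ_sub_le x x' y i j
      _ ≤ (4 * wt y ^ 4) * (32 * |x - x'| * ((1 + |x|) * (1 + |y|))) := by
          gcongr
          nlinarith [mul_nonneg hd hxx, mul_nonneg hd hyy, mul_nonneg (mul_nonneg hd hxx) hyy]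
      _ = 128 * ((1 + |y|) * wt y) * (1 + |x|) * |x - x'| * wt y ^ 3 := by ring
      _ ≤ 128 * 4 * (1 + |x|) * |x - x'| * wt y ^ 1 := by
          gcongr 128 * ?_ * _ * _ * ?_
          · exact one_add_abs_mul_wt_le y
          · exact pow_le_pow_of_le_one hy.le hy1 (by norm_num)
      _ = _ := by ring

/-- The operator `K₀₀ + 1` is invertible on `L²`. -/
theorem isUnit_one_add_op00 : IsUnit (1 + op _ adm00) := by
  obtain ⟨h, hc⟩ := compactKernel_k00
  -- Fredholm alternative at `-1`; `K00_injective` rules out the eigenvalue.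
  rcases hc.hasEigenvalue_or_mem_resolventSet (μ := (-1 : ℂ)) (by norm_num) with h1 | h1
  · exfalso
    obtain ⟨f, hf⟩ := h1.exists_hasEigenvector
    have h2 : op _ adm00 f = (-1 : ℂ) • f := hf.apply_eq_smul
    obtain ⟨F, hF, rfl⟩ : ∃ (F : ℝ → Vec) (hF : IsL2 F), f = toL2 F hF :=
      ⟨f, isL2_coe f, (toL2_coe f _).symm⟩
    rw [op_toL2, ← toL2_smul, toL2_eq_iff] at h2
    have h3 : F =ᵐ[volume] 0 := K00_injective hF <| by
      filter_upwards [h2] with x hx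
      rw [Pi.add_apply, K00, sandwich_eq_kint, hx]
      simp
    exact hf.2 ((toL2_eq_iff (hg := MemLp.zero)).2 h3)
  · rw [spectrum.mem_resolventSet_iff] at h1
    have : (algebraMap ℂ (L2Space →L[ℂ] L2Space) (-1) - op _ h) = -(1 + op _ adm00) := by
      rw [map_neg, map_one]; abel
    rw [this] at h1
    exact (IsUnit.neg_iff _).1 h1

/-! ### The reduced inverse, the expansion coefficients and the sign of `α₂`. -/

/-! ### The reduced operator -/

theorem isL2_P (f : ℝ → Vec) : IsL2 (P f) := isL2_v.smul _

theorem isL2_Pbar {f : ℝ → Vec} (hf : IsL2 f) : IsL2 (Pbar f) := hf.sub (isL2_P f)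

theorem Pbar_eq (f : ℝ → Vec) : Pbar f = f - (ip v f / 8) • v := by
  unfold Pbar P; rw [ip_v_v]; rfl

theorem ip_sub {f g h : ℝ → Vec} (hf : IsL2 f) (hg : IsL2 g) (hh : IsL2 h) :
    ip h (f - g) = ip h f - ip h g := by
  rw [← inner_toL2 hh (hf.sub hg), toL2_sub hf hg, inner_sub_right, inner_toL2, inner_toL2]

theorem ip_rsmul (c : ℝ) (f h : ℝ → Vec) : ip h (c • f) = c * ip h f := by
  rw [← ip_smul]; congr 1

theorem ip_w0_v : ip w0 v = 0 := by rw [← ip_conj, ip_v_w0, map_zero]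

theorem ip_v_Pbar {f : ℝ → Vec} (hf : IsL2 f) : ip v (Pbar f) = 0 := by
  rw [Pbar_eq, ip_sub hf (isL2_v.smul _) isL2_v, ip_smul, ip_v_v]; ring

theorem ip_w0_Pbar {f : ℝ → Vec} (hf : IsL2 f) : ip w0 (Pbar f) = ip w0 f := by
  rw [Pbar_eq, ip_sub hf (isL2_v.smul _) isL2_w0, ip_smul, ip_w0_v]; ring

theorem Pbar_of_ip_eq_zero {f : ℝ → Vec} (hf : ip v f = 0) : Pbar f = f := by
  rw [Pbar_eq, hf]; simp

theorem IsPerp.reduced_eq {f : ℝ → Vec} (hf : IsPerp f) :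
    reduced f = K00 f + f - (ip v (K00 f + f) / 8) • v := by
  unfold reduced
  rw [Pbar_of_ip_eq_zero hf.2.1, Pbar_eq]

theorem isL2_K00_add {f : ℝ → Vec} (hf : IsL2 f) : IsL2 (K00 f + f) := (isL2_K00 hf).add hf

theorem K00_add_toL2 {f : ℝ → Vec} (hf : IsL2 f) :
    (1 + op _ adm00) (toL2 f hf) = toL2 (K00 f + f) (isL2_K00_add hf) := by
  rw [add_apply, op_toL2, toL2_add (isL2_K00 hf) hf, add_comm]; rfl

theorem K00_add_add {f g : ℝ → Vec} (hf : IsL2 f) (hg : IsL2 g) :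
    K00 (f + g) + (f + g) = (K00 f + f) + (K00 g + g) := by
  unfold K00; rw [sandwich_eq_kint, kint_add adm00 hf hg]; abel

theorem K00_smul (c : ℂ) (f : ℝ → Vec) : K00 (c • f) = c • K00 f := by
  unfold K00; rw [sandwich_eq_kint, kint_smul]

theorem K00_w0_add : K00 w0 + w0 = (2 : ℂ) • v := by ext1 x; exact K00_w0 x

theorem exists_K00_add_eq {g : ℝ → Vec} (hg : IsL2 g) :
    ∃ f, IsL2 f ∧ K00 f + f =ᵐ[volume] g := by
  obtain ⟨u, hu⟩ := isUnit_one_add_op00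
  set F := (↑u⁻¹ : L2Space →L[ℂ] L2Space) (toL2 g hg)
  have h1 : (1 + op _ adm00) F = toL2 g hg := by
    rw [← hu, ← mul_apply_eq_comp, Units.mul_inv, one_apply_eq_self]
  refine ⟨F, isL2_coe F, ?_⟩
  rw [← toL2_coe F (isL2_coe F), K00_add_toL2, toL2_eq_iff] at h1
  exact h1

theorem ip_w0_w0_ne_zero : ip w0 w0 ≠ 0 := by
  intro h
  rw [← inner_toL2 isL2_w0 isL2_w0, inner_self_eq_zero] at h
  have h1 : w0 =ᵐ[volume] 0 := (toL2_eq_iff (hg := MemLp.zero)).1 h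
  have h2 : K00 w0 + w0 =ᵐ[volume] 0 := by
    have h3 := K00_add_toL2 isL2_w0
    rw [h, map_zero] at h3
    exact (toL2_eq_iff (hg := MemLp.zero)).1 h3.symm
  rw [K00_w0_add] at h2
  have h4 := ip_congr (EventuallyEq.refl _ v) h2
  rw [ip_smul, ip_v_v] at h4
  have h5 : ip v 0 = 0 := by simp [ip]
  rw [h5] at h4
  norm_num at h4

/-- If `(K₀₀ + 1) f` is a multiple of `v` then `f` is a multiple of `w₀`. -/
theorem ae_eq_smul_w0 {f : ℝ → Vec} (hf : IsL2 f) {c : ℂ} (h : K00 f + f =ᵐ[volume] c • v) :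
    f =ᵐ[volume] (c / 2) • w0 := by
  have h1 : K00 (f + (-(c / 2)) • w0) + (f + (-(c / 2)) • w0) =ᵐ[volume] 0 := by
    rw [K00_add_add hf (isL2_w0.smul _), K00_smul, ← smul_add, K00_w0_add]
    filter_upwards [h] with x hx
    rw [Pi.add_apply, hx]
    simp only [Pi.smul_apply, smul_smul, ← add_smul, Pi.zero_apply]
    ring_nf; simp
  filter_upwards [K00_injective (hf.add (isL2_w0.smul _)) h1] with x hx
  rw [Pi.add_apply, Pi.smul_apply, Pi.zero_apply, neg_smul, ← sub_eq_add_neg, sub_eq_zero] at hx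
  exact hx

/-- On `v^⊥` the reduced equation asks for `(K₀₀ + 1) f = g` modulo `v`. The invertibility of `K₀₀ +
1` gives a solution, and adding multiples of `w₀` changes the right side only along `v`, so
orthogonality to `w₀` can be arranged. Two solutions differ by a multiple of `w₀`, which
orthogonality forces to be zero. -/
theorem exists_unique_reducedPreimage {g : ℝ → Vec} (hg : IsPerp g) :
    ∃ f : ℝ → Vec, IsReducedPreimage g f ∧
      ∀ f' : ℝ → Vec, IsReducedPreimage g f' → ∀ᵐ x : ℝ, f' x = f x := by
  obtain ⟨hgL, hgv, hgw⟩ := hg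
  obtain ⟨F, hF, hFg⟩ := exists_K00_add_eq hgL
  set c : ℂ := -(ip w0 F / ip w0 w0) with hc
  have hf : IsL2 (F + c • w0) := hF.add (isL2_w0.smul c)
  have hB : K00 (F + c • w0) + (F + c • w0) =ᵐ[volume] g + (2 * c) • v := by
    rw [K00_add_add hF (isL2_w0.smul _), K00_smul, ← smul_add, K00_w0_add, smul_smul, mul_comm c]
    exact hFg.add EventuallyEq.rfl
  -- Orthogonality to `v` is automatic: by symmetry `2⟨v, f⟩ = ⟨w₀, (K₀₀ + 1) f⟩`, and both `g` and
  -- `v` are orthogonal to `w₀`.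
  have hv : ip v (F + c • w0) = 0 := by
    have h := ip_w0_K00_add hf
    rw [ip_congr EventuallyEq.rfl hB, ip_add hgL (isL2_v.smul _) isL2_w0, ip_smul, ip_w0_v,
      hgw] at h
    simpa using h.symm
  have hw : ip w0 (F + c • w0) = 0 := by
    rw [ip_add hF (isL2_w0.smul _) isL2_w0, ip_smul, hc]
    have := ip_w0_w0_ne_zero
    field_simp
    ring
  have hperp : IsPerp (F + c • w0) := ⟨hf, hv, hw⟩
  refine ⟨F + c • w0, ⟨hperp, ?_⟩, ?_⟩
  · rw [hperp.reduced_eq, ip_congr EventuallyEq.rfl hB, ip_add hgL (isL2_v.smul _) isL2_v, ip_smul,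
      hgv, ip_v_v]
    filter_upwards [hB] with x hx
    rw [Pi.sub_apply, hx]
    simp
  · rintro f' ⟨hf', hf'g⟩
    have hd := hf'.1.sub hf
    set d := f' - (F + c • w0) with hddef
    obtain ⟨b, hb⟩ : ∃ b : ℂ, b = ip v (K00 f' + f') / 8 - 2 * c := ⟨_, rfl⟩
    have h1 : K00 d + d =ᵐ[volume] b • v := by
      have h2 : K00 d = K00 f' - K00 (F + c • w0) := by
        have := K00_add_add hd hf
        rw [hddef, sub_add_cancel] at this
        rw [hddef]
        rw [← sub_eq_zero] at this ⊢
        rw [← neg_eq_zero, ← this]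
        abel
      rw [hf'.reduced_eq] at hf'g
      filter_upwards [hf'g, hB] with x hx hx'
      have hx2 : (K00 f' + f') x = g x + (ip v (K00 f' + f') / 8) • v x := by
        rw [← hx]; simp
      have hx3 : (K00 d + d) x =
          (K00 f' + f') x - (K00 (F + c • w0) + (F + c • w0)) x := by
        rw [h2, hddef]; simp only [Pi.add_apply, Pi.sub_apply]; abel
      rw [hx3, hx2, hx', hb]
      simp only [Pi.add_apply, Pi.smul_apply, sub_smul]
      abel
    have h3 := ae_eq_smul_w0 hd h1
    have h4 : b / 2 = 0 := by
      have h5 : ip w0 d = 0 := by rw [hddef, ip_sub hf'.1 hf isL2_w0, hf'.2.2, hw, sub_zero]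
      rw [ip_congr EventuallyEq.rfl h3, ip_smul] at h5
      exact (mul_eq_zero.1 h5).resolve_right ip_w0_w0_ne_zero
    filter_upwards [h3] with x hx
    rw [h4] at hx
    simpa [hddef, sub_eq_zero] using hx

theorem isReducedPreimage_reducedInv {g : ℝ → Vec} (hg : IsPerp g) :
    IsReducedPreimage g (reducedInv g) := by
  have h : ∃ f, IsReducedPreimage g f := (exists_unique_reducedPreimage hg).imp fun _ h => h.1
  rw [reducedInv, dif_pos h]
  exact h.choose_spec

/-! ### The singular part of the resolvent -/

/-- The functional `f ↦ ½ ∫ (V |V₀|^{-1/2} f)₁`. -/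
noncomputable def singularCoeff (V : ℝ → Mat) (f : ℝ → Vec) : ℂ :=
  1 / 2 * ∫ y, act (V y) (act (sqrtAbsV0 y)⁻¹ (f y)) 0

theorem act_Rm1 (x y : ℝ) (z : Vec) : act (Rm1 x y) z = (1 / 2 * z 0 : ℂ) • cvec 1 0 := by
  apply vec_ext <;> simp [act_apply, Rm1]

theorem sandwich_Rm1 {V : ℝ → Mat} (hk : Adm (sandwichKernel Rm1 V)) {f : ℝ → Vec} (hf : IsL2 f) :
    sandwich Rm1 V f = singularCoeff V f • v := by
  ext1 x
  rw [sandwich_eq_kint, kint_sandwich hk hf, Pi.smul_apply, v_eq, ← act_smul]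
  congr 1
  simp only [act_Rm1]
  rw [integral_smul_const, integral_const_mul, singularCoeff]

/-- Together with `⟨v, v⟩ = 8` this says that the leading singular operator is `-4P`, the origin of
the factors `1/4` in the definitions of `w₁` and `w₂`. -/
theorem singularCoeff_V0 {f : ℝ → Vec} : singularCoeff V0 f = -(1 / 2) * ip v f := by
  have h : ∀ y, act (V0 y) (act (sqrtAbsV0 y)⁻¹ (f y)) 0 = -inner ℂ (v y) (f y) := fun y => by
    rw [← act_mul, V0_mul_inv, v_eq, ← sqrtAbsV0_transpose, ← inner_act, inner_vec, neg_act,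
      sqrtAbsV0_transpose]
    simp
  simp only [singularCoeff, h, integral_neg, ip]
  ring

theorem ip_w0_K00_v : ip w0 (K00 v) = 16 := by
  have h := ip_w0_K00_add isL2_v
  rw [ip_add (isL2_K00 isL2_v) isL2_v isL2_w0, ip_w0_v, ip_v_v, add_zero] at h
  rw [h]; norm_num

/-- The vector `|V₀|^{-1/2} V u₀`. -/
noncomputable def sourceVec (V : ℝ → Mat) (y : ℝ) : Vec := act (sqrtAbsV0 y)⁻¹ (act (V y) (u0 y))

theorem sqrtAbsV0_inv_transpose (x : ℝ) : ((sqrtAbsV0 x)⁻¹)ᵀ = (sqrtAbsV0 x)⁻¹ := by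
  rw [Matrix.transpose_nonsing_inv, sqrtAbsV0_transpose]

/-- The functional `¼ K₀₀ K₋₁ + K₀`, tested against `w₀`. -/
theorem ip_w0_K0_add {V : ℝ → Mat} {d : ℝ} (hV : PotBound V d) (hs : ∀ y, (V y)ᵀ = V y)
    {f : ℝ → Vec} (hf : IsL2 f) :
    1 / 4 * ip w0 (K00 (sandwich Rm1 V f)) + ip w0 (sandwich R0 V f) = ip (sourceVec V) f := by
  have h0 := adm_sandwich resBound_R0 hV
  have hk : Adm (sandwichKernel Rm1 V) := adm_sandwich resBound_Rm1 hV
  have h1 := ip_kint h0 hf isL2_w0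
  have hadj : ∀ x y, (sandwichKernel R0 V y x)ᵀ =
      (sqrtAbsV0 x)⁻¹ * V x * R0 x y * sqrtAbsV0 y := fun x y => by
    simp only [sandwichKernel, Matrix.transpose_mul, R0_symm, sqrtAbsV0_transpose, hs,
      sqrtAbsV0_inv_transpose, Matrix.mul_assoc]
  -- The adjoint of the regular part sends `w₀` to `-|V₀|^{-1/2} V R₀ V₀ u₀`, and `R₀ V₀ u₀ = (2, 0)
  -- - u₀`. The unwanted `(2, 0)` is compensated by the singular part, since `⟨w₀, K₀₀ v⟩ / 4 = 4`.
  have h2 : ∀ x, kint (fun x y => (sandwichKernel R0 V y x)ᵀ) w0 x =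
      act (sqrtAbsV0 x)⁻¹ (act (V x) (u0 x - (2 : ℂ) • cvec 1 0)) := fun x => by
    have h3 : ∀ y, act (sandwichKernel R0 V y x)ᵀ (w0 y) = act ((sqrtAbsV0 x)⁻¹ * V x)
        (-act (R0 x y) (act (V0 y) (act (sqrtAbsV0 y)⁻¹ (w0 y)))) := fun y => by
      rw [hadj, act_mul, act_mul, ← act_mul (V0 y), V0_mul_inv, neg_act, act_neg, act_neg, act_neg,
        neg_neg]
    simp only [kint, h3]
    simp_rw [← actL_apply ((sqrtAbsV0 x)⁻¹ * V x)]
    have h3' := (actL ((sqrtAbsV0 x)⁻¹ * V x)).integral_comp_comm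
      (sandwich_integrable adm00 isL2_w0 x).neg
    simp only [Pi.neg_apply] at h3'
    rw [h3', integral_neg, R0_V0_u0, actL_apply, act_mul]
    congr 2
    rw [u0_eq]
    apply vec_ext <;> simp
  have h4 : Integrable fun y => act (V y) (act (sqrtAbsV0 y)⁻¹ (f y)) 0 := by
    have h5 := sandwich_integrable hk hf 0
    have h6 := (EuclideanSpace.proj (𝕜 := ℂ) (0 : Fin 2)).integrable_comp h5
    refine (h6.const_mul 2).congr (ae_of_all _ fun y => ?_)
    simp [act_Rm1]
  have hpt : ∀ (z : Vec) y, inner ℂ (act (sqrtAbsV0 y)⁻¹ (act (V y) z)) (f y) =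
      inner ℂ z (act (V y) (act (sqrtAbsV0 y)⁻¹ (f y))) := fun z y => by
    rw [inner_act, inner_act, hs, sqrtAbsV0_inv_transpose]
  have h7 : ip w0 (sandwich R0 V f) = ∫ y, (inner ℂ (sourceVec V y) (f y) -
      2 * act (V y) (act (sqrtAbsV0 y)⁻¹ (f y)) 0) := by
    rw [sandwich_eq_kint, h1, ip]
    refine integral_congr_ae (ae_of_all _ fun y => ?_)
    simp only [h2, sourceVec, hpt, inner_sub_left, inner_smul_left]
    rw [inner_vec (cvec 1 0), Complex.conj_ofNat]
    simp
  have h8 : Integrable fun y => inner ℂ (sourceVec V y) (f y) := by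
    have h10 : Integrable fun y => inner ℂ
        (toL2 _ ((adm_sandwich resBound_R0 hV).choose_spec.adjoint.adm.isL2_kint isL2_w0) y)
        (toL2 f hf y) := L2.integrable_inner (𝕜 := ℂ) _ _
    refine (h10.add (h4.const_mul 2)).congr ?_
    filter_upwards [coeFn_toL2 hf, coeFn_toL2
      ((adm_sandwich resBound_R0 hV).choose_spec.adjoint.adm.isL2_kint isL2_w0)] with y hy hy'
    rw [Pi.add_apply, hy, hy']
    simp only [h2, sourceVec, hpt, inner_sub_left, inner_smul_left]
    rw [inner_vec (cvec 1 0), Complex.conj_ofNat]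
    simp
  rw [h7, integral_sub h8 (h4.const_mul 2), integral_const_mul, sandwich_Rm1 hk hf, K00_smul,
    ip_smul, ip_w0_K00_v, singularCoeff, ip]
  ring

/-! ### The coefficients of the expansion -/

theorem V1_transpose (y : ℝ) : (V1 y)ᵀ = V1 y := by
  ext i j; fin_cases i <;> fin_cases j <;> simp [V1]

theorem V2_transpose (y : ℝ) : (V2 y)ᵀ = V2 y := by
  ext i j; fin_cases i <;> fin_cases j <;> simp [V2]

theorem isL2_K01 {f : ℝ → Vec} (hf : IsL2 f) : IsL2 (K01 f) := adm01.isL2_kint hf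
theorem isL2_K02 {f : ℝ → Vec} (hf : IsL2 f) : IsL2 (K02 f) := adm02.isL2_kint hf
theorem isL2_K10 {f : ℝ → Vec} (hf : IsL2 f) : IsL2 (K10 f) := adm10.isL2_kint hf
theorem isL2_Km11 {f : ℝ → Vec} (hf : IsL2 f) : IsL2 (Km11 f) := adm_m11.isL2_kint hf
theorem isL2_Km12 {f : ℝ → Vec} (hf : IsL2 f) : IsL2 (Km12 f) := adm_m12.isL2_kint hf

theorem Km11_eq {f : ℝ → Vec} (hf : IsL2 f) : Km11 f = singularCoeff V1 f • v :=
  sandwich_Rm1 adm_m11 hf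

theorem Km12_eq {f : ℝ → Vec} (hf : IsL2 f) : Km12 f = singularCoeff V2 f • v :=
  sandwich_Rm1 adm_m12 hf

theorem ip_w0_first {f : ℝ → Vec} (hf : IsL2 f) :
    1 / 4 * ip w0 (K00 (Km11 f)) + ip w0 (K01 f) = ip (sourceVec V1) f :=
  ip_w0_K0_add potBound_V1 V1_transpose hf

theorem ip_w0_second {f : ℝ → Vec} (hf : IsL2 f) :
    1 / 4 * ip w0 (K00 (Km12 f)) + ip w0 (K02 f) = ip (sourceVec V2) f :=
  ip_w0_K0_add potBound_V2 V2_transpose hf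

/-- The density is the first component of `V₀ u₀`, namely `4 (tanh sech²)'`. All decaying terms of
the primitive drop out and only `-tanh` contributes at infinity, which is why the value does not
depend on `x`. -/
theorem integral_sq_mul_deriv (x : ℝ) :
    ∫ y, |x - y| ^ 2 / 4 * (12 * (sech y ^ 2) ^ 2 - 8 * sech y ^ 2) = -2 := by
  have hd : ∀ y, HasDerivAt (fun y => ((x ^ 2 * (Real.tanh y * sech y ^ 2) -
      2 * x * (y * (Real.tanh y * sech y ^ 2)) + y * (y * (Real.tanh y * sech y ^ 2))) -
      x * sech y ^ 2 + y * sech y ^ 2) - Real.tanh y)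
      (|x - y| ^ 2 / 4 * (12 * (sech y ^ 2) ^ 2 - 8 * sech y ^ 2)) y := fun y => by
    have h1 := hasDerivAt_tanh_sech_sq y
    have h2 := (hasDerivAt_id y).mul h1
    have h3 := (hasDerivAt_id y).mul h2
    have h4 := hasDerivAt_sech_sq y
    have h5 := (hasDerivAt_id y).mul h4
    refine (((((h1.const_mul (x ^ 2)).sub (h2.const_mul (2 * x))).add h3).sub
      (h4.const_mul x)).add h5 |>.sub (hasDerivAt_tanh y)).congr_deriv ?_
    rw [sq_abs]
    simp only [Pi.mul_apply, id]
    ring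
  have e1 := expDecay_tanh_sech_sq
  have e2 := expDecay_sech_sq
  have h4 : ExpDecay fun x => (sech x ^ 2) ^ 2 := by
    simpa only [pow_two (sech _ ^ 2)] using expDecay_sech_sq.bdd_mul abs_sech_sq_le
  have hdec : ExpDecay fun y => ((x ^ 2 * (Real.tanh y * sech y ^ 2) -
      2 * x * (y * (Real.tanh y * sech y ^ 2)) + y * (y * (Real.tanh y * sech y ^ 2))) -
      x * sech y ^ 2 + y * sech y ^ 2) :=
    ((((e1.const_mul _).sub (e1.id_mul.const_mul _)).add e1.id_mul.id_mul).sub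
      (e2.const_mul _)).add e2.id_mul
  have hi : Integrable fun y => |x - y| ^ 2 / 4 * (12 * (sech y ^ 2) ^ 2 - 8 * sech y ^ 2) := by
    have g := (h4.const_mul 12).sub (e2.const_mul 8)
    have g2 : ExpDecay fun y => (x ^ 2 / 4 * (12 * (sech y ^ 2) ^ 2 - 8 * sech y ^ 2) -
        x / 2 * (y * (12 * (sech y ^ 2) ^ 2 - 8 * sech y ^ 2))) +
        1 / 4 * (y * (y * (12 * (sech y ^ 2) ^ 2 - 8 * sech y ^ 2))) :=
      ((g.const_mul _).sub (g.id_mul.const_mul _)).add (g.id_mul.id_mul.const_mul _)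
    have := continuous_sech
    refine (g2.integrable (by fun_prop)).congr (ae_of_all _ fun y => ?_)
    simp only [sq_abs]; ring
  rw [integral_of_hasDerivAt_of_tendsto hd hi
    (hdec.tendsto_atBot.sub tendsto_tanh_atBot) (hdec.tendsto_atTop.sub tendsto_tanh_atTop)]
  norm_num

theorem K10_w0 : K10 w0 = (-2 : ℂ) • v := by
  ext1 x
  unfold K10
  rw [sandwich_eq_kint, kint_sandwich adm10 isL2_w0, Pi.smul_apply, v_eq, ← act_smul]
  have h : ∀ y, act (R1 x y) (act (V0 y) (act (sqrtAbsV0 y)⁻¹ (w0 y))) =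
      ((|x - y| ^ 2 / 4 * (12 * (sech y ^ 2) ^ 2 - 8 * sech y ^ 2) : ℝ) : ℂ) • cvec 1 0 :=
    fun y => by
      rw [act_inv_w0, V0_act_cvec, act_cvec]
      apply vec_ext
      · simp [R1]; ring
      · simp [R1]
  simp only [h]
  rw [integral_smul_const, integral_complex_ofReal, integral_sq_mul_deriv]
  norm_num

/-- `K₁₀ w₀` is parallel to `v`, hence orthogonal to `w₀`; the whole value comes from the second
term, `⟨w₀, K₀₀ v⟩ / 2`. -/
theorem denominator_eq : ip w0 (K10 w0) + 1 / 4 * ip w0 (K00 (K00 w0 + w0)) = 8 := by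
  rw [K10_w0, K00_w0_add, K00_smul, ip_smul, ip_smul, ip_w0_v, ip_w0_K00_v]; norm_num

theorem inner_sourceVec (V : ℝ → Mat) (x : ℝ) (z : Vec) :
    inner ℂ (sourceVec V x) (act (sqrtAbsV0 x) z) = inner ℂ (act (V x) (u0 x)) z := by
  rw [sourceVec, inner_act, sqrtAbsV0_transpose, act_sqrt_inv]

theorem inner_sourceVec_V1 (x a b : ℝ) :
    inner ℂ (sourceVec V1 x) (act (sqrtAbsV0 x) (cvec a b)) =
      ((-(1 / 2) * ((2 * sech x ^ 2 + 3 * q1 x) * (2 - 4 * sech x ^ 2) * (a + b) +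
        2 * q1 x * (a - b)) : ℝ) : ℂ) := by
  rw [inner_sourceVec, u0_eq, V1_act_cvec, inner_cvec]
  congr 1; ring

theorem inner_sourceVec_V2 (x a b : ℝ) :
    inner ℂ (sourceVec V2 x) (act (sqrtAbsV0 x) (cvec a b)) =
      ((-(1 / 2) * ((q1 x + 3 * q2 x) * (2 - 4 * sech x ^ 2) * (a + b) +
        2 * q2 x * (a - b)) : ℝ) : ℂ) := by
  rw [inner_sourceVec, u0_eq, V2_act_cvec, inner_cvec]
  congr 1; ring

theorem expDecay_q1 : ExpDecay q1 := ⟨128, 3 / 2, by norm_num, abs_q1_le⟩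

theorem expDecay_q2 : ExpDecay q2 := ⟨256, 3 / 2, by norm_num, abs_q2_le⟩

/-- The quantity is `⟨V₁ u₀, u₀⟩`, and its integrand is exact, with an explicit decaying primitive.
It is the solvability condition at order `ε`, the reason why `α` starts at order `ε²`, and it makes
multiples of `w₀` in `w₁` irrelevant for `α₂`. -/
theorem ip_sourceVec_V1_w0 : ip (sourceVec V1) w0 = 0 := by
  have e : ∀ x, inner ℂ (sourceVec V1 x) (w0 x) =
      ((-(1 / 2) * ((2 * sech x ^ 2 + 3 * q1 x) * (2 - 4 * sech x ^ 2) * (2 - 4 * sech x ^ 2) +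
        4 * q1 x) : ℝ) : ℂ) := fun x => by
    rw [w0_eq, inner_sourceVec_V1]; congr 1; ring
  have e1 := expDecay_tanh_sech_sq
  have e2 := expDecay_sech_sq
  have h4 : ExpDecay fun x => sech x ^ 2 * sech x ^ 2 := expDecay_sech_sq.bdd_mul abs_sech_sq_le
  have h6 : ExpDecay fun x => sech x ^ 2 * (sech x ^ 2 * sech x ^ 2) := h4.bdd_mul abs_sech_sq_le
  have h5 : ExpDecay fun x => sech x ^ 2 * (Real.tanh x * sech x ^ 2) :=
    expDecay_tanh_sech_sq.bdd_mul abs_sech_sq_le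
  have hdec : ExpDecay fun x => ((4 * (sech x ^ 2 * (Real.tanh x * sech x ^ 2)) +
      8 * (x * sech x ^ 2)) - 12 * (x * (sech x ^ 2 * sech x ^ 2))) +
      8 * (x * (sech x ^ 2 * (sech x ^ 2 * sech x ^ 2))) :=
    (((h5.const_mul _).add (e2.id_mul.const_mul _)).sub (h4.id_mul.const_mul _)).add
      (h6.id_mul.const_mul _)
  have hder : ∀ x, HasDerivAt (fun x => ((4 * (sech x ^ 2 * (Real.tanh x * sech x ^ 2)) +
      8 * (x * sech x ^ 2)) - 12 * (x * (sech x ^ 2 * sech x ^ 2))) +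
      8 * (x * (sech x ^ 2 * (sech x ^ 2 * sech x ^ 2))))
      (1 / 2 * ((2 * sech x ^ 2 + 3 * q1 x) * (2 - 4 * sech x ^ 2) * (2 - 4 * sech x ^ 2) +
        4 * q1 x)) x := fun x => by
    have d1 := hasDerivAt_sech_sq x
    have d2 := hasDerivAt_tanh_sech_sq x
    have d4 := d1.mul d1
    have d6 := d1.mul d4
    have d5 := d1.mul d2
    have di := hasDerivAt_id x
    refine (((((d5.const_mul 4).add ((di.mul d1).const_mul 8))).sub
      ((di.mul d4).const_mul 12)).add ((di.mul d6).const_mul 8)).congr_deriv ?_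
    have ht := tanh_sq x
    simp only [Pi.mul_apply, id, q1]
    linear_combination (-8 * (sech x ^ 2) ^ 2) * ht
  have hi : Integrable fun x => 1 / 2 * ((2 * sech x ^ 2 + 3 * q1 x) * (2 - 4 * sech x ^ 2) *
      (2 - 4 * sech x ^ 2) + 4 * q1 x) := by
    have hb : ∀ x, |2 - 4 * sech x ^ 2| ≤ 6 := fun x => by
      obtain ⟨h1, h2⟩ := abs_le.1 (abs_sech_sq_le x)
      exact abs_le.2 ⟨by linarith, by linarith⟩
    have g := (((((e2.const_mul 2).add (expDecay_q1.const_mul 3)).bdd_mul hb).bdd_mul hb).add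
      (expDecay_q1.const_mul 4)).const_mul (1 / 2)
    have := continuous_sech
    have := continuous_q1
    refine (g.integrable (by fun_prop)).congr (ae_of_all _ fun y => ?_)
    simp only; ring
  simp only [ip, e]
  rw [integral_complex_ofReal]
  have := hdec.integral_deriv_eq_zero hder hi
  have h7 : ∀ x, -(1 / 2) * ((2 * sech x ^ 2 + 3 * q1 x) * (2 - 4 * sech x ^ 2) *
      (2 - 4 * sech x ^ 2) + 4 * q1 x) = -(1 / 2 * ((2 * sech x ^ 2 + 3 * q1 x) *
      (2 - 4 * sech x ^ 2) * (2 - 4 * sech x ^ 2) + 4 * q1 x)) := fun x => by ring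
  simp only [h7]
  rw [integral_neg, this]; simp

/-! ### Structure of `w₁` and `w₂` -/

/-- A function determined by its component along `v` and a reduced equation. -/
theorem K00_add_smul_sub_reducedInv {r : ℝ → Vec} (σ : ℂ)
    (hg : IsPerp (Pbar (σ • K00 v + r))) :
    ∃ β : ℂ, K00 (σ • v - reducedInv (Pbar (σ • K00 v + r))) +
      (σ • v - reducedInv (Pbar (σ • K00 v + r))) =ᵐ[volume] β • v - r := by
  obtain ⟨hf, hfg⟩ := isReducedPreimage_reducedInv hg
  set f := reducedInv (Pbar (σ • K00 v + r))
  rw [hf.reduced_eq, Pbar_eq] at hfg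
  refine ⟨σ + ip v (σ • K00 v + r) / 8 - ip v (K00 f + f) / 8, ?_⟩
  have h1 : K00 (σ • v - f) + (σ • v - f) = σ • (K00 v + v) - (K00 f + f) := by
    have h2 : K00 (σ • v - f) = σ • K00 v - K00 f := by
      have h3 := K00_add_add (isL2_v.smul σ) (hf.1.smul (-1))
      rw [K00_smul, K00_smul] at h3
      have h4 : σ • v - f = σ • v + (-1 : ℂ) • f := by rw [neg_one_smul, sub_eq_add_neg]
      rw [h4]
      have h5 := add_right_cancel (h3.trans (by abel :
        _ = (σ • K00 v + (-1 : ℂ) • K00 f) + (σ • v + (-1 : ℂ) • f)))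
      rw [h5, neg_one_smul, sub_eq_add_neg]
    rw [h2, smul_add]; abel
  rw [h1]
  filter_upwards [hfg] with x hx
  have h2 : (K00 f + f) x = (σ • K00 v + r) x - (ip v (σ • K00 v + r) / 8) • v x +
      (ip v (K00 f + f) / 8) • v x := by
    rw [Pi.sub_apply, Pi.sub_apply, Pi.smul_apply] at hx
    rw [Pi.smul_apply] at hx
    rw [← hx]; abel
  rw [Pi.sub_apply, h2]
  simp only [Pi.add_apply, Pi.sub_apply, Pi.smul_apply, sub_smul, add_smul, smul_add]
  abel

theorem ip_v_smul_sub_reducedInv {g : ℝ → Vec} (σ : ℂ) (hg : IsPerp g) :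
    ip v (σ • v - reducedInv g) = 8 * σ := by
  have hf := (isReducedPreimage_reducedInv hg).1
  rw [ip_sub (isL2_v.smul σ) hf.1 isL2_v, ip_smul, ip_v_v, hf.2.1]; ring

theorem Pbar_add {f g : ℝ → Vec} (hf : IsL2 f) (hg : IsL2 g) : Pbar (f + g) = Pbar f + Pbar g := by
  simp only [Pbar_eq, ip_add hf hg isL2_v, add_div, add_smul]; abel

theorem Pbar_smul (c : ℂ) (f : ℝ → Vec) : Pbar (c • f) = c • Pbar f := by
  simp only [Pbar_eq, ip_smul, smul_sub, smul_smul, mul_div_assoc]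

theorem Pbar_rsmul (c : ℝ) (f : ℝ → Vec) : Pbar (c • f) = c • Pbar f := Pbar_smul (c : ℂ) f

theorem isPerp_of_ip_w0 {h : ℝ → Vec} (hh : IsL2 h) (h0 : ip w0 h = 0) : IsPerp (Pbar h) :=
  ⟨isL2_Pbar hh, ip_v_Pbar hh, (ip_w0_Pbar hh).trans h0⟩

theorem source1_eq' : source1 = Pbar ((1 / 4 : ℝ) • K00 (Km11 w0) + K01 w0) := by
  rw [Pbar_add ((isL2_K00 (isL2_Km11 isL2_w0)).rsmul _) (isL2_K01 isL2_w0), Pbar_rsmul]; rfl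

/-- Orthogonality to `v` comes from the projection, orthogonality to `w₀` from `⟨V₁ u₀, u₀⟩ = 0`. -/
theorem isPerp_source1 : IsPerp source1 := by
  have h := isL2_Km11 isL2_w0
  rw [source1_eq']
  refine isPerp_of_ip_w0 (((isL2_K00 h).rsmul _).add (isL2_K01 isL2_w0)) ?_
  rw [ip_add ((isL2_K00 h).rsmul _) (isL2_K01 isL2_w0) isL2_w0, ip_rsmul, ← ip_sourceVec_V1_w0,
    ← ip_w0_first isL2_w0]
  push_cast; rfl

theorem isL2_w1 : IsL2 w1 :=
  ((isL2_Km11 isL2_w0).rsmul _).sub (isReducedPreimage_reducedInv isPerp_source1).1.1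

theorem source1_eq : source1 = Pbar ((singularCoeff V1 w0 / 4) • K00 v + K01 w0) := by
  rw [source1_eq', Km11_eq isL2_w0, K00_smul]
  congr 2
  ext1 x
  simp only [Pi.smul_apply, ← Complex.coe_smul, smul_smul]
  congr 1; push_cast; ring

theorem w1_eq : w1 = (singularCoeff V1 w0 / 4) • v - reducedInv source1 := by
  unfold w1
  rw [Km11_eq isL2_w0]
  congr 1
  ext1 x
  simp only [Pi.smul_apply, ← Complex.coe_smul, smul_smul]
  congr 1; push_cast; ring

/-- The equation at order `ε`, modulo `v`. The multiple `β` need not be known: it only renormalizes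
the approximate solution. -/
theorem K00_w1 : ∃ β : ℂ, K00 w1 + w1 =ᵐ[volume] β • v - K01 w0 := by
  rw [w1_eq, source1_eq]
  exact K00_add_smul_sub_reducedInv _ (source1_eq ▸ isPerp_source1)

/-- The component of `w₁` along `v` cancels the singular term at order `ε`, that is, `ℓ₀(w₁) +
ℓ₁(w₀) = 0`. -/
theorem ip_v_w1 : ip v w1 = 2 * singularCoeff V1 w0 := by
  rw [w1_eq, ip_v_smul_sub_reducedInv _ isPerp_source1]; ring

theorem alpha2Quotient_eq :
    alpha2Quotient = -(ip (sourceVec V1) w1 + ip (sourceVec V2) w0) / 8 := by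
  unfold alpha2Quotient
  rw [denominator_eq, ← ip_w0_first isL2_w1, ← ip_w0_second isL2_w0]
  congr 1; ring

/-- The function to which the projection is applied in `source2`. -/
noncomputable def preSource2 : ℝ → Vec :=
  (1 / 4 : ℝ) • K00 (Km11 w1) + (1 / 4 : ℝ) • K00 (Km12 w0)
    + (alpha2 / 4) • K00 (K00 w0 + w0) + K01 w1 + K02 w0 + alpha2 • K10 w0

theorem isL2_K00_Km (a b c : ℝ) :
    IsL2 (a • K00 (Km11 w1)) ∧ IsL2 (b • K00 (Km12 w0)) ∧ IsL2 (c • K00 (K00 w0 + w0)) :=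
  ⟨(isL2_K00 (isL2_Km11 isL2_w1)).rsmul _, (isL2_K00 (isL2_Km12 isL2_w0)).rsmul _,
    (isL2_K00 (isL2_K00_add isL2_w0)).rsmul _⟩

theorem source2_eq' : source2 = Pbar preSource2 := by
  obtain ⟨h1, h2, h3⟩ := isL2_K00_Km (1 / 4) (1 / 4) (alpha2 / 4)
  have h4 := isL2_K01 isL2_w1
  have h5 := isL2_K02 isL2_w0
  have h6 : IsL2 (alpha2 • K10 w0) := (isL2_K10 isL2_w0).rsmul _
  unfold preSource2
  rw [Pbar_add ((((h1.add h2).add h3).add h4).add h5) h6, Pbar_add (((h1.add h2).add h3).add h4) h5,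
    Pbar_add ((h1.add h2).add h3) h4, Pbar_add (h1.add h2) h3, Pbar_add h1 h2]
  simp only [Pbar_rsmul]
  rfl

theorem isL2_preSource2 : IsL2 preSource2 := by
  obtain ⟨h1, h2, h3⟩ := isL2_K00_Km (1 / 4) (1 / 4) (alpha2 / 4)
  exact ((((h1.add h2).add h3).add (isL2_K01 isL2_w1)).add (isL2_K02 isL2_w0)).add
    ((isL2_K10 isL2_w0).rsmul _)

/-- `α₂` is exactly the number for which this solvability condition at order `ε²` holds. Since
`alpha2` is a real part, the quotient must first be known to be real. -/
theorem isPerp_source2 (hα : alpha2Quotient = (alpha2 : ℂ)) : IsPerp source2 := by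
  rw [source2_eq']
  refine isPerp_of_ip_w0 isL2_preSource2 ?_
  obtain ⟨h1, h2, h3⟩ := isL2_K00_Km (1 / 4) (1 / 4) (alpha2 / 4)
  have h4 := isL2_K01 isL2_w1
  have h5 := isL2_K02 isL2_w0
  have h6 : IsL2 (alpha2 • K10 w0) := (isL2_K10 isL2_w0).rsmul _
  have hq := alpha2Quotient_eq
  rw [hα, ← ip_w0_first isL2_w1, ← ip_w0_second isL2_w0] at hq
  have hden := denominator_eq
  unfold preSource2
  rw [ip_add ((((h1.add h2).add h3).add h4).add h5) h6 isL2_w0,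
    ip_add (((h1.add h2).add h3).add h4) h5 isL2_w0,
    ip_add ((h1.add h2).add h3) h4 isL2_w0, ip_add (h1.add h2) h3 isL2_w0, ip_add h1 h2 isL2_w0]
  simp only [ip_rsmul]
  push_cast
  linear_combination 8 * hq + (alpha2 : ℂ) * hden

/-- One quarter of the coefficient of `v` that determines `P w₂`. -/
noncomputable def coeffW2 : ℂ :=
  (singularCoeff V1 w1 + singularCoeff V2 w0 + 2 * alpha2) / 4

theorem source2_eq :
    source2 = Pbar (coeffW2 • K00 v + (K01 w1 + K02 w0 + alpha2 • K10 w0)) := by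
  rw [source2_eq', preSource2, Km11_eq isL2_w1, Km12_eq isL2_w0, K00_w0_add]
  simp only [K00_smul]
  congr 1
  ext1 x
  simp only [Pi.add_apply, Pi.smul_apply, ← Complex.coe_smul, smul_smul, coeffW2]
  have : ((singularCoeff V1 w1 + singularCoeff V2 w0 + 2 * alpha2) / 4 : ℂ) • K00 v x =
      (((1 / 4 : ℝ) : ℂ) * singularCoeff V1 w1) • K00 v x +
      (((1 / 4 : ℝ) : ℂ) * singularCoeff V2 w0) • K00 v x +
      (((alpha2 / 4 : ℝ) : ℂ) * 2) • K00 v x := by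
    rw [← add_smul, ← add_smul]; congr 1; push_cast; ring
  rw [this]
  abel

theorem w2_eq : w2 = coeffW2 • v - reducedInv source2 := by
  unfold w2
  rw [Km11_eq isL2_w1, Km12_eq isL2_w0, K00_w0_add]
  congr 1
  ext1 x
  simp only [Pi.smul_apply, ← Complex.coe_smul, smul_smul, ← add_smul, coeffW2]
  congr 1; push_cast; ring

theorem isL2_w2 (hα : alpha2Quotient = (alpha2 : ℂ)) : IsL2 w2 := by
  rw [w2_eq]
  exact (isL2_v.smul _).sub (isReducedPreimage_reducedInv (isPerp_source2 hα)).1.1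

theorem K00_w2 (hα : alpha2Quotient = (alpha2 : ℂ)) : ∃ β : ℂ,
    K00 w2 + w2 =ᵐ[volume] β • v - (K01 w1 + K02 w0 + alpha2 • K10 w0) := by
  rw [w2_eq, source2_eq]
  exact K00_add_smul_sub_reducedInv _ (source2_eq ▸ isPerp_source2 hα)

theorem ip_v_w2 (hα : alpha2Quotient = (alpha2 : ℂ)) :
    ip v w2 = 2 * (singularCoeff V1 w1 + singularCoeff V2 w0 + 2 * alpha2) := by
  rw [w2_eq, ip_v_smul_sub_reducedInv _ (isPerp_source2 hα), coeffW2]; ring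

/-! ### The first order corrector and the sign of `α₂` -/

theorem ExpDecay.exists_bound {E : Type*} [NormedAddCommGroup E] {f : ℝ → E} (hf : ExpDecay f) :
    ∃ C, ∀ x, ‖f x‖ ≤ C := by
  obtain ⟨C, c, hc, h⟩ := hf
  have hC : 0 ≤ C := by simpa using (norm_nonneg _).trans (h 0)
  refine ⟨C, fun x => (h x).trans (mul_le_of_le_one_right hC (Real.exp_le_one_iff.2 ?_))⟩
  nlinarith [abs_nonneg x]

theorem ExpDecay.mul {f g : ℝ → ℝ} (hf : ExpDecay f) (hg : ExpDecay g) :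
    ExpDecay fun x => f x * g x := by
  obtain ⟨C, hC⟩ := hf.exists_bound
  exact hg.bdd_mul hC

/-- The function `(2 - ∂ₓ²)⁻¹ sech²`. -/
theorem exists_potential_sech_sq : ∃ κ κ' : ℝ → ℝ, (∀ x, HasDerivAt κ (κ' x) x) ∧
    (∀ x, HasDerivAt κ' (2 * κ x - sech x ^ 2) x) ∧ ExpDecay κ ∧ ExpDecay κ' ∧ ∀ x, 0 ≤ κ x := by
  have h2 := one_le_sqrt_two
  obtain ⟨φ', h1, h3, ⟨C, h4⟩, D, h5⟩ := green_solution (f := fun x => ((sech x ^ 2 : ℝ) : ℂ))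
    (σ := √2) (by positivity) (Complex.continuous_ofReal.comp continuous_sech_sq) (M := 4) (c := 2)
    (s := 1) one_pos h2 (by norm_num) (fun y => by
      rw [Complex.norm_real, Real.norm_of_nonneg (sq_nonneg _)]; exact sech_sq_le y)
  have e : ∀ x, ∫ y, green √2 |x - y| • ((sech y ^ 2 : ℝ) : ℂ) =
      ((∫ y, green √2 |x - y| * sech y ^ 2 : ℝ) : ℂ) := fun x => by
    rw [← integral_complex_ofReal]
    simp
  simp only [e] at h1 h3 h4
  refine ⟨fun x => ∫ y, green √2 |x - y| * sech y ^ 2, fun x => (φ' x).re, fun x => ?_, fun x => ?_,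
    ⟨C, 1, one_pos, fun x => ?_⟩, ⟨D, 1, one_pos, fun x => ?_⟩, fun x => ?_⟩
  · exact Complex.reCLM.hasFDerivAt.comp_hasDerivAt x (h1 x)
  · have := (Complex.reCLM.hasFDerivAt.comp_hasDerivAt x (h3 x))
    refine this.congr_deriv ?_
    rw [Real.sq_sqrt (by norm_num), Complex.reCLM_apply, Complex.sub_re, Complex.real_smul,
      Complex.re_ofReal_mul, Complex.ofReal_re, Complex.ofReal_re]
  · simpa using h4 x
  · exact (Complex.abs_re_le_norm _).trans (h5 x)
  · refine integral_nonneg fun y => ?_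
    have : 0 ≤ green √2 |x - y| := by unfold green; positivity
    exact mul_nonneg this (sq_nonneg _)

theorem integrable_inner {f g : ℝ → Vec} (hf : IsL2 f) (hg : IsL2 g) :
    Integrable fun x => inner ℂ (f x) (g x) := by
  have h : Integrable fun y => inner ℂ (toL2 f hf y) (toL2 g hg y) := L2.integrable_inner (𝕜 := ℂ) _ _
  refine h.congr ?_
  filter_upwards [coeFn_toL2 hf, coeFn_toL2 hg] with y hy hy'
  rw [hy, hy']

theorem isL2_sourceVec {V : ℝ → Mat} {d : ℝ} (hV : PotBound V d) : IsL2 (sourceVec V) := by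
  have hu : Continuous u0 := by
    have : u0 = fun x => cvec (2 - 2 * sech x ^ 2) (-(2 * sech x ^ 2)) := by ext1 x; exact u0_eq x
    have := continuous_sech
    rw [‹u0 = _›]
    exact continuous_cvec (by fun_prop) (by fun_prop)
  have hd : 0 ≤ d := by
    have := (abs_nonneg _).trans (hV.bound 0 0 0); simpa using this
  refine isL2_of_bound (c := 256 * d) (aestronglyMeasurable_act
    (fun i j => (continuous_inv_sqrt i j).measurable)
    (aestronglyMeasurable_act hV.meas hu.aestronglyMeasurable)) fun x => ?_
  have h1 := norm_act_le (abs_inv_sqrt_le x) (act (V x) (u0 x))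
  have h2 := norm_act_le (hV.bound x) (u0 x)
  have h3 : ‖u0 x‖ ≤ 16 := by
    obtain ⟨g1, g2⟩ := abs_le.1 (abs_sech_sq_le x)
    rw [u0_eq]
    refine (norm_le_comp _).trans ?_
    rw [cvec_zero, cvec_one, Complex.norm_real, Complex.norm_real, Real.norm_eq_abs,
      Real.norm_eq_abs]
    have k1 : |2 - 2 * sech x ^ 2| ≤ 4 := abs_le.2 ⟨by linarith, by linarith⟩
    have k2 : |-(2 * sech x ^ 2)| ≤ 4 := abs_le.2 ⟨by linarith, by linarith⟩
    linarith
  have hw : Real.exp |x| * Real.exp (-(3 / 2) * |x|) ≤ wt x := by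
    rw [← Real.exp_add, wt]
    refine Real.exp_le_exp.2 ?_
    linarith [abs_nonneg x]
  calc _ ≤ 4 * Real.exp |x| * (4 * (d * Real.exp (-(3 / 2) * |x|)) * 16) := by
        refine h1.trans ?_
        gcongr
        exact h2.trans (by gcongr)
    _ = 256 * d * (Real.exp |x| * Real.exp (-(3 / 2) * |x|)) := by ring
    _ ≤ _ := by gcongr

section Corrector

variable {κ κ' : ℝ → ℝ}

/-- The sum of the components of the corrector. -/
noncomputable def corrSum (κ κ' : ℝ → ℝ) (x : ℝ) : ℝ :=
  -3 * κ x + 2 * (sech x ^ 2 * κ x) + 2 * (Real.tanh x * κ' x) + 4 * (x * (Real.tanh x * sech x ^ 2))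

/-- The difference of the components of the corrector. -/
noncomputable def corrDiff (κ κ' : ℝ → ℝ) (x : ℝ) : ℝ :=
  3 * κ x - 2 * (Real.tanh x * κ' x) + 2 * sech x ^ 2

noncomputable def corrSum' (κ κ' : ℝ → ℝ) (x : ℝ) : ℝ :=
  -3 * κ' x - 4 * (Real.tanh x * sech x ^ 2 * κ x) + 4 * (sech x ^ 2 * κ' x) +
    4 * (Real.tanh x * κ x) + 2 * (Real.tanh x * sech x ^ 2) +
    4 * (x * (3 * (sech x ^ 2) ^ 2 - 2 * sech x ^ 2))

noncomputable def corrDiff' (κ κ' : ℝ → ℝ) (x : ℝ) : ℝ :=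
  3 * κ' x - 2 * (sech x ^ 2 * κ' x) - 4 * (Real.tanh x * κ x) - 2 * (Real.tanh x * sech x ^ 2)

theorem hasDerivAt_corrSum (h1 : ∀ x, HasDerivAt κ (κ' x) x)
    (h2 : ∀ x, HasDerivAt κ' (2 * κ x - sech x ^ 2) x) (x : ℝ) :
    HasDerivAt (corrSum κ κ') (corrSum' κ κ' x) x := by
  refine ((((h1 x).const_mul (-3)).add (((hasDerivAt_sech_sq x).mul (h1 x)).const_mul 2)).add
    (((hasDerivAt_tanh x).mul (h2 x)).const_mul 2) |>.add
    (((hasDerivAt_id x).mul (hasDerivAt_tanh_sech_sq x)).const_mul 4)).congr_deriv ?_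
  simp only [corrSum', id]
  ring

theorem hasDerivAt_corrDiff (h1 : ∀ x, HasDerivAt κ (κ' x) x)
    (h2 : ∀ x, HasDerivAt κ' (2 * κ x - sech x ^ 2) x) (x : ℝ) :
    HasDerivAt (corrDiff κ κ') (corrDiff' κ κ' x) x := by
  refine ((((h1 x).const_mul 3).sub (((hasDerivAt_tanh x).mul (h2 x)).const_mul 2)).add
    ((hasDerivAt_sech_sq x).const_mul 2)).congr_deriv ?_
  simp only [corrDiff']
  ring

/-- With `hasDerivAt_corrDiff'` this verifies that the pair solves the threshold system `L₊ a - b`,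
`L₋ b - a` with source `-V₁ u₀`, written in sum and difference of the components. -/
theorem hasDerivAt_corrSum' (h1 : ∀ x, HasDerivAt κ (κ' x) x)
    (h2 : ∀ x, HasDerivAt κ' (2 * κ x - sech x ^ 2) x) (x : ℝ) :
    HasDerivAt (corrSum' κ κ') (corrSum κ κ' x - corrDiff κ κ' x - 6 * sech x ^ 2 * corrSum κ κ' x -
      (2 * sech x ^ 2 + 3 * q1 x) * (2 - 4 * sech x ^ 2)) x := by
  have d := hasDerivAt_tanh_sech_sq x
  have ds := hasDerivAt_sech_sq x
  refine ((((((h2 x).const_mul (-3)).sub ((d.mul (h1 x)).const_mul 4)).add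
    ((ds.mul (h2 x)).const_mul 4)).add (((hasDerivAt_tanh x).mul (h1 x)).const_mul 4)).add
    (d.const_mul 2) |>.add (((hasDerivAt_id x).mul (((ds.pow 2).const_mul 3).sub
      (ds.const_mul 2))).const_mul 4)).congr_deriv ?_
  simp only [corrSum, corrDiff, q1, id, Pi.sub_apply, Pi.pow_apply]
  push_cast
  ring

theorem hasDerivAt_corrDiff' (h1 : ∀ x, HasDerivAt κ (κ' x) x)
    (h2 : ∀ x, HasDerivAt κ' (2 * κ x - sech x ^ 2) x) (x : ℝ) :
    HasDerivAt (corrDiff' κ κ') (corrDiff κ κ' x - corrSum κ κ' x -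
      2 * sech x ^ 2 * corrDiff κ κ' x - 2 * q1 x) x := by
  have d := hasDerivAt_tanh_sech_sq x
  have ds := hasDerivAt_sech_sq x
  refine (((((h2 x).const_mul 3).sub ((ds.mul (h2 x)).const_mul 2)).sub
    (((hasDerivAt_tanh x).mul (h1 x)).const_mul 4)).sub (d.const_mul 2)).congr_deriv ?_
  simp only [corrSum, corrDiff, q1]
  ring

theorem expDecay_corrSum (h3 : ExpDecay κ) (h4 : ExpDecay κ') : ExpDecay (corrSum κ κ') :=
  (((h3.const_mul _).add ((h3.bdd_mul abs_sech_sq_le).const_mul _)).add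
    ((h4.bdd_mul abs_tanh_le).const_mul _)).add (expDecay_tanh_sech_sq.id_mul.const_mul _)

theorem expDecay_corrDiff (h3 : ExpDecay κ) (h4 : ExpDecay κ') : ExpDecay (corrDiff κ κ') :=
  ((h3.const_mul _).sub ((h4.bdd_mul abs_tanh_le).const_mul _)).add (expDecay_sech_sq.const_mul _)

theorem expDecay_sech_pow_four : ExpDecay fun x => (sech x ^ 2) ^ 2 := by
  simpa only [pow_two (sech _ ^ 2)] using expDecay_sech_sq.mul expDecay_sech_sq

theorem expDecay_corrSum' (h3 : ExpDecay κ) (h4 : ExpDecay κ') : ExpDecay (corrSum' κ κ') :=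
  (((((h4.const_mul _).sub ((expDecay_tanh_sech_sq.mul h3).const_mul _)).add
    ((h4.bdd_mul abs_sech_sq_le).const_mul _)).add ((h3.bdd_mul abs_tanh_le).const_mul _)).add
    (expDecay_tanh_sech_sq.const_mul _)).add
    (((expDecay_sech_pow_four.const_mul _).sub (expDecay_sech_sq.const_mul _)).id_mul.const_mul _)

theorem expDecay_corrDiff' (h3 : ExpDecay κ) (h4 : ExpDecay κ') : ExpDecay (corrDiff' κ κ') :=
  (((h4.const_mul _).sub ((h4.bdd_mul abs_sech_sq_le).const_mul _)).sub
    ((h3.bdd_mul abs_tanh_le).const_mul _)).sub (expDecay_tanh_sech_sq.const_mul _)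

/-- The first order corrector, up to a multiple of `w₀`. -/
noncomputable def corrector (κ κ' : ℝ → ℝ) (x : ℝ) : Vec :=
  act (sqrtAbsV0 x) (cvec ((corrSum κ κ' x + corrDiff κ κ' x) / 2)
    ((corrSum κ κ' x - corrDiff κ κ' x) / 2))

theorem continuous_of_hasDerivAt {f f' : ℝ → ℝ} (h : ∀ x, HasDerivAt f (f' x) x) : Continuous f :=
  continuous_iff_continuousAt.2 fun x => (h x).continuousAt

theorem isL2_corrector (h1 : ∀ x, HasDerivAt κ (κ' x) x)
    (h2 : ∀ x, HasDerivAt κ' (2 * κ x - sech x ^ 2) x) (h3 : ExpDecay κ) (h4 : ExpDecay κ') :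
    IsL2 (corrector κ κ') := by
  obtain ⟨A, hA⟩ := (expDecay_corrSum h3 h4).exists_bound
  obtain ⟨B, hB⟩ := (expDecay_corrDiff h3 h4).exists_bound
  have c1 := continuous_of_hasDerivAt (hasDerivAt_corrSum h1 h2)
  have c2 := continuous_of_hasDerivAt (hasDerivAt_corrDiff h1 h2)
  refine isL2_sqrt_cvec (C := A + B) (by fun_prop) (by fun_prop) (fun x => ?_) (fun x => ?_)
  · have := abs_le.1 (hA x)
    have := abs_le.1 (hB x)
    exact abs_le.2 ⟨by linarith, by linarith⟩
  · have := abs_le.1 (hA x)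
    have := abs_le.1 (hB x)
    exact abs_le.2 ⟨by linarith, by linarith⟩

/-- The corrector decays, so it can be recovered by `R₀` from `V₀ u + V₁ u₀`, which the differential
equations identify with the image of the corrector under `diag(∂ₓ², ∂ₓ² - 2)`. -/
theorem K00_corrector (h1 : ∀ x, HasDerivAt κ (κ' x) x)
    (h2 : ∀ x, HasDerivAt κ' (2 * κ x - sech x ^ 2) x) (h3 : ExpDecay κ) (h4 : ExpDecay κ') :
    K00 (corrector κ κ') + corrector κ κ' = -K01 w0 := by
  have hL := isL2_corrector h1 h2 h3 h4
  have ha := expDecay_corrSum h3 h4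
  have hb := expDecay_corrDiff h3 h4
  have ha' := expDecay_corrSum' h3 h4
  have hb' := expDecay_corrDiff' h3 h4
  have c1 := continuous_of_hasDerivAt (hasDerivAt_corrSum h1 h2)
  have c2 := continuous_of_hasDerivAt (hasDerivAt_corrDiff h1 h2)
  have cs := continuous_sech
  have cq := continuous_q1
  have e1 := expDecay_q1
  have es := expDecay_sech_sq
  have hb0 : ∀ x, |2 - 4 * sech x ^ 2| ≤ 6 := fun x => by
    obtain ⟨h1, h2⟩ := abs_le.1 (abs_sech_sq_le x)
    exact abs_le.2 ⟨by linarith, by linarith⟩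
  obtain ⟨A2, hA2⟩ : ∃ f : ℝ → ℝ, f = fun x => corrSum κ κ' x - corrDiff κ κ' x -
      6 * sech x ^ 2 * corrSum κ κ' x - (2 * sech x ^ 2 + 3 * q1 x) * (2 - 4 * sech x ^ 2) :=
    ⟨_, rfl⟩
  obtain ⟨B2, hB2⟩ : ∃ f : ℝ → ℝ, f = fun x => corrDiff κ κ' x - corrSum κ κ' x -
      2 * sech x ^ 2 * corrDiff κ κ' x - 2 * q1 x := ⟨_, rfl⟩
  have dA : ∀ x, HasDerivAt (corrSum' κ κ') (A2 x) x := fun x => by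
    rw [hA2]; exact hasDerivAt_corrSum' h1 h2 x
  have dB : ∀ x, HasDerivAt (corrDiff' κ κ') (B2 x) x := fun x => by
    rw [hB2]; exact hasDerivAt_corrDiff' h1 h2 x
  have hA2e : ExpDecay A2 := by
    have := ((ha.sub hb).sub ((es.mul ha).const_mul 6)).sub
      (((es.const_mul 2).add (e1.const_mul 3)).bdd_mul hb0)
    rw [hA2]
    convert this using 2 with x
    ring
  have hB2e : ExpDecay B2 := by
    have := ((hb.sub ha).sub ((es.mul hb).const_mul 2)).sub (e1.const_mul 2)
    rw [hB2]
    convert this using 2 with x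
    ring
  have hA2c : Continuous A2 := by rw [hA2]; fun_prop
  have hB2c : Continuous B2 := by rw [hB2]; fun_prop
  ext1 x
  have i1 := sandwich_integrable adm00 hL x
  have i2 := sandwich_integrable adm01 isL2_w0 x
  have hrepr := R0_repr (φ := fun x => 1 / 2 * (corrSum κ κ' x + corrDiff κ κ' x))
    (φ' := fun x => 1 / 2 * (corrSum' κ κ' x + corrDiff' κ κ' x))
    (φ'' := fun x => 1 / 2 * (A2 x + B2 x))
    (ψ := fun x => 1 / 2 * (corrSum κ κ' x - corrDiff κ κ' x))
    (ψ' := fun x => 1 / 2 * (corrSum' κ κ' x - corrDiff' κ κ' x))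
    (ψ'' := fun x => 1 / 2 * (A2 x - B2 x))
    (F := fun y => act (V0 y) (act (sqrtAbsV0 y)⁻¹ (corrector κ κ' y)) +
      act (V1 y) (act (sqrtAbsV0 y)⁻¹ (w0 y)))
    ((ha.add hb).const_mul _) ((ha'.add hb').const_mul _) ((hA2e.add hB2e).const_mul _)
    (by fun_prop)
    (fun x => ((hasDerivAt_corrSum h1 h2 x).add (hasDerivAt_corrDiff h1 h2 x)).const_mul _)
    (fun x => ((dA x).add (dB x)).const_mul _)
    ((ha.sub hb).const_mul _) ((ha'.sub hb').const_mul _) ((hA2e.sub hB2e).const_mul _)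
    (by fun_prop)
    (fun x => ((hasDerivAt_corrSum h1 h2 x).sub (hasDerivAt_corrDiff h1 h2 x)).const_mul _)
    (fun x => ((dA x).sub (dB x)).const_mul _)
    (fun y => by
      rw [corrector, act_inv_sqrt, act_inv_w0, V0_act_cvec, V1_act_cvec, cvec_add]
      simp only [hA2, hB2]
      congr 1 <;> ring) x
    ((i1.add i2).congr (ae_of_all _ fun y => by simp only [Pi.add_apply, act_add]))
  simp only [act_add] at hrepr
  rw [integral_add i1 i2] at hrepr
  have hS : act (sqrtAbsV0 x) (∫ y, act (R0 x y)
      (act (V0 y) (act (sqrtAbsV0 y)⁻¹ (corrector κ κ' y)))) + act (sqrtAbsV0 x) (∫ y, act (R0 x y)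
      (act (V1 y) (act (sqrtAbsV0 y)⁻¹ (w0 y)))) = -corrector κ κ' x := by
    rw [← act_add, hrepr, act_neg, corrector]
    congr 3 <;> ring
  unfold K00 K01
  rw [Pi.add_apply, Pi.neg_apply, sandwich_eq_kint, sandwich_eq_kint, kint_sandwich adm00 hL,
    kint_sandwich adm01 isL2_w0, eq_neg_iff_add_eq_zero]
  rw [add_right_comm, hS, neg_add_cancel]

/-- Both sides solve the equation at order `ε` modulo `v`, so their difference is mapped by `K₀₀ +
1` into the span of `v` and is a multiple of `w₀`. -/
theorem w1_ae_eq (h1 : ∀ x, HasDerivAt κ (κ' x) x)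
    (h2 : ∀ x, HasDerivAt κ' (2 * κ x - sech x ^ 2) x) (h3 : ExpDecay κ) (h4 : ExpDecay κ') :
    ∃ c : ℂ, w1 =ᵐ[volume] corrector κ κ' + c • w0 := by
  obtain ⟨β, hβ⟩ := K00_w1
  have hL := isL2_corrector h1 h2 h3 h4
  have hK := K00_corrector h1 h2 h3 h4
  have h5 : K00 (w1 + (-1 : ℂ) • corrector κ κ') + (w1 + (-1 : ℂ) • corrector κ κ')
      =ᵐ[volume] β • v := by
    rw [K00_add_add isL2_w1 (hL.smul _), K00_smul, ← smul_add, hK]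
    filter_upwards [hβ] with x hx
    rw [Pi.add_apply, hx]
    simp
  refine ⟨β / 2, ?_⟩
  filter_upwards [ae_eq_smul_w0 (isL2_w1.add (hL.smul _)) h5] with x hx
  rw [Pi.add_apply, ← hx]
  simp

/-- The integrand of `8 α₂` is `sech² + sech² κ` up to an exact derivative. -/
theorem integral_alpha2_integrand (h1 : ∀ x, HasDerivAt κ (κ' x) x)
    (h2 : ∀ x, HasDerivAt κ' (2 * κ x - sech x ^ 2) x) (h3 : ExpDecay κ) (h4 : ExpDecay κ') :
    ∫ x, (1 / 2 * ((2 * sech x ^ 2 + 3 * q1 x) * (2 - 4 * sech x ^ 2) * corrSum κ κ' x +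
        2 * q1 x * corrDiff κ κ' x) + 1 / 2 * ((q1 x + 3 * q2 x) * (2 - 4 * sech x ^ 2) *
          (2 - 4 * sech x ^ 2) + 4 * q2 x)) = 2 + ∫ x, sech x ^ 2 * κ x := by
  have es := expDecay_sech_sq
  have em := expDecay_tanh_sech_sq
  have es2 := es.mul es
  have es3 := es.mul es2
  have ems := es.mul em
  have ems2 := es.mul ems
  have ck := continuous_of_hasDerivAt h1
  have hi1 : Integrable fun x => sech x ^ 2 * κ x :=
    (es.mul h3).integrable (continuous_sech_sq.mul ck)
  have hi0 : Integrable fun x => sech x ^ 2 := es.integrable continuous_sech_sq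
  -- A decaying primitive of the integrand minus `sech² + sech² κ`: affine in `κ` and `κ'`, with
  -- coefficients polynomial in `x`, `tanh` and `sech²`. Derivatives of `κ'` are eliminated by `κ''
  -- = 2κ - sech²`.
  have hdec : ExpDecay fun x => (-4 * (x * (sech x ^ 2 * sech x ^ 2)) +
      6 * (x * (sech x ^ 2 * (sech x ^ 2 * sech x ^ 2))) -
      4 * (x * (x * (Real.tanh x * sech x ^ 2))) +
      12 * (x * (x * (sech x ^ 2 * (Real.tanh x * sech x ^ 2)))) -
      12 * (x * (x * (sech x ^ 2 * (sech x ^ 2 * (Real.tanh x * sech x ^ 2)))))) +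
      (2 * (Real.tanh x * sech x ^ 2) - 2 * (sech x ^ 2 * (Real.tanh x * sech x ^ 2)) -
        4 * (x * sech x ^ 2) + 10 * (x * (sech x ^ 2 * sech x ^ 2)) -
        4 * (x * (sech x ^ 2 * (sech x ^ 2 * sech x ^ 2)))) * κ x +
      (-1 * sech x ^ 2 + 2 * (sech x ^ 2 * sech x ^ 2) + 2 * (x * (Real.tanh x * sech x ^ 2)) -
        4 * (x * (sech x ^ 2 * (Real.tanh x * sech x ^ 2)))) * κ' x :=
    ((((((es2.id_mul.const_mul _).add (es3.id_mul.const_mul _)).sub (em.id_mul.id_mul.const_mul _)).add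
      (ems.id_mul.id_mul.const_mul _)).sub (ems2.id_mul.id_mul.const_mul _)).add
      ((((((em.const_mul _).sub (ems.const_mul _)).sub (es.id_mul.const_mul _)).add
        (es2.id_mul.const_mul _)).sub (es3.id_mul.const_mul _)).mul h3)).add
      (((((es.const_mul _).add (es2.const_mul _)).add (em.id_mul.const_mul _)).sub
        (ems.id_mul.const_mul _)).mul h4)
  have hder := fun x => by
    have ds := hasDerivAt_sech_sq x
    have dm := hasDerivAt_tanh_sech_sq x
    have di := hasDerivAt_id x
    have ds2 := ds.mul ds
    have ds3 := ds.mul ds2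
    have dms := ds.mul dm
    have dms2 := ds.mul dms
    exact (((((((di.mul ds2).const_mul (-4)).add ((di.mul ds3).const_mul 6)).sub
      ((di.mul (di.mul dm)).const_mul 4)).add ((di.mul (di.mul dms)).const_mul 12)).sub
      ((di.mul (di.mul dms2)).const_mul 12)).add
      ((((((dm.const_mul 2).sub (dms.const_mul 2)).sub ((di.mul ds).const_mul 4)).add
        ((di.mul ds2).const_mul 10)).sub ((di.mul ds3).const_mul 4)).mul (h1 x))).add
      (((((ds.const_mul (-1)).add (ds2.const_mul 2)).add ((di.mul dm).const_mul 2)).sub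
        ((di.mul dms).const_mul 4)).mul (h2 x))
  have hb0 : ∀ x, |2 - 4 * sech x ^ 2| ≤ 6 := fun x => by
    obtain ⟨h1, h2⟩ := abs_le.1 (abs_sech_sq_le x)
    exact abs_le.2 ⟨by linarith, by linarith⟩
  have hF : Integrable fun x => 1 / 2 * ((2 * sech x ^ 2 + 3 * q1 x) * (2 - 4 * sech x ^ 2) *
      corrSum κ κ' x + 2 * q1 x * corrDiff κ κ' x) + 1 / 2 * ((q1 x + 3 * q2 x) *
        (2 - 4 * sech x ^ 2) * (2 - 4 * sech x ^ 2) + 4 * q2 x) := by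
    have e1 := expDecay_q1
    have e2 := expDecay_q2
    have c1 := continuous_of_hasDerivAt (hasDerivAt_corrSum h1 h2)
    have c2 := continuous_of_hasDerivAt (hasDerivAt_corrDiff h1 h2)
    have := continuous_sech
    have := continuous_q1
    have := continuous_q2
    have g := ((((((es.const_mul 2).add (e1.const_mul 3)).bdd_mul hb0).mul
      (expDecay_corrSum h3 h4)).add ((e1.const_mul 2).mul (expDecay_corrDiff h3 h4))).const_mul
      (1 / 2)).add ((((((e1.add (e2.const_mul 3)).bdd_mul hb0).bdd_mul hb0)).add
        (e2.const_mul 4)).const_mul (1 / 2))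
    refine (g.integrable (by fun_prop)).congr (ae_of_all _ fun y => ?_)
    simp only; ring
  have key := hdec.integral_deriv_eq_zero (f' := fun x => (1 / 2 * ((2 * sech x ^ 2 + 3 * q1 x) *
      (2 - 4 * sech x ^ 2) * corrSum κ κ' x + 2 * q1 x * corrDiff κ κ' x) + 1 / 2 *
        ((q1 x + 3 * q2 x) * (2 - 4 * sech x ^ 2) * (2 - 4 * sech x ^ 2) + 4 * q2 x)) -
      (sech x ^ 2 + sech x ^ 2 * κ x)) (fun x => ?_) (hF.sub (hi0.add hi1))
  · have h5 := integral_sub hF (hi0.add hi1)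
    simp only [Pi.add_apply] at h5
    rw [h5, integral_add hi0 hi1, integral_sech_sq, sub_eq_zero] at key
    exact key
  · refine (hder x).congr_deriv ?_
    have ht := tanh_sq x
    rw [q2_eq]
    simp only [corrSum, corrDiff, q1, Pi.mul_apply, Pi.add_apply, Pi.sub_apply, id]
    linear_combination (-24 * x ^ 2 * (sech x ^ 2) ^ 2 + 48 * x ^ 2 * (sech x ^ 2) ^ 3 +
      4 * (sech x ^ 2) ^ 2 * κ x + 8 * x * (sech x ^ 2) ^ 2 * κ' x +
      3 * x * sech x ^ 2 * (2 - 4 * sech x ^ 2) * (2 * κ' x + 4 * x * sech x ^ 2) -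
      4 * x * sech x ^ 2 * κ' x) * ht

/-- `w₁` may be replaced by the explicit corrector, because the omitted multiple of `w₀` is
invisible to `⟨V₁ u₀, ·⟩`. Everything left is a real integral. -/
theorem eight_mul_alpha2Quotient : ∃ κ κ' : ℝ → ℝ, ((∀ x, HasDerivAt κ (κ' x) x) ∧
    (∀ x, HasDerivAt κ' (2 * κ x - sech x ^ 2) x) ∧ ExpDecay κ ∧ ExpDecay κ' ∧ ∀ x, 0 ≤ κ x) ∧
    alpha2Quotient = (((2 + ∫ x, sech x ^ 2 * κ x) / 8 : ℝ) : ℂ) := by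
  obtain ⟨κ, κ', hκ⟩ := exists_potential_sech_sq
  refine ⟨κ, κ', hκ, ?_⟩
  obtain ⟨h1, h2, h3, h4, -⟩ := hκ
  obtain ⟨c, hc⟩ := w1_ae_eq h1 h2 h3 h4
  have hL := isL2_corrector h1 h2 h3 h4
  have l1 := isL2_sourceVec potBound_V1
  have i1 := integrable_inner l1 hL
  have i2 := integrable_inner (isL2_sourceVec potBound_V2) isL2_w0
  have e3 : ip (sourceVec V1) w1 = ip (sourceVec V1) (corrector κ κ') := by
    rw [ip_congr EventuallyEq.rfl hc, ip_add hL (isL2_w0.smul c) l1, ip_smul, ip_sourceVec_V1_w0,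
      mul_zero, add_zero]
  rw [alpha2Quotient_eq, e3, ip, ip, ← integral_add i1 i2]
  have e : ∀ x, inner ℂ (sourceVec V1 x) (corrector κ κ' x) + inner ℂ (sourceVec V2 x) (w0 x) =
      ((-(1 / 2 * ((2 * sech x ^ 2 + 3 * q1 x) * (2 - 4 * sech x ^ 2) * corrSum κ κ' x +
        2 * q1 x * corrDiff κ κ' x) + 1 / 2 * ((q1 x + 3 * q2 x) * (2 - 4 * sech x ^ 2) *
          (2 - 4 * sech x ^ 2) + 4 * q2 x)) : ℝ) : ℂ) := fun x => by
    rw [corrector, w0_eq, inner_sourceVec_V1, inner_sourceVec_V2, ← Complex.ofReal_add]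
    congr 1; ring
  simp only [e]
  rw [integral_complex_ofReal, integral_neg, integral_alpha2_integrand h1 h2 h3 h4]
  push_cast; ring

end Corrector

theorem alpha2_real_pos : alpha2Quotient = (alpha2 : ℂ) ∧ 0 < alpha2 := by
  obtain ⟨κ, κ', ⟨-, -, -, -, h5⟩, h⟩ := eight_mul_alpha2Quotient
  have h6 : alpha2 = (2 + ∫ x, sech x ^ 2 * κ x) / 8 := by rw [alpha2, h, Complex.ofReal_re]
  refine ⟨by rw [h6, h], ?_⟩
  have : 0 ≤ ∫ x, sech x ^ 2 * κ x := integral_nonneg fun x => mul_nonneg (sq_nonneg _) (h5 x)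
  rw [h6]; positivity

/-! ### The scalar bifurcation equation, its root, and its application to the Birman–Schwinger
family. -/

/-! ### An abstract edge bifurcation -/

section Abstract

variable {H : Type*} [NormedAddCommGroup H] [NormedSpace ℂ H] [CompleteSpace H]

/-- Perturbation of an invertible operator, with a bound for the inverse. -/
theorem isUnit_of_near {B A : H →L[ℂ] H} {D : H →L[ℂ] H} (h1 : D * B = 1) (h2 : B * D = 1)
    (hA : ‖D‖ * ‖A - B‖ ≤ 1 / 2) : IsUnit A ∧ ∀ f, ‖f‖ ≤ 2 * ‖D‖ * ‖A f‖ := by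
  have hB : IsUnit B := ⟨⟨B, D, h2, h1⟩, rfl⟩
  constructor
  · have h3 : A = B * (1 - (-(D * (A - B)))) := by
      rw [sub_neg_eq_add, mul_add, ← mul_assoc, h2]; simp
    rw [h3]
    refine hB.mul (isUnit_one_sub_of_norm_lt_one ?_)
    rw [norm_neg]
    exact ((norm_mul_le _ _).trans hA).trans_lt (by norm_num)
  · intro f
    have h4 : f = D (A f) - D ((A - B) f) := by
      rw [sub_apply, map_sub, sub_sub_cancel, ← mul_apply_eq_comp, h1, one_apply_eq_self]
    have h5 : ‖D (A f)‖ ≤ ‖D‖ * ‖A f‖ := D.le_opNorm _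
    have h6 : ‖D ((A - B) f)‖ ≤ ‖D‖ * ‖A - B‖ * ‖f‖ := by
      refine (D.le_opNorm _).trans ?_
      rw [mul_assoc]
      gcongr
      exact (A - B).le_opNorm f
    have h7 : ‖f‖ ≤ ‖D (A f)‖ + ‖D ((A - B) f)‖ := by
      conv_lhs => rw [h4]
      exact norm_sub_le _ _
    have h8 := mul_le_mul_of_nonneg_right hA (norm_nonneg f)
    linarith

-- Where `A` is invertible, a solution of `A x + α⁻¹ ℓ(x) v = 0` must be a multiple of `A⁻¹ v`, and
-- a nonzero one exists exactly when `α + ℓ(A⁻¹ v) = 0`. The approximate solution `w₀ + ε w₁ + ε²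
-- w₂` evaluates this scalar function up to `O(|ε|³)`, and its sign change gives a root. No
-- smoothness in `ε` is used, and in `α` only continuity.
set_option maxHeartbeats 2000000 in
theorem exists_edge_bifurcation {B T01 T02 T10 : H →L[ℂ] H} {v w0 w1 w2 : H}
    {ℓ0 ℓ1 ℓ2 : H →L[ℂ] ℂ} {β1 β2 : ℂ} {a2 M δ : ℝ} (hδ : 0 < δ) (hM : 0 ≤ M)
    (hB : IsUnit B) (hv : v ≠ 0) (ha2 : 0 < a2)
    (e0 : B w0 = (2 : ℂ) • v) (e1 : B w1 + T01 w0 = β1 • v)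
    (e2 : B w2 + T01 w1 + T02 w0 = β2 • v) (e10 : T10 w0 = (-2 : ℂ) • v)
    (l0 : ℓ0 w0 = 0) (l1 : ℓ0 w1 + ℓ1 w0 = 0) (l2 : ℓ0 w2 + ℓ1 w1 + ℓ2 w0 = -2 * a2)
    {A : ℝ → ℝ → H →L[ℂ] H} {ℓ : ℝ → H →L[ℂ] ℂ}
    (hA : ∀ α ε : ℝ, 0 < α → α ≤ 1 → |ε| ≤ δ →
      ‖A α ε - (B + (ε : ℂ) • T01 + (ε ^ 2 : ℂ) • T02 + (α : ℂ) • T10)‖ ≤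
        M * (|ε| ^ 3 + α * |ε| + α ^ 2))
    (hℓ : ∀ ε : ℝ, |ε| ≤ δ → ‖ℓ ε - (ℓ0 + (ε : ℂ) • ℓ1 + (ε ^ 2 : ℂ) • ℓ2)‖ ≤ M * |ε| ^ 3)
    (hc : ∀ ε : ℝ, |ε| ≤ δ → ContinuousOn (fun α => A α ε) (Set.Ioc 0 1))
    (hreal : ∀ α ε : ℝ, 0 < α → α ≤ 1 → |ε| ≤ δ → IsUnit (A α ε) → ∀ x, A α ε x = v →
      (ℓ ε x).im = 0) :
    ∃ ε₀ : ℝ, 0 < ε₀ ∧ ε₀ ≤ δ ∧ ∃ C : ℝ, 0 < C ∧ ∀ ε : ℝ, ε ≠ 0 → |ε| ≤ ε₀ →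
      ∃ (α : ℝ) (x : H), 0 < α ∧ α ≤ 1 ∧ α ≤ 2 * a2 * ε ^ 2 ∧ |α - ε ^ 2 * a2| < C * |ε| ^ 3 ∧
        A α ε x + ((α : ℂ)⁻¹ * ℓ ε x) • v = 0 ∧ x ≠ 0 ∧
        ‖x - (w0 + (ε : ℂ) • w1 + (ε ^ 2 : ℂ) • w2)‖ < C * |ε| ^ 3 := by
  obtain ⟨u, rfl⟩ := hB
  obtain ⟨D, hD1, hD2⟩ : ∃ D : H →L[ℂ] H, D * u = 1 ∧ u * D = 1 :=
    ⟨(u⁻¹ : (H →L[ℂ] H)ˣ), u.inv_mul, u.mul_inv⟩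
  generalize hBu : (u : H →L[ℂ] H) = B at *
  -- constants
  obtain ⟨m, hm⟩ : ∃ m, m = M * (1 + 2 * a2 + 4 * a2 ^ 2) := ⟨_, rfl⟩
  have hm0 : 0 ≤ m := hm ▸ by positivity
  obtain ⟨K1, hK1⟩ : ∃ K, K = ‖T01‖ + ‖T02‖ + 2 * a2 * ‖T10‖ + m := ⟨_, rfl⟩
  have hK10 : 0 ≤ K1 := hK1 ▸ by positivity
  obtain ⟨K2, hK2⟩ : ∃ K, K = ‖T01 w2‖ + ‖T02 w1‖ + ‖T02 w2‖ + 2 * a2 * ‖T10 w1‖ +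
    2 * a2 * ‖T10 w2‖ + m * (‖w0‖ + ‖w1‖ + ‖w2‖) := ⟨_, rfl⟩
  have hK20 : 0 ≤ K2 := hK2 ▸ by positivity
  obtain ⟨K3, hK3⟩ : ∃ K, K = ‖ℓ1 w2‖ + ‖ℓ2 w1‖ + ‖ℓ2 w2‖ + M * (‖w0‖ + ‖w1‖ + ‖w2‖) := ⟨_, rfl⟩
  have hK30 : 0 ≤ K3 := hK3 ▸ by positivity
  obtain ⟨K4, hK4⟩ : ∃ K, K = ‖ℓ0‖ + ‖ℓ1‖ + ‖ℓ2‖ + M := ⟨_, rfl⟩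
  have hK40 : 0 ≤ K4 := hK4 ▸ by positivity
  obtain ⟨K5, hK5⟩ : ∃ K, K = ‖β1‖ + ‖β2‖ + 4 * a2 := ⟨_, rfl⟩
  have hK50 : 0 ≤ K5 := hK5 ▸ by positivity
  obtain ⟨K6, hK6⟩ : ∃ K, K = K3 + K4 * (2 * ‖D‖ * K2) + 2 * a2 * K5 := ⟨_, rfl⟩
  have hK60 : 0 ≤ K6 := hK6 ▸ by positivity
  obtain ⟨C0, hC0⟩ : ∃ C, C = K6 + 1 := ⟨_, rfl⟩
  have hC00 : 0 < C0 := hC0 ▸ by positivity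
  -- smallness
  obtain ⟨ε₀, hε₀, hεδ, hε1, hεa, hεC, hεK5, hεD⟩ : ∃ ε₀ : ℝ, 0 < ε₀ ∧ ε₀ ≤ δ ∧ ε₀ ≤ 1 ∧
      2 * a2 * ε₀ ≤ 1 ∧ C0 * ε₀ ≤ a2 / 2 ∧ K5 * ε₀ ≤ 1 ∧ ‖D‖ * (K1 * ε₀) ≤ 1 / 2 := by
    have ev : ∀ k b : ℝ, 0 < b → ∀ᶠ e in 𝓝[>] (0 : ℝ), k * e ≤ b := fun k b hb => by
      have : Tendsto (fun e : ℝ => k * e) (𝓝[>] 0) (𝓝 (k * 0)) :=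
        ((continuous_const.mul continuous_id).tendsto 0).mono_left nhdsWithin_le_nhds
      rw [mul_zero] at this
      exact (this.eventually (gt_mem_nhds hb)).mono fun _ h => h.le
    have hs : ∀ᶠ e : ℝ in 𝓝[>] 0, 0 < e := eventually_mem_nhdsWithin
    obtain ⟨e, g1, g2, g3, g4, g5, g6, g7⟩ := (hs.and <| (ev 1 δ hδ).and <| (ev 1 1 one_pos).and <|
      (ev (2 * a2) 1 one_pos).and <| (ev C0 (a2 / 2) (by positivity)).and <|
      (ev K5 1 one_pos).and <| ev (‖D‖ * K1) (1 / 2) (by norm_num)).exists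
    exact ⟨e, g1, by linarith, by linarith, g4, g5, g6, by linarith⟩
  refine ⟨ε₀, hε₀, hεδ, C0 + 2 * ‖D‖ * K2 + 1, by positivity, fun ε hε0 hε => ?_⟩
  obtain ⟨e, he⟩ : ∃ e, e = |ε| := ⟨_, rfl⟩
  have he0 : 0 < e := he ▸ abs_pos.2 hε0
  have heε : e ≤ ε₀ := he ▸ hε
  have he1 : e ≤ 1 := heε.trans hε1
  have heδ : |ε| ≤ δ := hε.trans hεδ
  have hsq : ε ^ 2 = e ^ 2 := by rw [he, sq_abs]
  have hεn : ‖(ε : ℂ)‖ = e := by rw [Complex.norm_real, Real.norm_eq_abs, he]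
  have he3 : 0 < e ^ 3 := by positivity
  have he32 : e ^ 3 ≤ e ^ 2 := pow_le_pow_of_le_one he0.le he1 (by norm_num)
  have he21 : e ^ 2 ≤ e := by simpa using pow_le_pow_of_le_one he0.le he1 one_le_two
  have he43 : e ^ 4 ≤ e ^ 3 := pow_le_pow_of_le_one he0.le he1 (by norm_num)
  obtain ⟨W, hW⟩ : ∃ W, W = w0 + (ε : ℂ) • w1 + (ε ^ 2 : ℂ) • w2 := ⟨_, rfl⟩
  have hWn : ‖W‖ ≤ ‖w0‖ + ‖w1‖ + ‖w2‖ := by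
    have h1 : ‖(ε : ℂ) • w1‖ ≤ ‖w1‖ := by
      rw [norm_smul, hεn]; exact mul_le_of_le_one_left (norm_nonneg _) he1
    have h2 : ‖(ε ^ 2 : ℂ) • w2‖ ≤ ‖w2‖ := by
      rw [norm_smul, norm_pow, hεn]
      exact mul_le_of_le_one_left (norm_nonneg _) (he21.trans he1)
    rw [hW]
    exact (norm_add₃_le).trans (by linarith)
  -- the functional on the approximate solution
  have hℓW : ‖ℓ ε W + 2 * ε ^ 2 * a2‖ ≤ K3 * e ^ 3 := by
    have h1 : ℓ ε W + 2 * ε ^ 2 * a2 =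
        (ℓ ε - (ℓ0 + (ε : ℂ) • ℓ1 + (ε ^ 2 : ℂ) • ℓ2)) W +
          ((ε : ℂ) ^ 3 * (ℓ1 w2) + (ε : ℂ) ^ 3 * (ℓ2 w1) + (ε : ℂ) ^ 4 * ℓ2 w2) := by
      simp only [hW, sub_apply, add_apply, smul_apply, map_add, map_smul, smul_eq_mul]
      linear_combination l0 + (ε : ℂ) * l1 + (ε : ℂ) ^ 2 * l2
    rw [h1]
    refine (norm_add_le _ _).trans ?_
    have h2 : ‖(ℓ ε - (ℓ0 + (ε : ℂ) • ℓ1 + (ε ^ 2 : ℂ) • ℓ2)) W‖ ≤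
        M * e ^ 3 * (‖w0‖ + ‖w1‖ + ‖w2‖) := by
      refine (ContinuousLinearMap.le_opNorm _ _).trans ?_
      have := hℓ ε heδ
      rw [← he] at this
      gcongr
    have h3 : ‖(ε : ℂ) ^ 3 * (ℓ1 w2) + (ε : ℂ) ^ 3 * (ℓ2 w1) + (ε : ℂ) ^ 4 * ℓ2 w2‖ ≤
        e ^ 3 * ‖ℓ1 w2‖ + e ^ 3 * ‖ℓ2 w1‖ + e ^ 3 * ‖ℓ2 w2‖ := by
      refine norm_add₃_le.trans ?_
      simp only [norm_mul, norm_pow, hεn]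
      gcongr
    rw [hK3]
    linarith
  have hℓn : ‖ℓ ε‖ ≤ K4 := by
    have h1 : ℓ ε = (ℓ ε - (ℓ0 + (ε : ℂ) • ℓ1 + (ε ^ 2 : ℂ) • ℓ2)) +
        (ℓ0 + (ε : ℂ) • ℓ1 + (ε ^ 2 : ℂ) • ℓ2) := by abel
    have h2 := hℓ ε heδ
    rw [← he] at h2
    have h3 : ‖(ε : ℂ) • ℓ1‖ ≤ ‖ℓ1‖ := by
      rw [norm_smul, hεn]; exact mul_le_of_le_one_left (norm_nonneg _) he1
    have h4 : ‖(ε ^ 2 : ℂ) • ℓ2‖ ≤ ‖ℓ2‖ := by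
      rw [norm_smul, norm_pow, hεn]
      exact mul_le_of_le_one_left (norm_nonneg _) (he21.trans he1)
    have h5 : M * e ^ 3 ≤ M := mul_le_of_le_one_right hM (he32.trans (he21.trans he1))
    rw [h1]
    refine (norm_add_le _ _).trans ?_
    have := norm_add₃_le (a := ℓ0) (b := (ε : ℂ) • ℓ1) (c := (ε ^ 2 : ℂ) • ℓ2)
    rw [hK4]
    linarith
  -- uniform estimates for admissible `α`
  have key : ∀ α : ℝ, 0 < α → α ≤ 2 * a2 * e ^ 2 → IsUnit (A α ε) ∧ ∃ β : ℂ, 1 ≤ β.re ∧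
      ∀ y, A α ε y = v → ‖β • y - W‖ ≤ 2 * ‖D‖ * K2 * e ^ 3 ∧
        |β.re * (α + ℓ ε y).re - 2 * (α - ε ^ 2 * a2)| ≤ K6 * e ^ 3 := by
    intro α hα hαe
    have hα1 : α ≤ 1 := by
      have : 2 * a2 * e ^ 2 ≤ 2 * a2 * e := by gcongr
      have : 2 * a2 * e ≤ 2 * a2 * ε₀ := by gcongr
      linarith
    obtain ⟨E, hE⟩ : ∃ E, E = A α ε - (B + (ε : ℂ) • T01 + (ε ^ 2 : ℂ) • T02 + (α : ℂ) • T10) :=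
      ⟨_, rfl⟩
    have hAE : A α ε = B + (ε : ℂ) • T01 + (ε ^ 2 : ℂ) • T02 + (α : ℂ) • T10 + E := by
      rw [hE]; abel
    have hαn : ‖(α : ℂ)‖ = α := by rw [Complex.norm_real, Real.norm_of_nonneg hα.le]
    have hEn : ‖E‖ ≤ m * e ^ 3 := by
      have h1 := hA α ε hα hα1 heδ
      rw [← hE, ← he] at h1
      have h2 : e ^ 3 + α * e + α ^ 2 ≤ (1 + 2 * a2 + 4 * a2 ^ 2) * e ^ 3 := by
        have h3 : α * e ≤ 2 * a2 * e ^ 2 * e := by gcongr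
        have h4 : α ^ 2 ≤ (2 * a2 * e ^ 2) ^ 2 := by gcongr
        have h5 : (2 * a2 * e ^ 2) ^ 2 = 4 * a2 ^ 2 * e ^ 4 := by ring
        have h6 : 4 * a2 ^ 2 * e ^ 4 ≤ 4 * a2 ^ 2 * e ^ 3 := by gcongr
        linarith
      calc ‖E‖ ≤ _ := h1
        _ ≤ M * ((1 + 2 * a2 + 4 * a2 ^ 2) * e ^ 3) := by gcongr
        _ = _ := by rw [hm]; ring
    have hAB : ‖A α ε - B‖ ≤ K1 * e := by
      have h1 : A α ε - B = ((ε : ℂ) • T01 + (ε ^ 2 : ℂ) • T02 + (α : ℂ) • T10) + E := by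
        rw [hAE]; abel
      rw [h1]
      refine (norm_add_le _ _).trans ?_
      have h2 := norm_add₃_le (a := (ε : ℂ) • T01) (b := (ε ^ 2 : ℂ) • T02) (c := (α : ℂ) • T10)
      rw [norm_smul, norm_smul, norm_smul, hεn, norm_pow, hεn, hαn] at h2
      have h3 : e ^ 2 * ‖T02‖ ≤ e * ‖T02‖ := by gcongr
      have h4 : α * ‖T10‖ ≤ 2 * a2 * e * ‖T10‖ := by
        gcongr
        exact hαe.trans (by gcongr)
      have h5 : m * e ^ 3 ≤ m * e := by
        have := he32.trans he21
        gcongr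
      rw [hK1]
      linarith
    obtain ⟨hu, hinv⟩ := isUnit_of_near hD1 hD2 (A := A α ε) <| by
      calc ‖D‖ * ‖A α ε - B‖ ≤ ‖D‖ * (K1 * ε₀) := by
            gcongr
            exact hAB.trans (by gcongr)
        _ ≤ _ := hεD
    -- Apart from the `2v` of order zero, these are the multiples of `v` left over by the equations
    -- for `w₁`, `w₂` and by `α T₁₀ w₀`.
    obtain ⟨η, hη⟩ : ∃ η : ℂ, η = ε * β1 + ε ^ 2 * β2 - 2 * α := ⟨_, rfl⟩
    have hηn : ‖η‖ ≤ K5 * e := by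
      rw [hη]
      refine (norm_sub_le _ _).trans ?_
      have h1 := norm_add_le ((ε : ℂ) * β1) ((ε : ℂ) ^ 2 * β2)
      rw [norm_mul, norm_mul, norm_pow, hεn] at h1
      have h2 : ‖(2 * α : ℂ)‖ = 2 * α := by rw [norm_mul, hαn]; norm_num
      have h3 : e ^ 2 * ‖β2‖ ≤ e * ‖β2‖ := by gcongr
      have h4 : α ≤ 2 * a2 * e := hαe.trans (by gcongr)
      rw [hK5]
      linarith
    have hAW : ‖A α ε W - (2 + η) • v‖ ≤ K2 * e ^ 3 := by
      have h1 : A α ε W - (2 + η) • v = ((ε : ℂ) ^ 3 • T01 w2 + (ε : ℂ) ^ 3 • T02 w1 +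
          (ε : ℂ) ^ 4 • T02 w2) + (((α * ε : ℂ) • T10 w1 + (α * ε ^ 2 : ℂ) • T10 w2) + E W) := by
        have e1' : B w1 = β1 • v - T01 w0 := eq_sub_of_add_eq e1
        have e2' : B w2 = β2 • v - T01 w1 - T02 w0 := by rw [← e2]; abel
        rw [hAE]
        simp only [add_apply, smul_apply]
        have h2 : B W = (2 : ℂ) • v + (ε : ℂ) • (β1 • v - T01 w0) +
            (ε ^ 2 : ℂ) • (β2 • v - T01 w1 - T02 w0) := by
          rw [hW, map_add, map_add, map_smul, map_smul, e0, e1', e2']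
        have h3 : T01 W = T01 w0 + (ε : ℂ) • T01 w1 + (ε ^ 2 : ℂ) • T01 w2 := by
          rw [hW, map_add, map_add, map_smul, map_smul]
        have h4 : T02 W = T02 w0 + (ε : ℂ) • T02 w1 + (ε ^ 2 : ℂ) • T02 w2 := by
          rw [hW, map_add, map_add, map_smul, map_smul]
        have h5 : T10 W = (-2 : ℂ) • v + (ε : ℂ) • T10 w1 + (ε ^ 2 : ℂ) • T10 w2 := by
          rw [hW, map_add, map_add, map_smul, map_smul, e10]
        rw [h2, h3, h4, h5, hη]
        module
      rw [h1]
      refine (norm_add_le _ _).trans ?_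
      have h2 := norm_add₃_le (a := (ε : ℂ) ^ 3 • T01 w2) (b := (ε : ℂ) ^ 3 • T02 w1)
        (c := (ε : ℂ) ^ 4 • T02 w2)
      have h3 := norm_add₃_le (a := (α * ε : ℂ) • T10 w1) (b := (α * ε ^ 2 : ℂ) • T10 w2) (c := E W)
      simp only [norm_smul, norm_mul, norm_pow, hεn, hαn] at h2 h3
      have h4 : e ^ 4 * ‖T02 w2‖ ≤ e ^ 3 * ‖T02 w2‖ := by gcongr
      have h5 : α * e * ‖T10 w1‖ ≤ 2 * a2 * e ^ 3 * ‖T10 w1‖ := by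
        refine mul_le_mul_of_nonneg_right ?_ (norm_nonneg _)
        calc α * e ≤ 2 * a2 * e ^ 2 * e := by gcongr
          _ = _ := by ring
      have h6 : α * e ^ 2 * ‖T10 w2‖ ≤ 2 * a2 * e ^ 3 * ‖T10 w2‖ := by
        refine mul_le_mul_of_nonneg_right ?_ (norm_nonneg _)
        calc α * e ^ 2 ≤ 2 * a2 * e ^ 2 * e := by gcongr
          _ = _ := by ring
      have h7 : ‖E W‖ ≤ m * e ^ 3 * (‖w0‖ + ‖w1‖ + ‖w2‖) :=
        (E.le_opNorm W).trans (by gcongr)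
      rw [hK2]
      linarith
    refine ⟨hu, 2 + η, ?_, fun y hy => ?_⟩
    · have h1 := (Complex.abs_re_le_norm η).trans hηn
      have h2 : K5 * e ≤ K5 * ε₀ := by gcongr
      have h3 := (abs_le.1 h1).1
      rw [Complex.add_re, Complex.re_ofNat]
      linarith
    · have h1 : ‖(2 + η) • y - W‖ ≤ 2 * ‖D‖ * K2 * e ^ 3 := by
        refine (hinv _).trans ?_
        rw [map_sub, map_smul, hy, norm_sub_rev]
        calc _ ≤ 2 * ‖D‖ * (K2 * e ^ 3) := by gcongr
          _ = _ := by ring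
      refine ⟨h1, ?_⟩
      have him := hreal α ε hα hα1 heδ hu y hy
      -- Since `α + ℓ(y)` is real, the real factor may be replaced by the complex one. Then `(2 + η)
      -- ℓ(y)` is `ℓ(W)` plus an error, and `ηα` is already of third order.
      have h2 : (2 + η).re * (α + ℓ ε y).re - 2 * (α - ε ^ 2 * a2) =
          ((ℓ ε ((2 + η) • y - W) + (ℓ ε W + 2 * ε ^ 2 * a2)) + η * α).re := by
        have h3 : (2 + η).re * (α + ℓ ε y).re = ((2 + η) * (α + ℓ ε y)).re := by
          rw [Complex.mul_re, Complex.add_im (α : ℂ), him]; simp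
        have h4 : (2 * (α - ε ^ 2 * a2) : ℝ) = ((2 * (α - ε ^ 2 * a2) : ℝ) : ℂ).re := rfl
        rw [h3, h4, ← Complex.sub_re]
        congr 1
        rw [map_sub, map_smul, smul_eq_mul]
        push_cast
        ring
      rw [h2]
      refine (Complex.abs_re_le_norm _).trans (norm_add₃_le.trans ?_)
      have h5 : ‖ℓ ε ((2 + η) • y - W)‖ ≤ K4 * (2 * ‖D‖ * K2 * e ^ 3) :=
        ((ℓ ε).le_opNorm _).trans (by gcongr)
      have h6 : ‖η * α‖ ≤ K5 * e * (2 * a2 * e ^ 2) := by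
        rw [norm_mul, hαn]; gcongr
      rw [hK6]
      linarith
  -- the intermediate value theorem
  have hC0e : C0 * e ^ 3 ≤ a2 / 2 * e ^ 2 := by
    have : C0 * e ≤ a2 / 2 := (by gcongr : C0 * e ≤ C0 * ε₀).trans hεC
    calc C0 * e ^ 3 = C0 * e * e ^ 2 := by ring
      _ ≤ _ := by gcongr
  have hae : 0 < a2 * e ^ 2 := by positivity
  -- At distance `C₀ |ε|³` from `ε² a₂` the main term `2 (α - ε² a₂)` exceeds the error `K₆ |ε|³`,
  -- because `C₀ = K₆ + 1`; so the signs at the endpoints are known.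
  obtain ⟨p, hp⟩ : ∃ p, p = ε ^ 2 * a2 - C0 * e ^ 3 := ⟨_, rfl⟩
  obtain ⟨q, hq⟩ : ∃ q, q = ε ^ 2 * a2 + C0 * e ^ 3 := ⟨_, rfl⟩
  have hC0e' : 0 < C0 * e ^ 3 := by positivity
  have hpq : p ≤ q := by linarith
  have hpp : 0 < p := by rw [hp, hsq]; linarith
  have hqq : q ≤ 2 * a2 * e ^ 2 := by rw [hq, hsq]; linarith
  have hq1 : q ≤ 1 := by
    have : 2 * a2 * e ^ 2 ≤ 2 * a2 * e := by gcongr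
    have : 2 * a2 * e ≤ 2 * a2 * ε₀ := by gcongr
    linarith
  have hIcc : ∀ α ∈ Set.Icc p q, 0 < α ∧ α ≤ 2 * a2 * e ^ 2 := fun α h =>
    ⟨hpp.trans_le h.1, h.2.trans hqq⟩
  obtain ⟨Φ, hΦ⟩ : ∃ Φ : ℝ → ℝ, Φ = fun α => (α + ℓ ε (Ring.inverse (A α ε) v)).re := ⟨_, rfl⟩
  have hinv : ∀ α ∈ Set.Icc p q, A α ε (Ring.inverse (A α ε) v) = v := fun α h => by
    have hu := (key α (hIcc α h).1 (hIcc α h).2).1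
    rw [← mul_apply_eq_comp, Ring.mul_inverse_cancel _ hu, one_apply_eq_self]
  have hcont : ContinuousOn Φ (Set.Icc p q) := by
    have h1 : ContinuousOn (fun α => Ring.inverse (A α ε)) (Set.Icc p q) := fun α h => by
      obtain ⟨U, hU⟩ := (key α (hIcc α h).1 (hIcc α h).2).1
      have h2 := (hc ε heδ).mono (s := Set.Ioc 0 1) (t := Set.Icc p q)
        (fun a ha => ⟨hpp.trans_le ha.1, ha.2.trans hq1⟩) α h
      have h3 := NormedRing.inverse_continuousAt U
      rw [hU] at h3
      exact ContinuousAt.comp_continuousWithinAt (f := fun a => A a ε) h3 h2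
    rw [hΦ]
    exact Complex.continuous_re.comp_continuousOn
      (Complex.continuous_ofReal.continuousOn.add
        ((ℓ ε).continuous.comp_continuousOn (h1.clm_apply continuousOn_const)))
  have hΦp : Φ p ≤ 0 := by
    obtain ⟨-, β, hβ, hy⟩ := key p hpp (hpq.trans hqq)
    have h1 := (abs_le.1 (hy _ (hinv p ⟨le_rfl, hpq⟩)).2).2
    have h2 : β.re * Φ p ≤ 0 := by
      rw [hΦ]
      have : p - ε ^ 2 * a2 = -(C0 * e ^ 3) := by rw [hp]; ring
      rw [this, hC0, add_one_mul] at h1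
      linarith [mul_nonneg hK60 he3.le]
    exact nonpos_of_mul_nonpos_right h2 (by linarith)
  have hΦq : 0 ≤ Φ q := by
    obtain ⟨-, β, hβ, hy⟩ := key q (hpp.trans_le hpq) hqq
    have h1 := (abs_le.1 (hy _ (hinv q ⟨hpq, le_rfl⟩)).2).1
    have h2 : 0 ≤ β.re * Φ q := by
      rw [hΦ]
      have : q - ε ^ 2 * a2 = C0 * e ^ 3 := by rw [hq]; ring
      rw [this, hC0, add_one_mul] at h1
      linarith [mul_nonneg hK60 he3.le]
    exact nonneg_of_mul_nonneg_right h2 (by linarith)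
  obtain ⟨α, hα, hα0⟩ := intermediate_value_Icc hpq hcont ⟨hΦp, hΦq⟩
  obtain ⟨hαp, hαe⟩ := hIcc α hα
  obtain ⟨hu, β, hβ, hy⟩ := key α hαp hαe
  obtain ⟨y, hyd⟩ : ∃ y, y = Ring.inverse (A α ε) v := ⟨_, rfl⟩
  have hAy : A α ε y = v := hyd ▸ hinv α hα
  have him := hreal α ε hαp (hα.2.trans hq1) heδ hu y hAy
  have hℓy : ℓ ε y = -α := by
    rw [hΦ] at hα0
    simp only [← hyd] at hα0
    apply Complex.ext
    · rw [Complex.add_re, Complex.ofReal_re] at hα0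
      simp; linarith
    · simp [him]
  have hα' : (α : ℂ) ≠ 0 := by exact_mod_cast hαp.ne'
  have hβ0 : β ≠ 0 := by rintro rfl; norm_num at hβ
  refine ⟨α, β • y, hαp, hα.2.trans hq1, hsq ▸ hαe, ?_, ?_, ?_, ?_⟩
  · rw [← he]
    have h1 : |α - ε ^ 2 * a2| ≤ C0 * e ^ 3 :=
      abs_le.2 ⟨by linarith [hα.1], by linarith [hα.2]⟩
    have h2 : 0 ≤ ‖D‖ * K2 * e ^ 3 := by positivity
    linarith
  -- With `ℓ(y) = -α` the singular term is exactly `-β v` and cancels `A (β y) = β v`.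
  · rw [map_smul, map_smul, hAy, hℓy, ← add_smul, smul_eq_mul]
    have : β + (α : ℂ)⁻¹ * (β * -α) = 0 := by field_simp; ring
    rw [this, zero_smul]
  · intro h
    have : A α ε (β • y) = β • v := by rw [map_smul, hAy]
    rw [h, map_zero] at this
    exact (smul_ne_zero hβ0 hv) this.symm
  · rw [← hW, ← he]
    have h1 := (hy y hAy).1
    linarith

end Abstract

/-! ### Complex conjugation -/

/-- Componentwise complex conjugation. -/
noncomputable def conjVec (z : Vec) : Vec := !₂[starRingEnd ℂ (z 0), starRingEnd ℂ (z 1)]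

@[simp] theorem conjVec_zero (z : Vec) : conjVec z 0 = starRingEnd ℂ (z 0) := rfl
@[simp] theorem conjVec_one (z : Vec) : conjVec z 1 = starRingEnd ℂ (z 1) := rfl

theorem continuous_conjVec : Continuous conjVec := by
  have h : Continuous fun z : Vec => (![starRingEnd ℂ (z 0), starRingEnd ℂ (z 1)] : Fin 2 → ℂ) := by
    have h0 : ∀ i, Continuous fun z : Vec => starRingEnd ℂ (z i) := fun i =>
      Complex.continuous_conj.comp (by fun_prop)
    refine continuous_pi fun i => ?_
    fin_cases i
    exacts [h0 0, h0 1]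
  exact (PiLp.continuous_toLp 2 _).comp h

theorem norm_conjVec (z : Vec) : ‖conjVec z‖ = ‖z‖ := by
  simp [EuclideanSpace.norm_eq, Fin.sum_univ_two]

theorem act_conjVec (M : Mat) (z : Vec) : act M (conjVec z) = conjVec (act M z) := by
  apply vec_ext <;> simp [act_apply]

theorem conjVec_sub (z z' : Vec) : conjVec (z - z') = conjVec z - conjVec z' := by
  apply vec_ext <;> simp

theorem conjVec_add (z z' : Vec) : conjVec (z + z') = conjVec z + conjVec z' := by
  apply vec_ext <;> simp

theorem conjVec_smul (c : ℝ) (z : Vec) : conjVec ((c : ℂ) • z) = (c : ℂ) • conjVec z := by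
  apply vec_ext <;> simp

theorem conjVec_v (x : ℝ) : conjVec (v x) = v x := by
  rw [v_eq, ← act_conjVec]
  congr 1
  apply vec_ext <;> simp

theorem IsL2.conj {f : ℝ → Vec} (hf : IsL2 f) : IsL2 fun x => conjVec (f x) :=
  MemLp.of_le hf (continuous_conjVec.comp_aestronglyMeasurable hf.aestronglyMeasurable)
    (ae_of_all _ fun _ => (norm_conjVec _).le)

/-- Complex conjugation on `L²`. -/
noncomputable def conjL2 (f : L2Space) : L2Space := toL2 _ (isL2_coe f).conj

theorem conjL2_toL2 {f : ℝ → Vec} (hf : IsL2 f) : conjL2 (toL2 f hf) = toL2 _ hf.conj := by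
  rw [conjL2, toL2_eq_iff]
  filter_upwards [coeFn_toL2 hf] with x hx
  rw [hx]

theorem exists_rep (f : L2Space) : ∃ (F : ℝ → Vec) (hF : IsL2 F), f = toL2 F hF :=
  ⟨f, isL2_coe f, (toL2_coe f _).symm⟩

theorem conjL2_add (f g : L2Space) : conjL2 (f + g) = conjL2 f + conjL2 g := by
  obtain ⟨F, hF, rfl⟩ := exists_rep f
  obtain ⟨G, hG, rfl⟩ := exists_rep g
  rw [← toL2_add, conjL2_toL2, conjL2_toL2, conjL2_toL2, ← toL2_add, toL2_eq_iff]
  exact ae_of_all _ fun x => conjVec_add _ _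

theorem conjL2_sub (f g : L2Space) : conjL2 (f - g) = conjL2 f - conjL2 g := by
  obtain ⟨F, hF, rfl⟩ := exists_rep f
  obtain ⟨G, hG, rfl⟩ := exists_rep g
  rw [← toL2_sub, conjL2_toL2, conjL2_toL2, conjL2_toL2, ← toL2_sub, toL2_eq_iff]
  exact ae_of_all _ fun x => conjVec_sub _ _

theorem conjL2_smul (c : ℝ) (f : L2Space) : conjL2 ((c : ℂ) • f) = (c : ℂ) • conjL2 f := by
  obtain ⟨F, hF, rfl⟩ := exists_rep f
  rw [← toL2_smul, conjL2_toL2, conjL2_toL2, ← toL2_smul, toL2_eq_iff]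
  exact ae_of_all _ fun x => conjVec_smul _ _

theorem integral_conjVec {F : ℝ → Vec} (hF : Integrable F) :
    ∫ y, conjVec (F y) = conjVec (∫ y, F y) := by
  have h : Integrable fun y => conjVec (F y) := hF.norm.mono'
    (continuous_conjVec.comp_aestronglyMeasurable hF.aestronglyMeasurable)
    (ae_of_all _ fun x => (norm_conjVec _).le)
  apply vec_ext
  · rw [integral_vec_apply h, conjVec_zero, integral_vec_apply hF, ← integral_conj]; rfl
  · rw [integral_vec_apply h, conjVec_one, integral_vec_apply hF, ← integral_conj]; rfl

/-- The kernels are real. This is used only to see that the scalar bifurcation function is real. -/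
theorem op_conjL2 {k : ℝ → ℝ → Mat} (hk : Adm k) (f : L2Space) :
    op k hk (conjL2 f) = conjL2 (op k hk f) := by
  obtain ⟨F, hF, rfl⟩ := exists_rep f
  rw [conjL2_toL2, op_toL2, op_toL2, conjL2_toL2, toL2_eq_iff]
  refine ae_of_all _ fun x => ?_
  simp only [kint, act_conjVec]
  exact integral_conjVec (hk.integrable hF x)

theorem inner_conjL2 (f g : L2Space) :
    inner ℂ (conjL2 f) (conjL2 g) = starRingEnd ℂ (inner ℂ f g) := by
  obtain ⟨F, hF, rfl⟩ := exists_rep f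
  obtain ⟨G, hG, rfl⟩ := exists_rep g
  rw [conjL2_toL2, conjL2_toL2, inner_toL2, inner_toL2, ip, ip, ← integral_conj]
  congr 1
  ext1 x
  simp [inner_vec]

/-! ### The family of Birman–Schwinger operators -/

theorem PotBound.mono {V : ℝ → Mat} {c c' : ℝ} (h : PotBound V c) (hc : c ≤ c') : PotBound V c' :=
  ⟨h.meas, fun x i j => (h.bound x i j).trans (by gcongr)⟩

/-- The difference between the potential and its value at the cubic exponent. -/
noncomputable def potDiff (ε x : ℝ) : Mat := ε • V1 x + (ε ^ 2 • V2 x + potRem ε x)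

theorem potential_eq (ε x : ℝ) : potential (3 + ε) x = V0 x + potDiff ε x := by
  simp only [potDiff, potRem]; abel

theorem potBound_potDiff {ε : ℝ} (hε : |ε| ≤ 1 / 10) : PotBound (potDiff ε) (1100000 * |ε|) := by
  refine ((potBound_V1.smul ε).add ((potBound_V2.smul (ε ^ 2)).add (potBound_potRem hε))).mono ?_
  have h0 := abs_nonneg ε
  rw [abs_pow]
  have h2 : |ε| ^ 2 ≤ |ε| := by nlinarith
  have h3 : |ε| ^ 3 ≤ |ε| := by nlinarith
  linarith

theorem potBound_potential {ε : ℝ} (hε : |ε| ≤ 1 / 10) :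
    PotBound (potential (3 + ε)) 200000 := by
  have e : potential (3 + ε) = fun x => V0 x + potDiff ε x := by ext1 x; exact potential_eq ε x
  rw [e]
  exact (potBound_V0.add (potBound_potDiff hε)).mono (by linarith)

open Classical in
/-- The integral operator of a kernel, `0` if the kernel is not admissible. -/
noncomputable def opOf (k : ℝ → ℝ → Mat) : L2Space →L[ℂ] L2Space :=
  if h : Adm k then op k h else 0

theorem opOf_eq {k : ℝ → ℝ → Mat} (h : Adm k) : opOf k = op k h := dif_pos h

theorem norm_opOf_sandwich_le {R : ℝ → ℝ → Mat} {V : ℝ → Mat} {c d : ℝ} (hR : ResBound R c)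
    (hV : PotBound V d) : ‖opOf (sandwichKernel R V)‖ ≤ 16 * (sandwichConst * c * d) := by
  rw [opOf_eq (adm_sandwich hR hV)]
  exact norm_op_le (isAdm_sandwich hR hV)

theorem opOf_sandwich_add_left {R R' : ℝ → ℝ → Mat} {V : ℝ → Mat} {c c' d : ℝ} (hR : ResBound R c)
    (hR' : ResBound R' c') (hV : PotBound V d) :
    opOf (sandwichKernel (fun x y => R x y + R' x y) V) =
      opOf (sandwichKernel R V) + opOf (sandwichKernel R' V) := by
  have h1 := adm_sandwich hR hV
  have h2 := adm_sandwich hR' hV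
  have h3 := adm_sandwich (hR.add hR') hV
  have h4 : Adm fun x y => sandwichKernel R V x y + sandwichKernel R' V x y := by
    simpa only [← sandwichKernel_add_left] using h3
  rw [opOf_eq h1, opOf_eq h2, opOf_eq h3, ← op_add h1 h2 h4]
  exact op_congr _ _ fun x y => sandwichKernel_add_left R R' V x y

theorem opOf_sandwich_add_right {R : ℝ → ℝ → Mat} {V V' : ℝ → Mat} {c d d' : ℝ} (hR : ResBound R c)
    (hV : PotBound V d) (hV' : PotBound V' d') :
    opOf (sandwichKernel R (fun x => V x + V' x)) =
      opOf (sandwichKernel R V) + opOf (sandwichKernel R V') := by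
  have h1 := adm_sandwich hR hV
  have h2 := adm_sandwich hR hV'
  have h3 := adm_sandwich hR (hV.add hV')
  have h4 : Adm fun x y => sandwichKernel R V x y + sandwichKernel R V' x y := by
    simpa only [← sandwichKernel_add_right] using h3
  rw [opOf_eq h1, opOf_eq h2, opOf_eq h3, ← op_add h1 h2 h4]
  exact op_congr _ _ fun x y => sandwichKernel_add_right R V V' x y

theorem opOf_sandwich_smul_left {R : ℝ → ℝ → Mat} {V : ℝ → Mat} {c d : ℝ} (a : ℝ)
    (hR : ResBound R c) (hV : PotBound V d) :
    opOf (sandwichKernel (fun x y => a • R x y) V) = (a : ℂ) • opOf (sandwichKernel R V) := by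
  have h1 := adm_sandwich hR hV
  have h3 := adm_sandwich (hR.smul a) hV
  have h4 : Adm fun x y => a • sandwichKernel R V x y := by
    simpa only [← sandwichKernel_smul_left] using h3
  rw [opOf_eq h1, opOf_eq h3, ← op_smul h1 a h4]
  exact op_congr _ _ fun x y => sandwichKernel_smul_left a R V x y

theorem opOf_sandwich_smul_right {R : ℝ → ℝ → Mat} {V : ℝ → Mat} {c d : ℝ} (a : ℝ)
    (hR : ResBound R c) (hV : PotBound V d) :
    opOf (sandwichKernel R (fun x => a • V x)) = (a : ℂ) • opOf (sandwichKernel R V) := by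
  have h1 := adm_sandwich hR hV
  have h3 := adm_sandwich hR (hV.smul a)
  have h4 : Adm fun x y => a • sandwichKernel R V x y := by
    simpa only [← sandwichKernel_smul_right] using h3
  rw [opOf_eq h1, opOf_eq h3, ← op_smul h1 a h4]
  exact op_congr _ _ fun x y => sandwichKernel_smul_right a R V x y

/-- The expansion of the operator in the exponent. -/
theorem opOf_sandwich_potential {R : ℝ → ℝ → Mat} {c ε : ℝ} (hR : ResBound R c)
    (hε : |ε| ≤ 1 / 10) : opOf (sandwichKernel R (potential (3 + ε))) =
      opOf (sandwichKernel R V0) + (ε : ℂ) • opOf (sandwichKernel R V1) +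
        (ε ^ 2 : ℂ) • opOf (sandwichKernel R V2) + opOf (sandwichKernel R (potRem ε)) := by
  have e : potential (3 + ε) = fun x => V0 x + (ε • V1 x + (ε ^ 2 • V2 x + potRem ε x)) := by
    ext1 x; exact potential_eq ε x
  have h1 := potBound_V1.smul ε
  have h2 := potBound_V2.smul (ε ^ 2)
  have h3 := potBound_potRem hε
  rw [e, opOf_sandwich_add_right hR potBound_V0 (h1.add (h2.add h3)),
    opOf_sandwich_add_right hR h1 (h2.add h3), opOf_sandwich_add_right hR h2 h3,
    opOf_sandwich_smul_right ε hR potBound_V1, opOf_sandwich_smul_right (ε ^ 2) hR potBound_V2]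
  push_cast
  abel

/-- The regular part of the Birman–Schwinger operator. -/
noncomputable def regularOp (α ε : ℝ) : L2Space →L[ℂ] L2Space :=
  1 + (opOf (sandwichKernel (resolventKernel α) (potential (3 + ε))) -
    ((α⁻¹ : ℝ) : ℂ) • opOf (sandwichKernel Rm1 (potential (3 + ε))))

/-- After the exact terms are removed three remainders are left: `R₀` with the potential remainder,
of order `|ε|³`; `α R₁` with the deviation of the potential from `V₀`, of order `α|ε|`; and the
resolvent remainder with the full potential, of order `α²`. -/
theorem regularOp_expansion {α ε : ℝ} (h0 : 0 < α) (h1 : α ≤ 1) (hε : |ε| ≤ 1 / 10) :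
    ‖regularOp α ε - ((1 + op _ adm00) + (ε : ℂ) • op _ adm01 + (ε ^ 2 : ℂ) • op _ adm02 +
      (α : ℂ) • op _ adm10)‖ ≤ 16 * sandwichConst * 1100000 * (|ε| ^ 3 + α * |ε| + α ^ 2) := by
  have hV := potBound_potential hε
  have hdV := potBound_potDiff hε
  have hR := resBound_resRem h0 h1
  have e : resolventKernel α = fun x y => α⁻¹ • Rm1 x y + (R0 x y + (α • R1 x y + resRem α x y)) := by
    ext1 x; ext1 y; simp only [resRem, resReg]; abel
  have hV' : potential (3 + ε) = fun x => V0 x + potDiff ε x := by ext1 x; exact potential_eq ε x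
  have r1 := resBound_Rm1.smul α⁻¹
  have r2 := resBound_R1.smul α
  have key : opOf (sandwichKernel (resolventKernel α) (potential (3 + ε))) =
      ((α⁻¹ : ℝ) : ℂ) • opOf (sandwichKernel Rm1 (potential (3 + ε))) +
      ((opOf (sandwichKernel R0 V0) + (ε : ℂ) • opOf (sandwichKernel R0 V1) +
        (ε ^ 2 : ℂ) • opOf (sandwichKernel R0 V2) + opOf (sandwichKernel R0 (potRem ε))) +
      ((α : ℂ) • (opOf (sandwichKernel R1 V0) + opOf (sandwichKernel R1 (potDiff ε))) +
        opOf (sandwichKernel (resRem α) (potential (3 + ε))))) := by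
    rw [← opOf_sandwich_potential resBound_R0 hε,
      ← opOf_sandwich_add_right resBound_R1 potBound_V0 hdV, ← hV', e,
      opOf_sandwich_add_left r1 (resBound_R0.add (r2.add hR)) hV,
      opOf_sandwich_add_left resBound_R0 (r2.add hR) hV, opOf_sandwich_add_left r2 hR hV,
      opOf_sandwich_smul_left _ resBound_Rm1 hV, opOf_sandwich_smul_left _ resBound_R1 hV]
  have key2 : regularOp α ε - ((1 + op _ adm00) + (ε : ℂ) • op _ adm01 + (ε ^ 2 : ℂ) • op _ adm02 +
      (α : ℂ) • op _ adm10) = opOf (sandwichKernel R0 (potRem ε)) +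
        (α : ℂ) • opOf (sandwichKernel R1 (potDiff ε)) +
        opOf (sandwichKernel (resRem α) (potential (3 + ε))) := by
    rw [regularOp, key, opOf_eq adm00, opOf_eq adm01, opOf_eq adm02, opOf_eq adm10, smul_add]
    abel
  rw [key2]
  have n1 := norm_opOf_sandwich_le resBound_R0 (potBound_potRem hε)
  have n2 := norm_opOf_sandwich_le resBound_R1 hdV
  have n3 := norm_opOf_sandwich_le hR hV
  have hs : 0 ≤ sandwichConst := by unfold sandwichConst; norm_num
  refine norm_add₃_le.trans ?_
  rw [norm_smul, Complex.norm_real, Real.norm_of_nonneg h0.le]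
  have n2' := mul_le_mul_of_nonneg_left n2 h0.le
  have h3 : 0 ≤ |ε| ^ 3 := by positivity
  have h4 : 0 ≤ α ^ 2 := by positivity
  have h5 := mul_nonneg hs h3
  have h6 := mul_nonneg hs h4
  nlinarith

theorem continuousOn_regularOp {ε : ℝ} (hε : |ε| ≤ 1 / 10) :
    ContinuousOn (fun α => regularOp α ε) (Set.Ioc 0 1) := by
  have hV := potBound_potential hε
  have h1 : ContinuousOn
      (fun α => opOf (sandwichKernel (resolventKernel α) (potential (3 + ε)))) (Set.Ioc 0 1) := by
    intro a ha
    -- Near `a` one may assume `α > a/2`, where the resolvent kernel is Lipschitz in `α`.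
    obtain ⟨m, hm⟩ : ∃ m, m = a / 2 := ⟨_, rfl⟩
    have hm0 : 0 < m := by rw [hm]; exact half_pos ha.1
    rw [ContinuousWithinAt, tendsto_iff_norm_sub_tendsto_zero]
    have hlim : Tendsto (fun α : ℝ => 16 * (sandwichConst * (2 * (m⁻¹) ^ 2 * |α - a|) * 200000))
        (𝓝[Set.Ioc 0 1] a) (𝓝 0) := by
      have : Continuous fun α : ℝ =>
          16 * (sandwichConst * (2 * (m⁻¹) ^ 2 * |α - a|) * 200000) := by fun_prop
      simpa using (this.tendsto a).mono_left nhdsWithin_le_nhds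
    refine squeeze_zero' (Eventually.of_forall fun _ => norm_nonneg _) ?_ hlim
    have h2 : ∀ᶠ α in 𝓝[Set.Ioc 0 1] a, m < α :=
      mem_nhdsWithin_of_mem_nhds (lt_mem_nhds (by rw [hm]; exact half_lt_self ha.1))
    filter_upwards [h2, self_mem_nhdsWithin] with α hα hα1
    have hr := resBound_resolventKernel_sub hm0 hα.le hα1.2 (by rw [hm]; linarith [ha.1]) ha.2
    have hr1 := resBound_resolventKernel ha.1 ha.2
    have e : opOf (sandwichKernel (resolventKernel α) (potential (3 + ε))) =
        opOf (sandwichKernel (fun x y => resolventKernel α x y - resolventKernel a x y)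
          (potential (3 + ε))) + opOf (sandwichKernel (resolventKernel a) (potential (3 + ε))) := by
      rw [← opOf_sandwich_add_left hr hr1 hV]
      simp only [sub_add_cancel]
    rw [e, add_sub_cancel_right]
    exact norm_opOf_sandwich_le hr hV
  have h2 : ContinuousOn (fun α : ℝ => ((α⁻¹ : ℝ) : ℂ) •
      opOf (sandwichKernel Rm1 (potential (3 + ε)))) (Set.Ioc 0 1) :=
    (Complex.continuous_ofReal.comp_continuousOn
      (continuousOn_inv₀.mono fun a ha => ne_of_gt ha.1)).smul continuousOn_const
  exact continuousOn_const.add (h1.sub h2)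

/-- The functional in the singular part of the Birman–Schwinger operator. -/
noncomputable def singularForm (V : ℝ → Mat) : L2Space →L[ℂ] ℂ :=
  (1 / 8 : ℂ) • (innerSL ℂ (toL2 v isL2_v)).comp (opOf (sandwichKernel Rm1 V))

theorem opOf_Rm1_toL2 {V : ℝ → Mat} {d : ℝ} (hV : PotBound V d) {f : ℝ → Vec} (hf : IsL2 f) :
    opOf (sandwichKernel Rm1 V) (toL2 f hf) = singularCoeff V f • toL2 v isL2_v := by
  have hk := adm_sandwich resBound_Rm1 hV
  rw [opOf_eq hk, op_toL2, ← toL2_smul, toL2_eq_iff, ← sandwich_eq_kint, sandwich_Rm1 hk hf]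

theorem singularForm_toL2 {V : ℝ → Mat} {d : ℝ} (hV : PotBound V d) {f : ℝ → Vec} (hf : IsL2 f) :
    singularForm V (toL2 f hf) = singularCoeff V f := by
  have h : singularForm V (toL2 f hf) =
      1 / 8 * inner ℂ (toL2 v isL2_v) (opOf (sandwichKernel Rm1 V) (toL2 f hf)) := rfl
  rw [h, opOf_Rm1_toL2 hV, inner_smul_right, inner_toL2, ip_v_v]
  ring

theorem opOf_Rm1 {V : ℝ → Mat} {d : ℝ} (hV : PotBound V d) (x : L2Space) :
    opOf (sandwichKernel Rm1 V) x = singularForm V x • toL2 v isL2_v := by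
  obtain ⟨F, hF, rfl⟩ := exists_rep x
  rw [opOf_Rm1_toL2 hV, singularForm_toL2 hV]

theorem singularForm_expansion {ε : ℝ} (hε : |ε| ≤ 1 / 10) :
    ‖singularForm (potential (3 + ε)) - (singularForm V0 + (ε : ℂ) • singularForm V1 +
      (ε ^ 2 : ℂ) • singularForm V2)‖ ≤
      ‖toL2 v isL2_v‖ * (16 * (sandwichConst * 1 * 1000000)) * |ε| ^ 3 := by
  have h1 : singularForm (potential (3 + ε)) - (singularForm V0 + (ε : ℂ) • singularForm V1 +
      (ε ^ 2 : ℂ) • singularForm V2) = singularForm (potRem ε) := by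
    simp only [singularForm]
    rw [opOf_sandwich_potential resBound_Rm1 hε]
    ext1 x
    simp only [sub_apply, add_apply, smul_apply, ContinuousLinearMap.comp_apply, map_add, map_smul,
      smul_eq_mul]
    ring
  have h2 := norm_opOf_sandwich_le resBound_Rm1 (potBound_potRem hε)
  rw [h1, singularForm, norm_smul]
  have h3 := ContinuousLinearMap.opNorm_comp_le (innerSL ℂ (toL2 v isL2_v))
    (opOf (sandwichKernel Rm1 (potRem ε)))
  rw [innerSL_apply_norm] at h3
  have h4 : ‖(1 / 8 : ℂ)‖ ≤ 1 := by norm_num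
  calc _ ≤ 1 * (‖toL2 v isL2_v‖ * (16 * (sandwichConst * 1 * (1000000 * |ε| ^ 3)))) := by
        gcongr
        exact h3.trans (by gcongr)
    _ = _ := by ring

/-- The complex conjugate of a solution of `A x = v` is again a solution, since `v` and the kernels
are real; by invertibility `x` is real, and so is the value of the functional. -/
theorem singularForm_real {α ε : ℝ} (h0 : 0 < α) (h1 : α ≤ 1) (hε : |ε| ≤ 1 / 10)
    (hu : IsUnit (regularOp α ε)) {x : L2Space} (hx : regularOp α ε x = toL2 v isL2_v) :
    (singularForm (potential (3 + ε)) x).im = 0 := by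
  have hV := potBound_potential hε
  have k1 := adm_sandwich (resBound_resolventKernel h0 h1) hV
  have k2 := adm_sandwich resBound_Rm1 hV
  have hv : conjL2 (toL2 v isL2_v) = toL2 v isL2_v := by
    rw [conjL2_toL2, toL2_eq_iff]; exact ae_of_all _ conjVec_v
  have h2 : regularOp α ε (conjL2 x) = conjL2 (regularOp α ε x) := by
    simp only [regularOp, opOf_eq k1, opOf_eq k2, add_apply, sub_apply, smul_apply,
      one_apply_eq_self, op_conjL2, conjL2_add, conjL2_sub, conjL2_smul]
  have h3 : conjL2 x = x := by
    obtain ⟨U, hU⟩ := hu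
    rw [hx, hv, ← hx] at h2
    have h4 : (↑U⁻¹ : L2Space →L[ℂ] L2Space) * regularOp α ε = 1 := by rw [← hU, U.inv_mul]
    have h5 := congrArg (↑U⁻¹ : L2Space →L[ℂ] L2Space) h2
    rwa [← mul_apply_eq_comp, ← mul_apply_eq_comp, h4, one_apply_eq_self, one_apply_eq_self] at h5
  have h6 : singularForm (potential (3 + ε)) x =
      1 / 8 * inner ℂ (toL2 v isL2_v) (opOf (sandwichKernel Rm1 (potential (3 + ε))) x) := rfl
  have h7 : starRingEnd ℂ (inner ℂ (toL2 v isL2_v)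
      (opOf (sandwichKernel Rm1 (potential (3 + ε))) x)) =
      inner ℂ (toL2 v isL2_v) (opOf (sandwichKernel Rm1 (potential (3 + ε))) x) := by
    rw [← inner_conjL2, hv, opOf_eq k2, ← op_conjL2, h3]
  rw [← Complex.conj_eq_iff_im, h6, map_mul, h7, map_div₀, map_one, Complex.conj_ofNat]

/-- The Birman–Schwinger problem near the cubic exponent. -/
theorem exists_birmanSchwinger : ∃ ε₀ : ℝ, 0 < ε₀ ∧ ε₀ ≤ 1 / 10 ∧ ∃ C : ℝ, 0 < C ∧
    ∀ ε : ℝ, ε ≠ 0 → |ε| ≤ ε₀ → ∃ (α : ℝ) (w : ℝ → Vec), 0 < α ∧ α ≤ 1 ∧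
      α ≤ 2 * alpha2 * ε ^ 2 ∧ |α - ε ^ 2 * alpha2| < C * |ε| ^ 3 ∧ IsL2 w ∧
      (∀ᵐ x : ℝ, K α ε w x + w x = 0) ∧ (¬ ∀ᵐ x : ℝ, w x = 0) ∧
      eLpNorm (w - (w0 + ε • w1 + ε ^ 2 • w2)) 2 volume < ENNReal.ofReal (C * |ε| ^ 3) := by
  obtain ⟨hq, hpos⟩ := alpha2_real_pos
  have hw2 := isL2_w2 hq
  obtain ⟨β1, hβ1⟩ := K00_w1
  obtain ⟨β2, hβ2⟩ := K00_w2 hq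
  have hs : 0 ≤ sandwichConst := by unfold sandwichConst; norm_num
  have hv0 : toL2 v isL2_v ≠ 0 := fun h => by
    have := inner_toL2 isL2_v isL2_v
    rw [h, ip_v_v] at this
    simp at this
  obtain ⟨ε₀, h1, h2, C, hC, h3⟩ := exists_edge_bifurcation (δ := 1 / 10)
    (M := 16 * sandwichConst * 1100000 + ‖toL2 v isL2_v‖ * (16 * (sandwichConst * 1 * 1000000)))
    (B := 1 + op _ adm00) (T01 := op _ adm01) (T02 := op _ adm02) (T10 := op _ adm10)
    (v := toL2 v isL2_v) (w0 := toL2 w0 isL2_w0) (w1 := toL2 w1 isL2_w1) (w2 := toL2 w2 hw2)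
    (ℓ0 := singularForm V0) (ℓ1 := singularForm V1) (ℓ2 := singularForm V2)
    -- The equation for `w₂` contains `α₂ K₁₀ w₀ = -2 α₂ v`, which is moved into the multiple of
    -- `v`.
    (β1 := β1) (β2 := β2 + 2 * alpha2) (a2 := alpha2) (A := regularOp)
    (ℓ := fun ε => singularForm (potential (3 + ε)))
    (by norm_num) (by positivity) isUnit_one_add_op00 hv0 hpos
    (by
      rw [K00_add_toL2, ← toL2_smul, toL2_eq_iff, K00_w0_add])
    (by
      rw [K00_add_toL2, op_toL2, ← toL2_add, ← toL2_smul, toL2_eq_iff]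
      filter_upwards [hβ1] with x hx
      rw [Pi.add_apply, hx]
      simp [K01, sandwich_eq_kint])
    (by
      rw [K00_add_toL2, op_toL2, op_toL2, ← toL2_add, ← toL2_add, ← toL2_smul, toL2_eq_iff]
      filter_upwards [hβ2] with x hx
      rw [Pi.add_apply, Pi.add_apply, hx, K10_w0]
      simp only [K01, K02, sandwich_eq_kint, Pi.sub_apply, Pi.add_apply, Pi.smul_apply,
        ← Complex.coe_smul]
      module)
    (by
      rw [op_toL2, ← toL2_smul, toL2_eq_iff, ← K10_w0]; rfl)
    (by rw [singularForm_toL2 potBound_V0, singularCoeff_V0, ip_v_w0, mul_zero])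
    (by
      rw [singularForm_toL2 potBound_V0, singularForm_toL2 potBound_V1, singularCoeff_V0, ip_v_w1]
      ring)
    (by
      rw [singularForm_toL2 potBound_V0, singularForm_toL2 potBound_V1,
        singularForm_toL2 potBound_V2, singularCoeff_V0, ip_v_w2 hq]
      ring)
    (fun α ε ha hb hε => (regularOp_expansion ha hb hε).trans <| by
      have : 0 ≤ |ε| ^ 3 + α * |ε| + α ^ 2 := by positivity
      gcongr
      exact le_add_of_nonneg_right (by positivity))
    (fun ε hε => (singularForm_expansion hε).trans <| by
      gcongr
      exact le_add_of_nonneg_left (by positivity))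
    (fun ε hε => continuousOn_regularOp hε)
    (fun α ε ha hb hε hu x hx => singularForm_real ha hb hε hu hx)
  refine ⟨ε₀, h1, h2, C, hC, fun ε hε0 hε => ?_⟩
  obtain ⟨α, x, ha, hb, hb2, hc, hx, hx0, hd⟩ := h3 ε hε0 hε
  have hε' := hε.trans h2
  have hV := potBound_potential hε'
  have hk := adm_sandwich (resBound_resolventKernel ha hb) hV
  obtain ⟨w, hw, rfl⟩ := exists_rep x
  refine ⟨α, w, ha, hb, hb2, hc, hw, ?_, ?_, ?_⟩
  -- The singular term is put back: `α⁻¹ ℓ_ε(·) v` is exactly what was subtracted in `regularOp`.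
  · have h4 : op _ hk (toL2 w hw) + toL2 w hw = 0 := by
      rw [← hx, regularOp, opOf_eq hk, add_apply, one_apply_eq_self, sub_apply, smul_apply,
        opOf_Rm1 hV, smul_smul, Complex.ofReal_inv]
      abel
    rw [op_toL2, ← toL2_add] at h4
    exact (toL2_eq_iff (hg := MemLp.zero)).1 h4
  · intro h
    exact hx0 ((toL2_eq_iff (hg := MemLp.zero)).2 h)
  · have hW := (isL2_w0.add (isL2_w1.rsmul ε)).add (hw2.rsmul (ε ^ 2))
    have e : toL2 w hw - (toL2 w0 isL2_w0 + (ε : ℂ) • toL2 w1 isL2_w1 +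
        (ε ^ 2 : ℂ) • toL2 w2 hw2) = toL2 _ (hw.sub hW) := by
      rw [← toL2_smul, ← toL2_smul, ← toL2_add, ← toL2_add, ← toL2_sub, toL2_eq_iff]
      refine ae_of_all _ fun x => ?_
      simp [← Complex.coe_smul]
    have h5 : ‖toL2 _ (hw.sub hW)‖ = ENNReal.toReal _ := Lp.norm_toLp _ _
    rw [e, h5] at hd
    exact (ENNReal.lt_ofReal_iff_toReal_lt (hw.sub hW).eLpNorm_ne_top).2 hd

/-! ### From the Birman–Schwinger problem to the eigenvalue problem -/

theorem hasWeakDeriv_of_hasDerivAt {f f' : ℝ → Vec} (h : ∀ x, HasDerivAt f (f' x) x)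
    (hc : Continuous f') : HasWeakDeriv f f' := by
  intro φ hφ hsupp
  have hf : Continuous f := continuous_iff_continuousAt.2 fun x => (h x).continuousAt
  have hφ' : Continuous (deriv φ) := hφ.continuous_deriv (by simp)
  have hd : ∀ x, HasDerivAt φ (deriv φ x) x := fun x =>
    (hφ.differentiable (by simp) x).hasDerivAt
  have i1 : Integrable fun x => deriv φ x • f x :=
    (hφ'.smul hf).integrable_of_hasCompactSupport (hsupp.deriv.smul_right)
  have i2 : Integrable fun x => φ x • f' x :=
    (hφ.continuous.smul hc).integrable_of_hasCompactSupport (hsupp.smul_right)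
  have i3 : Integrable fun x => φ x • f x :=
    (hφ.continuous.smul hf).integrable_of_hasCompactSupport (hsupp.smul_right)
  have := integral_eq_zero_of_hasDerivAt_of_integrable (fun x => (hd x).smul (h x)) (i2.add i1) i3
  have h2 := integral_add i2 i1
  rw [eq_neg_iff_add_eq_zero, add_comm, ← h2]
  exact this

theorem vec_eq_smul_add (z : Vec) :
    z = z 0 • EuclideanSpace.single 0 (1 : ℂ) + z 1 • EuclideanSpace.single 1 (1 : ℂ) := by
  apply vec_ext <;> simp

theorem hasDerivAt_vec {f : ℝ → Vec} {z : Vec} {x : ℝ} (h0 : HasDerivAt (fun x => f x 0) (z 0) x)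
    (h1 : HasDerivAt (fun x => f x 1) (z 1) x) : HasDerivAt f z x := by
  have e : f = fun x => f x 0 • EuclideanSpace.single 0 (1 : ℂ) +
      f x 1 • EuclideanSpace.single 1 (1 : ℂ) := by
    ext1 x; exact vec_eq_smul_add (f x)
  rw [e, vec_eq_smul_add z]
  exact (h0.smul_const _).add (h1.smul_const _)

theorem isL2_of_expDecay {f : ℝ → Vec} (hc : Continuous f) (h : ∀ i : Fin 2, ExpDecay fun x => f x i) :
    IsL2 f := by
  refine ExpDecay.memLp_two ?_ hc
  have h0 : ExpDecay fun x => ‖f x 0‖ := (h 0).of_le 1 (by simp) zero_le_one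
  have h1 : ExpDecay fun x => ‖f x 1‖ := (h 1).of_le 1 (by simp) zero_le_one
  refine (h0.add h1).of_le 1 (fun x => ?_) zero_le_one
  rw [one_mul, Real.norm_of_nonneg (by positivity)]
  exact norm_le_comp _

theorem continuous_potential {p : ℝ} (hp : 1 < p) (i j : Fin 2) :
    Continuous fun x => potential p x i j := by
  have h : Continuous fun x => soliton p x ^ (p - 1) := by
    have := continuous_sech
    simp only [soliton_rpow hp]
    fun_prop
  simp only [potential, Matrix.smul_apply, smul_eq_mul]
  exact (h.const_mul _).mul_const _

theorem continuous_resolventKernel (α y : ℝ) (i j : Fin 2) :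
    Continuous fun x => resolventKernel α x y i j := by
  have h1 := continuous_green_abs α y
  have h2 := continuous_green_abs √(2 - α ^ 2) y
  simp only [resolventKernel_eq]
  fin_cases i <;> fin_cases j <;> simp <;> fun_prop

theorem act_resolventKernel (α x y : ℝ) (z : Vec) : act (resolventKernel α x y) z =
    !₂[green α |x - y| • z 0, green √(2 - α ^ 2) |x - y| • z 1] := by
  rw [resolventKernel_eq]
  apply vec_ext <;> simp [act_apply]

/-- A solution of the Birman–Schwinger problem yields an eigenfunction of the linearized
operator. -/
theorem isEigenfunction_of_birmanSchwinger {α ε : ℝ} (h0 : 0 < α) (h1 : α ≤ 1) (hε : |ε| ≤ 1 / 10)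
    {w : ℝ → Vec} (hw : IsL2 w) (hK : ∀ᵐ x : ℝ, K α ε w x + w x = 0)
    (hne : ¬ ∀ᵐ x : ℝ, w x = 0) :
    IsEigenfunction (3 + ε) ((1 - α ^ 2 : ℝ) : ℂ) (fun x => act (sqrtAbsV0 x)⁻¹ (w x)) := by
  have hp : 1 < 3 + ε := by have := abs_le.1 hε; linarith
  have hV := potBound_potential hε
  have hk := adm_sandwich (resBound_resolventKernel h0 h1) hV
  -- As for the threshold problem, `-K w` is a continuous representative of `w` dominated by the
  -- weight.
  obtain ⟨g, hg⟩ : ∃ g : ℝ → Vec, g = fun x => -K α ε w x := ⟨_, rfl⟩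
  have hwg : w =ᵐ[volume] g := by
    filter_upwards [hK] with x hx
    rw [hg]
    exact eq_neg_of_add_eq_zero_right hx
  have hgL : IsL2 g := by rw [hg]; exact (hk.isL2_kint hw).neg
  have hgK : ∀ x, g x = -K α ε g x := fun x => by
    have : K α ε w = K α ε g := kint_congr hwg
    rw [← this, hg]
  obtain ⟨C, hC⟩ := hk
  have hk := hC.adm
  have hgb : ∀ x, ‖g x‖ ≤ (8 * C * ‖toL2 w hw‖) * wt x := fun x => by
    rw [hg, norm_neg]; exact hC.norm_kint_le hw x
  have hgc : Continuous g := by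
    have : Continuous (K α ε w) :=
      continuous_kint hk (continuous_sandwichKernel _ (continuous_resolventKernel α)) hw
    rw [hg]; exact this.neg
  obtain ⟨u, hu⟩ : ∃ u : ℝ → Vec, u = fun x => act (sqrtAbsV0 x)⁻¹ (g x) := ⟨_, rfl⟩
  have huc : Continuous u := by rw [hu]; exact continuous_act_apply continuous_inv_sqrt hgc
  obtain ⟨F, hF⟩ : ∃ F : ℝ → Vec, F = fun y => act (potential (3 + ε) y) (u y) := ⟨_, rfl⟩
  have hFc : Continuous F := by
    rw [hF]; exact continuous_act_apply (continuous_potential hp) huc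
  have hFb := expDecay_source hV hgb
  have hFi := sandwich_integrable hk hgL
  have hur : ∀ x, u x = -∫ y, act (resolventKernel α x y) (F y) := fun x => by
    simp only [hF, hu]
    rw [hgK x, act_neg]
    unfold K
    rw [sandwich_eq_kint, kint_sandwich hk hgL, act_inv_sqrt]
  have hb : ∀ i y, ‖F y i‖ ≤ (16 * 200000 * (8 * C * ‖toL2 w hw‖)) * Real.exp (-(3 / 4) * |y|) :=
    fun i y => by
      simp only [hF, hu]; exact (norm_comp_le _ i).trans (hFb y)
  have hproj : ∀ i : Fin 2, Continuous fun z : Vec => z i := fun i =>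
    (EuclideanSpace.proj (𝕜 := ℂ) i).continuous
  -- One decay rate for both components: it must not exceed `α`, the smaller of the two resolvent
  -- rates, and must lie strictly below the rate `3/4` of the source.
  obtain ⟨s, hs0, hsα, hs⟩ : ∃ s : ℝ, 0 < s ∧ s ≤ α ∧ s < 3 / 4 :=
    ⟨α / 2, half_pos h0, by linarith, by linarith⟩
  have hσ := one_le_sqrt_two_sub h0.le h1
  obtain ⟨φ', p1, p2, ⟨Cp, p3⟩, ⟨Cp', p4⟩⟩ := green_solution h0 ((hproj 0).comp hFc) hs0 hsα hs (hb 0)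
  obtain ⟨ψ', r1, r2, ⟨Cr, r3⟩, ⟨Cr', r4⟩⟩ := green_solution (σ := √(2 - α ^ 2))
    (by linarith) ((hproj 1).comp hFc) hs0 (hsα.trans (h1.trans hσ)) hs (hb 1)
  have u0eq : ∀ x, u x 0 = -∫ y, green α |x - y| • F y 0 := fun x => by
    have h := integral_vec_apply (F := fun y => act (resolventKernel α x y) (F y))
      (by simp only [hF, hu]; exact hFi x) 0
    rw [hur, PiLp.neg_apply, h]
    simp only [act_resolventKernel]; rfl
  have u1eq : ∀ x, u x 1 = -∫ y, green √(2 - α ^ 2) |x - y| • F y 1 := fun x => by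
    have h := integral_vec_apply (F := fun y => act (resolventKernel α x y) (F y))
      (by simp only [hF, hu]; exact hFi x) 1
    rw [hur, PiLp.neg_apply, h]
    simp only [act_resolventKernel]; rfl
  simp only [Function.comp_def] at p1 p2 p3 r1 r2 r3
  obtain ⟨u', hu'⟩ : ∃ f : ℝ → Vec, f = fun x => !₂[-φ' x, -ψ' x] := ⟨_, rfl⟩
  -- Read off from `u = -R^{(α)} F` with `F = V u`: the components satisfy `u₁'' = α² u₁ + F₁` and
  -- `u₂'' = (2 - α²) u₂ + F₂`, which under `σ₃` both become the eigenvalue `1 - α²`.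
  obtain ⟨u'', hu''⟩ : ∃ f : ℝ → Vec, f = fun x => !₂[((α ^ 2 : ℝ) : ℂ) * u x 0 + F x 0,
    ((2 - α ^ 2 : ℝ) : ℂ) * u x 1 + F x 1] := ⟨_, rfl⟩
  have hd0 : ∀ x, HasDerivAt u (u' x) x := fun x => by
    refine hasDerivAt_vec ?_ ?_
    · simp only [u0eq, hu']; exact (p1 x).neg
    · simp only [u1eq, hu']; exact (r1 x).neg
  have hd1 : ∀ x, HasDerivAt u' (u'' x) x := fun x => by
    refine hasDerivAt_vec ?_ ?_
    · simp only [hu', hu'']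
      refine ((p2 x).neg).congr_deriv ?_
      simp [u0eq]
      ring
    · simp only [hu', hu'']
      refine ((r2 x).neg).congr_deriv ?_
      rw [Real.sq_sqrt (by nlinarith)]
      simp [u1eq]
      ring
  have hu'c : Continuous u' := continuous_iff_continuousAt.2 fun x => (hd1 x).continuousAt
  have hcomp : ∀ {f : ℝ → Vec}, Continuous f → ∀ i, Continuous fun x => f x i :=
    fun hf i => (hproj i).comp hf
  have hu''c : Continuous u'' := by
    have e : u'' = fun x => (((α ^ 2 : ℝ) : ℂ) * u x 0 + F x 0) • EuclideanSpace.single 0 (1 : ℂ) +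
        (((2 - α ^ 2 : ℝ) : ℂ) * u x 1 + F x 1) • EuclideanSpace.single 1 (1 : ℂ) := by
      ext1 x; rw [hu'']; exact vec_eq_smul_add _
    have a0 := hcomp huc 0
    have a1 := hcomp huc 1
    have a2 := hcomp hFc 0
    have a3 := hcomp hFc 1
    rw [e]
    fun_prop
  have d0 : ExpDecay fun x => u x 0 := ⟨Cp, s, hs0, fun x => by simpa only [u0eq, norm_neg] using p3 x⟩
  have d1 : ExpDecay fun x => u x 1 := ⟨Cr, s, hs0, fun x => by simpa only [u1eq, norm_neg] using r3 x⟩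
  have dF : ∀ i, ExpDecay fun x => F x i := fun i => ⟨_, 3 / 4, by norm_num, hb i⟩
  have huL : IsL2 u := isL2_of_expDecay huc fun i => by
    fin_cases i
    exacts [d0, d1]
  have hu'L : IsL2 u' := isL2_of_expDecay hu'c fun i => by
    rw [hu']
    fin_cases i
    · exact ⟨Cp', s, hs0, fun x => by simpa using p4 x⟩
    · exact ⟨Cr', s, hs0, fun x => by simpa using r4 x⟩
  have dmul : ∀ (c : ℂ) {f : ℝ → ℂ}, ExpDecay f → ExpDecay fun x => c * f x := fun c f hf =>
    hf.of_le ‖c‖ (fun x => (norm_mul _ _).le) (norm_nonneg _)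
  have hu''L : IsL2 u'' := isL2_of_expDecay hu''c fun i => by
    rw [hu'']
    fin_cases i
    · exact (dmul _ d0).add (dF 0)
    · exact (dmul _ d1).add (dF 1)
  have huu : (fun x => act (sqrtAbsV0 x)⁻¹ (w x)) =ᵐ[volume] u := by
    filter_upwards [hwg] with x hx
    rw [hx, hu]
  refine ⟨⟨huL.ae_eq huu.symm, u', u'', hu'L, hu''L, ?_, hasWeakDeriv_of_hasDerivAt hd1 hu''c, ?_⟩, ?_⟩
  · intro φ hφ hsupp
    rw [← hasWeakDeriv_of_hasDerivAt hd0 hu'c φ hφ hsupp]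
    refine integral_congr_ae ?_
    filter_upwards [huu] with x hx
    rw [hx]
  · filter_upwards [huu] with x hx
    have hFx : act (potential (3 + ε) x) (u x) = F x := by rw [hF]
    rw [hx, hFx, hu'']
    apply vec_ext
    · simp [act_apply, sigma3]
      ring
    · simp [act_apply, sigma3]
      ring
  · intro h
    refine hne ?_
    filter_upwards [h] with x hx
    rw [← act_sqrt_inv x (w x), hx, act_zero]

end NearCubicNLS

theorem theorem1 :
    -- the inverse used in the coefficients exists, and is taken where it is defined
    (∀ g : ℝ → Vec, IsPerp g →
      ∃ f : ℝ → Vec, IsReducedPreimage g f ∧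
        ∀ f' : ℝ → Vec, IsReducedPreimage g f' → ∀ᵐ x : ℝ, f' x = f x) ∧
    IsPerp source1 ∧ IsPerp source2 ∧
    -- the leading coefficient is real and positive
    alpha2Quotient = (alpha2 : ℂ) ∧ 0 < alpha2 ∧
    -- the bifurcation
    ∃ ε₀ : ℝ, 0 < ε₀ ∧ ∃ C : ℝ, 0 < C ∧
      ∀ ε : ℝ, ε ≠ 0 → |ε| ≤ ε₀ →
        ∃ (α : ℝ) (w : ℝ → Vec),
          0 < α ∧ IsL2 w ∧
          (∀ᵐ x : ℝ, K α ε w x + w x = 0) ∧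
          |α - ε ^ 2 * alpha2| < C * |ε| ^ 3 ∧
          eLpNorm (w - (w0 + ε • w1 + ε ^ 2 • w2)) 2 volume < ENNReal.ofReal (C * |ε| ^ 3) ∧
          -- the eigenvalue of the linearized operator, in the gap of the essential spectrum
          1 - α ^ 2 ∈ Set.Ioo (-1 : ℝ) 1 ∧
          |(1 - α ^ 2) - (1 - alpha2 ^ 2 * ε ^ 4)| < C * |ε| ^ 5 ∧
          IsEigenfunction (3 + ε) ((1 - α ^ 2 : ℝ) : ℂ)
            (fun x => act (sqrtAbsV0 x)⁻¹ (w x)) := by 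
  obtain ⟨hq, hpos⟩ := alpha2_real_pos
  obtain ⟨ε₀, h1, h2, C, hC, h3⟩ := exists_birmanSchwinger
  -- The enlarged constant serves both the estimates of third order and that of the eigenvalue,
  -- where `|α² - ε⁴ α₂²|` is `|α - ε² α₂|` times a sum of at most `3 α₂ ε²`, as `α ≤ 2 α₂ ε²`.
  refine ⟨fun g hg => exists_unique_reducedPreimage hg, isPerp_source1, isPerp_source2 hq, hq, hpos,
    ε₀, h1, C * (1 + 3 * alpha2), by positivity, fun ε hε0 hε => ?_⟩
  obtain ⟨α, w, ha, hb, hb2, hc, hw, hK, hne, hd⟩ := h3 ε hε0 hε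
  have he : 0 < |ε| := abs_pos.2 hε0
  have hCC : C ≤ C * (1 + 3 * alpha2) := le_mul_of_one_le_right hC.le (by linarith)
  have hle : C * |ε| ^ 3 ≤ C * (1 + 3 * alpha2) * |ε| ^ 3 := by gcongr
  refine ⟨α, w, ha, hw, hK, hc.trans_le hle, hd.trans_le (ENNReal.ofReal_le_ofReal hle),
    ⟨by nlinarith, by nlinarith⟩, ?_,
    isEigenfunction_of_birmanSchwinger ha hb (hε.trans h2) hw hK hne⟩
  have hsq : ε ^ 2 = |ε| ^ 2 := (sq_abs ε).symm
  have h4 : |(1 - α ^ 2) - (1 - alpha2 ^ 2 * ε ^ 4)| = |α - ε ^ 2 * alpha2| * (α + ε ^ 2 * alpha2) := by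
    have h5 : 0 < α + ε ^ 2 * alpha2 := by positivity
    have h6 : (1 - α ^ 2) - (1 - alpha2 ^ 2 * ε ^ 4) = -((α - ε ^ 2 * alpha2) * (α + ε ^ 2 * alpha2)) := by
      ring
    rw [h6, abs_neg, abs_mul, abs_of_pos h5]
  rw [h4]
  calc |α - ε ^ 2 * alpha2| * (α + ε ^ 2 * alpha2)
      ≤ C * |ε| ^ 3 * (3 * alpha2 * |ε| ^ 2) := by
        have h5 : α + ε ^ 2 * alpha2 ≤ 3 * alpha2 * |ε| ^ 2 := by rw [← hsq]; linarith
        gcongr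
    _ = C * (3 * alpha2) * |ε| ^ 5 := by ring
    _ < C * (1 + 3 * alpha2) * |ε| ^ 5 := by gcongr; linarith
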